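/- \textbf{Theorem (Cauchy--Fueter formulas for doubly regular functions).} \emph{Conventions.} Let $e_0=1,e_1=i,e_2=j,e_3=k$ be the units of the quaternions $\mathbb H$, write $Z=\sum_i x^i e_i$, $Z^+=x^0e_0-x^1e_1-x^2e_2-x^3e_3$, $N(Z)=ZZ^+=\sum_i (x^i)^2$. Let $\mathbb H_{\mathbb C}=\mathbb C\otimes_{\mathbb R}\mathbb H$ be identified with $\mathbb C^{2\times 2}$ via $e_0=\begin{pmatrix}1&0\\0&1\end{pmatrix}$, $e_1=\begin{pmatrix}0&-i\\-i&0\end{pmatrix}$, $e_2=\begin{pmatrix}0&-1\\1&0\end{pmatrix}$, $e_3=\begin{pmatrix}-i&0\\0&i\end{pmatrix}$, and let $\mathbb S$ (columns) and $\mathbb S'$ (rows) be its standard two-dimensional left and right modules. Then $\mathbb H_{\mathbb C}\otimes\mathbb H_{\mathbb C}$ acts on $\mathbb S\otimes\mathbb S$ from the left and on $\mathbb S'\otimes\mathbb S'$ from the right; $\mathbb S\odot\mathbb S$ and $\mathbb S'\odot\mathbb S'$ denote the symmetric tensors. A $C^1$ function $f$ from an open set $V\subset\mathbb H$ to $\mathbb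 S\odot\mathbb S$ is \emph{doubly left regular} if $\sum_i (e_i\otimes 1)\frac{\partial f}{\partial x^i}=0$ and $\sum_i (1\otimes e_i)\frac{\partial f}{\partial x^i}=0$ on $V$; a $C^1$ function $g:V\to\mathbb S'\odot\mathbb S'$ is \emph{doubly right regular} if $\sum_i \frac{\partial g}{\partial x^i}(e_i\otimes 1)=0$ and $\sum_i \frac{\partial g}{\partial x^i}(1\otimes e_i)=0$ on $V$. Put $(\deg+2)f=\sum_i x^i\frac{\partial f}{\partial x^i}+2f$, $$k_1(Z-W)=\tfrac14(\nabla\otimes\nabla)\Bigl(\frac1{N(Z-W)}\Bigr)=\tfrac14\sum_{i,j}\frac{\partial^2}{\partial x^i\partial x^j}\Bigl(\frac1{N(Z-W)}\Bigr)\,e_i^+\otimes e_j^+,$$ with derivatives in $Z$, and let $Dz$ be the $\mathbb H$-valued $3$-form $$Dz=e_0\,dx^1\wedge dx^2\wedge dx^3-e_1\,dx^0\wedge dx^2\wedge dx^3+e_2\,dx^0\wedge dx^1\wedge dx^3-e_3\,dx^0\wedge dx^1\wedge dx^2 .$$ An open set $U\subset\mathbb H$ has \emph{piecewise $C^1$ boundary}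 if $\partial U$ has finite $3$-dimensional surface (Hausdorff) measure and, apart from a subset of surface measure zero, every point of $\partial U$ has a neighbourhood in which $\partial U$ is a $C^1$ hypersurface with $U$ on exactly one side. $\partial U$ is oriented by the outward unit normal $n$: tangent vectors $\tau_1,\tau_2,\tau_3$ are positively oriented iff $(n,\tau_1,\tau_2,\tau_3)$ has the orientation of $(e_0,e_1,e_2,e_3)$. \emph{Statement.} Let $U\subset\mathbb H$ be an open bounded subset with piecewise $C^1$ boundary. If $f$ is doubly left regular on an open neighbourhood of $\overline U$, then $$\frac1{2\pi^2}\int_{\partial U}k_1(Z-W)\cdot(Dz\otimes Z)\cdot f(Z)=\frac1{2\pi^2}\int_{\partial U}k_1(Z-W)\cdot(Z\otimes Dz)\cdot f(Z)=\begin{cases}(\deg+2)f(W)&\text{if }W\in U,\\0&\text{if }W\notin\overline U.\end{cases}$$ If $g$ is doubly right regular on an open neighbourhood of $\overline U$, then $$\frac1{2\pi^2}\int_{\partial U}g(Z)\cdot(Dz\otimes Z)\cdot k_1(Z-W)=\frac1{2\pi^2}\int_{\partial U}g(Z)\cdot(Z\otimes Dz)\cdot k_1(Z-W)=\begin{cases}(\deg+2)g(W)&\text{if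 }W\in U,\\0&\text{if }W\notin\overline U.\end{cases}$$ All these integrals converge absolutely. -/

import Mathlib

open MeasureTheory Filter Topology Matrix
open scoped Quaternion Kronecker ENNReal

noncomputable section

namespace DoublyRegular

/-! ### Quaternions -/

instance instMeasurableSpaceQuaternion : MeasurableSpace ℍ := borel ℍ

instance instBorelSpaceQuaternion : BorelSpace ℍ := ⟨rfl⟩

/-- The quaternion `a + b i + c j + d k`. -/
def quat (a b c d : ℝ) : ℍ := ⟨a, b, c, d⟩

@[simp] lemma quat_re (a b c d : ℝ) : (quat a b c d).re = a := rfl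

@[simp] lemma quat_imI (a b c d : ℝ) : (quat a b c d).imI = b := rfl

@[simp] lemma quat_imJ (a b c d : ℝ) : (quat a b c d).imJ = c := rfl

@[simp] lemma quat_imK (a b c d : ℝ) : (quat a b c d).imK = d := rfl

/-- The units `e₀ = 1`, `e₁ = i`, `e₂ = j`, `e₃ = k` of the quaternions. -/
def e : Fin 4 → ℍ := ![quat 1 0 0 0, quat 0 1 0 0, quat 0 0 1 0, quat 0 0 0 1]

/-- The real coordinates: `Z = ∑ i, coord i Z • e i`. -/
def coord : Fin 4 → ℍ →ₗ[ℝ] ℝ :=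
  ![QuaternionAlgebra.reₗ _ _ _, QuaternionAlgebra.imIₗ _ _ _,
    QuaternionAlgebra.imJₗ _ _ _, QuaternionAlgebra.imKₗ _ _ _]

lemma sum_coord_smul_e (Z : ℍ) : ∑ i, coord i Z • e i = Z := by
  have h0 : coord 0 Z = Z.re := rfl
  have h1 : coord 1 Z = Z.imI := rfl
  have h2 : coord 2 Z = Z.imJ := rfl
  have h3 : coord 3 Z = Z.imK := rfl
  apply Quaternion.ext <;> simp [Fin.sum_univ_four, e, h0, h1, h2, h3]

/-- The standard realization of `ℍ` as a real subalgebra of the complex `2 × 2` matrices, with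
`e₁ ↦ (0, -i; -i, 0)`, `e₂ ↦ (0, -1; 1, 0)`, `e₃ ↦ (-i, 0; 0, i)`.  It identifies the complexified
quaternions with all complex `2 × 2` matrices. -/
def toMat : ℍ →ₐ[ℝ] Matrix (Fin 2) (Fin 2) ℂ :=
  AlgHom.ofLinearMap
    { toFun := fun q =>
        !![(q.re : ℂ) - Complex.I * q.imK, -(Complex.I * q.imI) - q.imJ;
           -(Complex.I * q.imI) + q.imJ, (q.re : ℂ) + Complex.I * q.imK]
      map_add' := by
        intro p q
        ext a b
        fin_cases a <;> fin_cases b <;> simp <;> ring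
      map_smul' := by
        intro r q
        ext a b
        fin_cases a <;> fin_cases b <;> simp <;> ring }
    (by
      ext a b
      fin_cases a <;> fin_cases b <;> simp)
    (by
      intro p q
      ext a b
      fin_cases a <;> fin_cases b <;> simp [Matrix.mul_apply, Fin.sum_univ_two] <;>
        ring_nf <;> simp only [Complex.I_sq] <;> ring)

/-! ### The tensor squares of the spinor modules

The irreducible module `𝕊` is realized as columns and `𝕊'` as rows of two complex numbers.
An element of `𝕊 ⊗ 𝕊` or of `𝕊' ⊗ 𝕊'` is its array of coordinates, `u ⊗ v` being
`(a, b) ↦ u a * v b`.  The algebra `ℍ_ℂ ⊗ ℍ_ℂ` is realized through the Kronecker product, acting on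
`𝕊 ⊗ 𝕊` on the left (`*ᵥ`) and on `𝕊' ⊗ 𝕊'` on the right (`ᵥ*`). -/

/-- The coordinate space underlying both `𝕊 ⊗ 𝕊` (columns) and `𝕊' ⊗ 𝕊'` (rows). -/
abbrev Spinor2 : Type := Fin 2 × Fin 2 → ℂ

/-- `ℍ_ℂ ⊗ ℍ_ℂ` as `4 × 4` matrices. -/
abbrev Mat4 : Type := Matrix (Fin 2 × Fin 2) (Fin 2 × Fin 2) ℂ

/-- The element `p ⊗ q` of `ℍ_ℂ ⊗ ℍ_ℂ`, for quaternions `p` and `q`. -/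
def tens (p q : ℍ) : Mat4 := toMat p ⊗ₖ toMat q

/-- Membership in the symmetric part `𝕊 ⊙ 𝕊` (or `𝕊' ⊙ 𝕊'`). -/
def IsSymmTensor (t : Spinor2) : Prop := ∀ a b, t (a, b) = t (b, a)

/-! ### Differential operators -/

/-- The partial derivative `∂f/∂xⁱ`. -/
def pd {E : Type*} [NormedAddCommGroup E] [NormedSpace ℝ E] (i : Fin 4) (f : ℍ → E) (Z : ℍ) : E :=
  fderiv ℝ f Z (e i)

/-- `f` is doubly left regular on the open set `V`: it is `C¹` there, takes values in `𝕊 ⊙ 𝕊`, and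
`(∇⁺ ⊗ 1) f = 0 = (1 ⊗ ∇⁺) f`, where `∇⁺ = ∑ eᵢ ∂/∂xⁱ`. -/
structure DoublyLeftRegularOn (f : ℍ → Spinor2) (V : Set ℍ) : Prop where
  contDiffOn : ContDiffOn ℝ 1 f V
  symm : ∀ Z ∈ V, IsSymmTensor (f Z)
  left : ∀ Z ∈ V, ∑ i, tens (e i) 1 *ᵥ pd i f Z = 0
  right : ∀ Z ∈ V, ∑ i, tens 1 (e i) *ᵥ pd i f Z = 0

/-- `g` is doubly right regular on the open set `V`: it is `C¹` there, takes values in `𝕊' ⊙ 𝕊'`,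
and is annihilated by `∇⁺ ⊗ 1` and `1 ⊗ ∇⁺` acting from the right. -/
structure DoublyRightRegularOn (g : ℍ → Spinor2) (V : Set ℍ) : Prop where
  contDiffOn : ContDiffOn ℝ 1 g V
  symm : ∀ Z ∈ V, IsSymmTensor (g Z)
  left : ∀ Z ∈ V, ∑ i, pd i g Z ᵥ* tens (e i) 1 = 0
  right : ∀ Z ∈ V, ∑ i, pd i g Z ᵥ* tens 1 (e i) = 0

/-- `(deg + 2) f = ∑ xⁱ ∂f/∂xⁱ + 2 f`. -/
def degAddTwo (f : ℍ → Spinor2) (W : ℍ) : Spinor2 :=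
  ∑ i, coord i W • pd i f W + (2 : ℝ) • f W

/-- The kernel `k₁(X) = ¼ (∇ ⊗ ∇) (1 / N(X))`, where `∇ = e₀ ∂₀ - e₁ ∂₁ - e₂ ∂₂ - e₃ ∂₃`, that is
`∇ = ∑ eᵢ⁺ ∂ᵢ` with `⁺` the quaternionic conjugation, and `N(X) = X X⁺`. -/
def k₁ (X : ℍ) : Mat4 :=
  (1 / 4 : ℝ) • ∑ i, ∑ j,
    pd i (pd j fun Y : ℍ => 1 / Quaternion.normSq Y) X • tens (star (e i)) (star (e j))

/-! ### Differential 3-forms -/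

/-- The real 3-form `dxᵃ ∧ dxᵇ ∧ dxᶜ` on `ℍ`. -/
def dx3 (a b c : Fin 4) : ℍ [⋀^Fin 3]→ₗ[ℝ] ℝ :=
  (Matrix.detRowAlternating (R := ℝ) (n := Fin 3)).compLinearMap
    (LinearMap.pi ![coord a, coord b, coord c])

/-- The quaternion valued 3-form
`Dz = e₀ dx¹∧dx²∧dx³ - e₁ dx⁰∧dx²∧dx³ + e₂ dx⁰∧dx¹∧dx³ - e₃ dx⁰∧dx¹∧dx²`. -/
def Dz : ℍ [⋀^Fin 3]→ₗ[ℝ] ℍ :=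
  (LinearMap.toSpanSingleton ℝ ℍ (e 0)).compAlternatingMap (dx3 1 2 3)
  - (LinearMap.toSpanSingleton ℝ ℍ (e 1)).compAlternatingMap (dx3 0 2 3)
  + (LinearMap.toSpanSingleton ℝ ℍ (e 2)).compAlternatingMap (dx3 0 1 3)
  - (LinearMap.toSpanSingleton ℝ ℍ (e 3)).compAlternatingMap (dx3 0 1 2)

/-- `p ↦ p ⊗ Z` as a linear map. -/
def tensRight (Z : ℍ) : ℍ →ₗ[ℝ] Mat4 where
  toFun p := tens p Z
  map_add' p q := by simp [tens, Matrix.add_kronecker]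
  map_smul' r p := by simp [tens, Matrix.smul_kronecker]

/-- `p ↦ Z ⊗ p` as a linear map. -/
def tensLeft (Z : ℍ) : ℍ →ₗ[ℝ] Mat4 where
  toFun p := tens Z p
  map_add' p q := by simp [tens, Matrix.kronecker_add]
  map_smul' r p := by simp [tens, Matrix.kronecker_smul]

/-- The 3-form `Dz ⊗ Z`. -/
def DzTensZ (Z : ℍ) : ℍ [⋀^Fin 3]→ₗ[ℝ] Mat4 := (tensRight Z).compAlternatingMap Dz

/-- The 3-form `Z ⊗ Dz`. -/
def ZTensDz (Z : ℍ) : ℍ [⋀^Fin 3]→ₗ[ℝ] Mat4 := (tensLeft Z).compAlternatingMap Dz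

/-- `M ↦ K · M · t`, for `K` in `ℍ_ℂ ⊗ ℍ_ℂ` and `t` in `𝕊 ⊗ 𝕊`. -/
def sandwichLeft (K : Mat4) (t : Spinor2) : Mat4 →ₗ[ℝ] Spinor2 where
  toFun M := (K * M) *ᵥ t
  map_add' M N := by simp [Matrix.mul_add, Matrix.add_mulVec]
  map_smul' r M := by simp [Matrix.smul_mulVec]

/-- `M ↦ t · M · K`, for `t` in `𝕊' ⊗ 𝕊'` and `K` in `ℍ_ℂ ⊗ ℍ_ℂ`. -/
def sandwichRight (t : Spinor2) (K : Mat4) : Mat4 →ₗ[ℝ] Spinor2 where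
  toFun M := t ᵥ* (M * K)
  map_add' M N := by simp [Matrix.add_mul, Matrix.vecMul_add]
  map_smul' r M := by simp [Matrix.vecMul_smul]

/-- The 3-form `k₁(Z - W) · ω(Z) · f(Z)` in the variable `Z`. -/
def leftForm (ω : ℍ → ℍ [⋀^Fin 3]→ₗ[ℝ] Mat4) (f : ℍ → Spinor2) (W Z : ℍ) :
    ℍ [⋀^Fin 3]→ₗ[ℝ] Spinor2 :=
  (sandwichLeft (k₁ (Z - W)) (f Z)).compAlternatingMap (ω Z)

/-- The 3-form `g(Z) · ω(Z) · k₁(Z - W)` in the variable `Z`. -/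
def rightForm (ω : ℍ → ℍ [⋀^Fin 3]→ₗ[ℝ] Mat4) (g : ℍ → Spinor2) (W Z : ℍ) :
    ℍ [⋀^Fin 3]→ₗ[ℝ] Spinor2 :=
  (sandwichRight (g Z) (k₁ (Z - W))).compAlternatingMap (ω Z)

/-! ### Piecewise `C¹` boundaries and integration over them -/

/-- Near `p` the set `U` is the side `ρ < 0` of the `C¹` hypersurface `ρ = 0` through `p`, and `n` is
the unit normal of that hypersurface at `p` which points out of `U`. -/
def IsOutwardUnitNormal (U : Set ℍ) (p n : ℍ) : Prop :=
  ‖n‖ = 1 ∧ ∃ ρ : ℍ → ℝ, ContDiffAt ℝ 1 ρ p ∧ ρ p = 0 ∧ HasGradientAt ρ n p ∧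
    ∀ᶠ Z in 𝓝 p, Z ∈ U ↔ ρ Z < 0

lemma eventually_pos_of_hasGradientAt {ρ : ℍ → ℝ} {p n v : ℍ} (h0 : ρ p = 0)
    (h : HasGradientAt ρ n p) (hv : 0 < inner ℝ n v) :
    ∀ᶠ t : ℝ in 𝓝[>] 0, 0 < ρ (p + t • v) := by
  have hd : HasDerivAt (fun t : ℝ => ρ (p + t • v)) (inner ℝ n v) 0 := by
    have h1 : HasDerivAt (fun t : ℝ => p + t • v) v 0 := by
      simpa using ((hasDerivAt_id (0 : ℝ)).smul_const v).const_add p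
    have h2 : HasFDerivAt ρ (InnerProductSpace.toDual ℝ ℍ n) (p + (0 : ℝ) • v) := by
      simpa using h.hasFDerivAt
    have h3 := h2.comp_hasDerivAt (0 : ℝ) h1
    rw [InnerProductSpace.toDual_apply_apply] at h3
    exact h3
  have ht := (hasDerivAt_iff_tendsto_slope.1 hd).mono_left
    (nhdsWithin_mono (0 : ℝ) (s := Set.Ioi 0) (fun x hx => ne_of_gt hx))
  filter_upwards [ht.eventually (lt_mem_nhds hv), self_mem_nhdsWithin] with t h1 h2
  have h3 : (0 : ℝ) < t := h2
  simp only [slope, sub_zero, zero_smul, add_zero, h0, vsub_eq_sub, smul_eq_mul] at h1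
  exact (pos_iff_pos_of_mul_pos h1).1 (inv_pos.2 h3)

/-- The outward unit normal at a boundary point is unique. -/
lemma IsOutwardUnitNormal.eq {U : Set ℍ} {p n m : ℍ} (hn : IsOutwardUnitNormal U p n)
    (hm : IsOutwardUnitNormal U p m) : n = m := by
  obtain ⟨hn1, ρ, -, hρ0, hρ, hU⟩ := hn
  obtain ⟨hm1, σ, -, hσ0, hσ, hU'⟩ := hm
  by_contra hne
  have hlt : inner ℝ n m < 1 := by
    refine lt_of_le_of_ne (by simpa [hn1, hm1] using real_inner_le_norm n m) fun h => hne ?_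
    exact (inner_eq_one_iff_of_norm_eq_one hn1 hm1).1 h
  have h1 : 0 < inner ℝ m (m - n) := by
    rw [inner_sub_right, real_inner_self_eq_norm_sq, hm1, real_inner_comm]; linarith
  have h2 : 0 < inner ℝ (-n) (m - n) := by
    rw [inner_neg_left, inner_sub_right, real_inner_self_eq_norm_sq, hn1]; linarith
  have hneg : HasGradientAt (fun Z => -ρ Z) (-n) p := by
    rw [hasGradientAt_iff_hasFDerivAt, map_neg]
    exact hρ.hasFDerivAt.neg
  have hc : Tendsto (fun t : ℝ => p + t • (m - n)) (𝓝[>] 0) (𝓝 p) := by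
    have : Continuous fun t : ℝ => p + t • (m - n) := by fun_prop
    simpa using (this.tendsto 0).mono_left nhdsWithin_le_nhds
  obtain ⟨t, ha, hb, hc1, hc2⟩ := ((eventually_pos_of_hasGradientAt hσ0 hσ h1).and
    ((eventually_pos_of_hasGradientAt (by simpa using hρ0) hneg h2).and
      ((hc.eventually hU).and (hc.eventually hU')))).exists
  have h3 := hc2.1 (hc1.2 (by linarith))
  linarith

/-- `U` has piecewise `C¹` boundary: the boundary has finite 3-dimensional surface measure, and away
from a set of surface measure zero (edges, corners, and the like) it is locally a `C¹` hypersurface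
with `U` on exactly one side of it.  This holds in particular when `∂U` is a finite union of compact
`C¹` pieces that meet only along lower-dimensional sets, `U` lying on one side of each piece. -/
structure HasPiecewiseC1Boundary (U : Set ℍ) : Prop where
  finite_area : μHE[3] (frontier U) < ∞
  null_singular : μHE[3] {p ∈ frontier U | ¬ ∃ n, IsOutwardUnitNormal U p n} = 0

open Classical in
/-- The outward unit normal field of `U` on the nonsingular part of its boundary (zero elsewhere). -/
def outwardNormal (U : Set ℍ) (p : ℍ) : ℍ :=
  if h : ∃ n, IsOutwardUnitNormal U p n then h.choose else 0

/-- For a unit quaternion `n`, the vectors `n i`, `n j`, `n k` form an orthonormal basis of the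
orthogonal complement of `n`, oriented so that `(n, n i, n j, n k)` is positively oriented in `ℍ`. -/
def tangentFrame (n : ℍ) : Fin 3 → ℍ := ![n * e 1, n * e 2, n * e 3]

lemma orthonormal_tangentFrame {n : ℍ} (hn : ‖n‖ = 1) :
    Orthonormal ℝ ![n, n * e 1, n * e 2, n * e 3] := by
  have h : n.re ^ 2 + n.imI ^ 2 + n.imJ ^ 2 + n.imK ^ 2 = 1 := by
    rw [← Quaternion.normSq_def', Quaternion.normSq_eq_norm_mul_self, hn, one_mul]
  have h1 : n * e 1 = quat (-n.imI) (n.re) (n.imK) (-n.imJ) := by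
    apply Quaternion.ext <;> simp [e]
  have h2 : n * e 2 = quat (-n.imJ) (-n.imK) (n.re) (n.imI) := by
    apply Quaternion.ext <;> simp [e]
  have h3 : n * e 3 = quat (-n.imK) (n.imJ) (-n.imI) (n.re) := by
    apply Quaternion.ext <;> simp [e]
  rw [h1, h2, h3, orthonormal_iff_ite]
  intro a b
  fin_cases a <;> fin_cases b <;>
    simp [Quaternion.inner_def, -inner_self_eq_norm_sq_to_K] <;> linarith

lemma det_tangentFrame {n : ℍ} (hn : ‖n‖ = 1) :
    (Matrix.of fun a b => coord b (![n, n * e 1, n * e 2, n * e 3] a)).det = 1 := by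
  have h : n.re ^ 2 + n.imI ^ 2 + n.imJ ^ 2 + n.imK ^ 2 = 1 := by
    rw [← Quaternion.normSq_def', Quaternion.normSq_eq_norm_mul_self, hn, one_mul]
  have h1 : n * e 1 = quat (-n.imI) (n.re) (n.imK) (-n.imJ) := by
    apply Quaternion.ext <;> simp [e]
  have h2 : n * e 2 = quat (-n.imJ) (-n.imK) (n.re) (n.imI) := by
    apply Quaternion.ext <;> simp [e]
  have h3 : n * e 3 = quat (-n.imK) (n.imJ) (-n.imI) (n.re) := by
    apply Quaternion.ext <;> simp [e]
  have hM : (Matrix.of fun a b => coord b (![n, n * e 1, n * e 2, n * e 3] a)) =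
      !![n.re, n.imI, n.imJ, n.imK; -n.imI, n.re, n.imK, -n.imJ;
         -n.imJ, -n.imK, n.re, n.imI; -n.imK, n.imJ, -n.imI, n.re] := by
    rw [h1, h2, h3]
    ext a b
    fin_cases a <;> fin_cases b <;> rfl
  rw [hM]
  simp [Matrix.det_succ_row_zero, Fin.sum_univ_succ, Fin.succAbove]
  linear_combination (n.re ^ 2 + n.imI ^ 2 + n.imJ ^ 2 + n.imK ^ 2 + 1) * h

/-- The density of the 3-form `ω` with respect to surface measure on `∂U`, where `∂U` is oriented by
the outward normal: the value of `ω` on a positively oriented orthonormal tangent frame. -/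
def boundaryDensity {E : Type*} [AddCommGroup E] [Module ℝ E] (U : Set ℍ)
    (ω : ℍ → ℍ [⋀^Fin 3]→ₗ[ℝ] E) (p : ℍ) : E :=
  ω p (tangentFrame (outwardNormal U p))

/-- The 3-form `ω` is (absolutely) integrable over `∂U`. -/
def BoundaryIntegrable {E : Type*} [NormedAddCommGroup E] [NormedSpace ℝ E] (U : Set ℍ)
    (ω : ℍ → ℍ [⋀^Fin 3]→ₗ[ℝ] E) : Prop :=
  IntegrableOn (boundaryDensity U ω) (frontier U) μHE[3]

/-- The integral of the 3-form `ω` over `∂U`, oriented by the outward normal of `U`. -/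
def boundaryIntegral {E : Type*} [NormedAddCommGroup E] [NormedSpace ℝ E] (U : Set ℍ)
    (ω : ℍ → ℍ [⋀^Fin 3]→ₗ[ℝ] E) : E :=
  ∫ p in frontier U, boundaryDensity U ω p ∂μHE[3]

end DoublyRegular

end

/-! Algebra. Write A(p) for the action of p ⊗ 1 and B(q) for that of 1 ⊗ q. They commute, and each
satisfies the Clifford relation A(p⁺)A(q) + A(q⁺)A(p) = 2⟨p, q⟩ (`CliffordPair`). The only other
fact needed about spinors is that Σ A(eᵢ)B(eᵢ) annihilates symmetric tensors. The left and right
formulas, and (by exchanging A and B) the forms Dz ⊗ Z and Z ⊗ Dz, are therefore four instances of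
one abstract statement, `CliffordPair.cauchyFueter`.

Analysis. On an oriented orthonormal tangent frame Dz takes the value n, so the integrand is the
normal component of the field Fᵢ(Z) = K(Z − W) A(eᵢ) B(Z) f(Z), where K(X) = 2A(X⁺)B(X⁺)/N(X)³ − ½
ΣA(eᵢ⁺)B(eᵢ⁺)/N(X)² is the explicit form of k₁. Away from W the field is divergence free, because Σ
∂ᵢK A(eᵢ) = 0, Σ A(eᵢ)B(eᵢ) f = 0 and Σ A(eᵢ)∂ᵢf = 0 (`CliffordPair.sum_pd_fluxField`). Hence the
flux vanishes for W outside the closure. For W inside, F is multiplied by a cutoff χ that vanishes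
near W and equals 1 off a ball of radius r; the flux becomes the integral of ∇χ · F over that ball.
As K(X)A(X) = N(X)⁻²(B(X⁺) + ½A(X⁺)ΣA(eᵢ)B(eᵢ⁺)) has degree −3, the substitution Z = W + rY leaves
one term of order 1/r. Its leading part is odd in Y and integrates to zero, so a limit exists as r →
0. Isotropy of radial second moments and the Clifford relations evaluate that limit as 2π² · ¼(4 deg
f + 8 f).

Divergence theorem (`gaussGreen`). Near a regular boundary point U lies under a Lipschitz graph with
arbitrarily small constant, and there the theorem holds up to ε∫‖g‖ over the boundary; this needs no
area formula. Such defects add without loss under a partition of unity, so ε may tend to 0 globally.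
The singular set has zero 3-dimensional measure, and it is removed by cutoffs whose gradients are
small in L¹. -/

open MeasureTheory Filter Topology Matrix
open scoped Quaternion Kronecker ENNReal

noncomputable section

namespace DoublyRegular

/-! ### Orthonormal cylindrical coordinates along a given axis. -/

section GraphCoordinates

variable {H : Type*} [NormedAddCommGroup H] [InnerProductSpace ℝ H] {d : ℕ}

/-- Cylindrical coordinates around `p` with axis `n`. -/
def cylCoord (p n : H) (ψ : EuclideanSpace ℝ (Fin d) →ₗᵢ[ℝ] H) (z : EuclideanSpace ℝ (Fin d) × ℝ) :
    H := p + ψ z.1 + z.2 • n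

/-- `n` is a unit vector orthogonal to the range of `ψ`. -/
structure IsAxis (n : H) (ψ : EuclideanSpace ℝ (Fin d) →ₗᵢ[ℝ] H) : Prop where
  norm_eq : ‖n‖ = 1
  inner_eq : ∀ y, inner ℝ n (ψ y) = 0

lemma exists_isAxis [FiniteDimensional ℝ H] (hd : Module.finrank ℝ H = d + 1) {n : H}
    (hn : ‖n‖ = 1) : ∃ ψ : EuclideanSpace ℝ (Fin d) →ₗᵢ[ℝ] H, IsAxis n ψ := by
  have hn0 : n ≠ 0 := fun h => by simp [h] at hn
  have : Fact (Module.finrank ℝ H = d + 1) := ⟨hd⟩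
  have h1 : Module.finrank ℝ (ℝ ∙ n)ᗮ = d := Submodule.finrank_orthogonal_span_singleton hn0
  let b := (stdOrthonormalBasis ℝ (ℝ ∙ n)ᗮ).reindex (finCongr h1)
  refine ⟨(Submodule.subtypeₗᵢ _).comp b.repr.symm.toLinearIsometry, hn, fun y => ?_⟩
  exact Submodule.mem_orthogonal_singleton_iff_inner_right.1 (b.repr.symm y).2

namespace IsAxis

variable {n : H} {ψ : EuclideanSpace ℝ (Fin d) →ₗᵢ[ℝ] H}

lemma norm_sq (h : IsAxis n ψ) (y : EuclideanSpace ℝ (Fin d)) (t : ℝ) :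
    ‖ψ y + t • n‖ ^ 2 = ‖y‖ ^ 2 + t ^ 2 := by
  rw [norm_add_sq_real, inner_smul_right, real_inner_comm, h.inner_eq, norm_smul, h.norm_eq,
    ψ.norm_map]
  simp

lemma norm_le (h : IsAxis n ψ) (y : EuclideanSpace ℝ (Fin d)) (t : ℝ) :
    ‖ψ y + t • n‖ ≤ ‖y‖ + |t| := by
  refine (norm_add_le _ _).trans ?_
  rw [norm_smul, h.norm_eq, ψ.norm_map]; simp

lemma inner_cyl (h : IsAxis n ψ) (y : EuclideanSpace ℝ (Fin d)) (t : ℝ) :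
    inner ℝ n (ψ y + t • n) = t := by
  rw [inner_add_right, h.inner_eq, inner_smul_right, real_inner_self_eq_norm_sq, h.norm_eq]
  simp

lemma cylCoord_sub (p : H) (z w : EuclideanSpace ℝ (Fin d) × ℝ) :
    cylCoord p n ψ z - cylCoord p n ψ w = ψ (z.1 - w.1) + (z.2 - w.2) • n := by
  simp only [cylCoord, map_sub, sub_smul]; abel

lemma cylCoord_sub_self (p : H) (z : EuclideanSpace ℝ (Fin d) × ℝ) :
    cylCoord p n ψ z - p = ψ z.1 + z.2 • n := by
  simp only [cylCoord]; abel

lemma continuous_cylCoord (p : H) : Continuous (cylCoord p n ψ) := by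
  have := ψ.continuous
  unfold cylCoord; fun_prop

lemma injective_cylCoord (h : IsAxis n ψ) (p : H) : Function.Injective (cylCoord p n ψ) := by
  intro z w hzw
  have h1 := cylCoord_sub (n := n) (ψ := ψ) p z w
  rw [hzw, sub_self] at h1
  have h2 := h.norm_sq (z.1 - w.1) (z.2 - w.2)
  rw [← h1, norm_zero] at h2
  have h3 : ‖z.1 - w.1‖ = 0 := by nlinarith [sq_nonneg (z.2 - w.2), sq_nonneg ‖z.1 - w.1‖]
  have h4 : z.2 - w.2 = 0 := by nlinarith [sq_nonneg (z.2 - w.2), sq_nonneg ‖z.1 - w.1‖]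
  exact Prod.ext (sub_eq_zero.1 (norm_eq_zero.1 h3)) (sub_eq_zero.1 h4)

variable [FiniteDimensional ℝ H]

/-- The linear part of the cylindrical coordinates as a linear isometric equivalence. -/
def isometryEquiv (h : IsAxis n ψ) (hd : Module.finrank ℝ H = d + 1) :
    WithLp 2 (EuclideanSpace ℝ (Fin d) × ℝ) ≃ₗᵢ[ℝ] H :=
  LinearIsometry.toLinearIsometryEquiv
    { toFun := fun z => ψ z.fst + z.snd • n
      map_add' := fun z w => by simp [add_smul]; abel
      map_smul' := fun r z => by simp [mul_smul]
      norm_map' := fun z => by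
        have h1 := h.norm_sq z.fst z.snd
        have h2 : ‖z‖ ^ 2 = ‖z.fst‖ ^ 2 + ‖z.snd‖ ^ 2 := by
          rw [WithLp.prod_norm_sq_eq_of_L2]
        rw [Real.norm_eq_abs, sq_abs, ← h1] at h2
        exact ((sq_eq_sq₀ (norm_nonneg _) (norm_nonneg _)).1 h2).symm }
    (by
      rw [hd, LinearEquiv.finrank_eq (WithLp.linearEquiv 2 ℝ _)]; simp)

lemma surjective_cylCoord (h : IsAxis n ψ) (hd : Module.finrank ℝ H = d + 1) (p : H) :
    Function.Surjective (cylCoord p n ψ) := by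
  intro q
  obtain ⟨z, hz⟩ := (h.isometryEquiv hd).surjective (q - p)
  refine ⟨(z.fst, z.snd), ?_⟩
  have h1 : ψ z.fst + z.snd • n = q - p := hz
  simp only [cylCoord, add_assoc, h1]; abel

variable [MeasurableSpace H] [BorelSpace H]

/-- The product `EuclideanSpace × ℝ` carries the sup norm, so the coordinate map is not an isometry.
It becomes one, up to translation, on the L² product, which has the same volume. -/
lemma measurePreserving_cylCoord (h : IsAxis n ψ) (hd : Module.finrank ℝ H = d + 1) (p : H) :
    MeasurePreserving (cylCoord p n ψ) := by
  have h1 := (measurePreserving_add_left (volume : Measure H) p).comp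
    ((h.isometryEquiv hd).measurePreserving.comp
      (WithLp.volume_preserving_toLp (EuclideanSpace ℝ (Fin d)) ℝ))
  have h2 : cylCoord p n ψ = (fun x => p + x) ∘ (h.isometryEquiv hd ∘ WithLp.toLp 2) := by
    funext z
    exact add_assoc p (ψ z.1) (z.2 • n)
  rw [h2]; exact h1

omit [FiniteDimensional ℝ H] in
lemma measurableEmbedding_cylCoord (h : IsAxis n ψ) (p : H) :
    MeasurableEmbedding (cylCoord p n ψ) :=
  (continuous_cylCoord p).measurableEmbedding (h.injective_cylCoord p)

end IsAxis

end GraphCoordinates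

/-! ### An approximate divergence theorem below a Lipschitz graph. -/

section Subgraph

variable {Y : Type*} [NormedAddCommGroup Y] [InnerProductSpace ℝ Y] [FiniteDimensional ℝ Y]
  [MeasurableSpace Y] [BorelSpace Y]
variable {E : Type*} [NormedAddCommGroup E] [NormedSpace ℝ E]

/-- The set of points below the graph of `φ`. -/
def subgraph (φ : Y → ℝ) : Set (Y × ℝ) := {z | z.2 < φ z.1}

omit [InnerProductSpace ℝ Y] [FiniteDimensional ℝ Y] in
lemma measurableSet_subgraph {φ : Y → ℝ} (hφ : Continuous φ) : MeasurableSet (subgraph φ) :=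
  measurableSet_lt measurable_snd (hφ.measurable.comp measurable_fst)

lemma setIntegral_subgraph {φ : Y → ℝ} (hφ : Continuous φ) {F : Y × ℝ → E} (hF : Integrable F) :
    Integrable (fun y => ∫ t in Set.Iic (φ y), F (y, t)) ∧
    ∫ z in subgraph φ, F z = ∫ y, ∫ t in Set.Iic (φ y), F (y, t) := by
  have h1 : Integrable ((subgraph φ).indicator F) (volume.prod volume) :=
    hF.indicator (measurableSet_subgraph hφ)
  have h2 : ∀ y, ∫ t in Set.Iic (φ y), F (y, t) = ∫ t, (subgraph φ).indicator F (y, t) := by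
    intro y
    rw [integral_Iic_eq_integral_Iio, ← integral_indicator measurableSet_Iio]
    rfl
  simp only [h2]
  refine ⟨h1.integral_prod_left, ?_⟩
  rw [← integral_indicator (measurableSet_subgraph hφ), ← integral_prod _ h1]
  rfl

omit [FiniteDimensional ℝ Y] [MeasurableSpace Y] [BorelSpace Y] in
lemma contDiff_section {g : Y × ℝ → E} (hg : ContDiff ℝ 1 g) (y : Y) :
    ContDiff ℝ 1 fun t => g (y, t) := hg.comp (contDiff_const.prodMk contDiff_id)

omit [InnerProductSpace ℝ Y] [FiniteDimensional ℝ Y] [MeasurableSpace Y] [BorelSpace Y]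
  [NormedSpace ℝ E] in
lemma hasCompactSupport_section {g : Y × ℝ → E} (hc : HasCompactSupport g) (y : Y) :
    HasCompactSupport fun t => g (y, t) := by
  refine HasCompactSupport.of_support_subset_isCompact (hc.image continuous_snd) fun t ht => ?_
  exact ⟨(y, t), subset_tsupport _ ht, rfl⟩

/-- Fubini and the fundamental theorem of calculus on each vertical half-line; compact support
removes the contribution at −∞. -/
lemma setIntegral_subgraph_vertical [CompleteSpace E] {φ : Y → ℝ} (hφ : Continuous φ)
    {g : Y × ℝ → E} (hg : ContDiff ℝ 1 g) (hc : HasCompactSupport g) :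
    ∫ z in subgraph φ, fderiv ℝ g z (0, 1) = ∫ y, g (y, φ y) := by
  have hi : Integrable fun z => fderiv ℝ g z (0, 1) :=
    ((hg.continuous_fderiv one_ne_zero).clm_apply continuous_const).integrable_of_hasCompactSupport
      (hc.fderiv_apply ℝ _)
  rw [(setIntegral_subgraph hφ hi).2]
  congr 1; funext y
  rw [← (hasCompactSupport_section hc y).integral_Iic_deriv_eq (contDiff_section hg y)]
  congr 1; funext t
  have h1 : HasDerivAt (fun t : ℝ => (y, t)) ((0 : Y), (1 : ℝ)) t :=
    (hasDerivAt_const t y).prodMk (hasDerivAt_id t)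
  exact ((((hg.differentiable one_ne_zero) (y, t)).hasFDerivAt.comp_hasDerivAt t h1).deriv).symm

omit [InnerProductSpace ℝ Y] [FiniteDimensional ℝ Y] in
lemma integrable_graph {μ : Measure Y} [IsFiniteMeasureOnCompacts μ] {φ : Y → ℝ}
    (hφ : Continuous φ) {F : Type*} [NormedAddCommGroup F]
    {g : Y × ℝ → F} (hg : Continuous g) (hc : HasCompactSupport g) :
    Integrable (fun y => g (y, φ y)) μ := by
  refine Continuous.integrable_of_hasCompactSupport (by fun_prop) ?_
  refine HasCompactSupport.of_support_subset_isCompact (hc.image continuous_fst) fun y hy => ?_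
  exact ⟨(y, φ y), subset_tsupport _ hy, rfl⟩

lemma hasDerivAt_setIntegral_translate {g : Y × ℝ → E} (hg : ContDiff ℝ 1 g)
    (hc : HasCompactSupport g) (s : Set (Y × ℝ)) (a : Y × ℝ) :
    HasDerivAt (fun τ : ℝ => ∫ z in s, g (z + τ • a)) (∫ z in s, fderiv ℝ g z a) 0 := by
  have hcf : HasCompactSupport (fun z => fderiv ℝ g z a) := hc.fderiv_apply ℝ _
  have hct : Continuous (fun z => fderiv ℝ g z a) :=
    (hg.continuous_fderiv one_ne_zero).clm_apply continuous_const
  obtain ⟨C, hC⟩ := hcf.exists_bound_of_continuous hct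
  -- For |τ| < 1 all translates of `g` by `τ • a` are supported in this compact set, so a constant
  -- on it dominates the difference quotients.
  let K : Set (Y × ℝ) := Metric.cthickening ‖a‖ (tsupport g)
  have hK : IsCompact K := hc.isCompact.cthickening
  have key := hasDerivAt_integral_of_dominated_loc_of_deriv_le (𝕜 := ℝ) (μ := volume.restrict s)
    (F := fun τ z => g (z + τ • a)) (F' := fun τ z => fderiv ℝ g (z + τ • a) a) (x₀ := 0)
    (s := Metric.ball 0 1) (bound := K.indicator fun _ => C) (Metric.ball_mem_nhds _ one_pos)
    (Eventually.of_forall fun τ => (Continuous.aestronglyMeasurable (by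
      have := hg.continuous; fun_prop)))
    (by simpa using (hg.continuous.integrable_of_hasCompactSupport hc).restrict)
    (by simpa using hct.aestronglyMeasurable)
    (Eventually.of_forall fun z τ hτ => by
      by_cases hz : z ∈ K
      · rw [Set.indicator_of_mem hz]; exact hC _
      · rw [Set.indicator_of_notMem hz]
        have h1 : z + τ • a ∉ tsupport g := by
          intro h
          apply hz
          refine Metric.mem_cthickening_of_dist_le z _ _ _ h ?_
          rw [dist_eq_norm]
          have : z - (z + τ • a) = -(τ • a) := by abel
          rw [this, norm_neg, norm_smul]
          have : ‖τ‖ < 1 := by simpa using hτ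
          nlinarith [norm_nonneg a]
        have h2 : fderiv ℝ g (z + τ • a) = 0 := by
          by_contra h
          exact h1 (support_fderiv_subset ℝ h)
        simp [h2])
    (((integrable_indicator_iff hK.measurableSet).2
      (integrableOn_const (hs := hK.measure_lt_top.ne))).restrict)
    (Eventually.of_forall fun z τ _ => by
      have h1 : HasDerivAt (fun τ : ℝ => z + τ • a) a τ := by
        simpa using ((hasDerivAt_id τ).smul_const a).const_add z
      exact ((hg.differentiable one_ne_zero) _).hasFDerivAt.comp_hasDerivAt τ h1)
  simpa using key.2

/-- The integral of a horizontal derivative is the derivative at 0 of the integral of `g` over a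
horizontally translated subgraph. Translation by τw moves the graph vertically by at most L‖τw‖, so
the increment is at most that height times the values of `g` close to the graph. -/
lemma norm_setIntegral_subgraph_horizontal_le {φ : Y → ℝ} {L : NNReal}
    (hφ : LipschitzWith L φ) {g : Y × ℝ → E} (hg : ContDiff ℝ 1 g) (hc : HasCompactSupport g)
    (w : Y) :
    ‖∫ z in subgraph φ, fderiv ℝ g z (w, 0)‖ ≤ L * ‖w‖ * ∫ y, ‖g (y, φ y)‖ := by
  have hgi := hg.continuous.integrable_of_hasCompactSupport hc (μ := volume)
  have hφc := hφ.continuous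
  set K : Set Y := Prod.fst '' tsupport g
  have hK : IsCompact K := hc.image continuous_fst
  have hzero : ∀ y ∉ K, ∀ t, g (y, t) = 0 := fun y hy t => by
    by_contra h
    exact hy ⟨(y, t), subset_tsupport _ h, rfl⟩
  have hn : Integrable fun y => ‖g (y, φ y)‖ := (integrable_graph hφc hg.continuous hc).norm
  have htrans : ∀ τ : ℝ, ∫ z in subgraph φ, g (z + τ • ((w, 0) : Y × ℝ)) =
      ∫ z in subgraph (fun y => φ (y - τ • w)), g z := by
    intro τ
    have hm : Continuous fun y => φ (y - τ • w) := by fun_prop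
    have : (volume : Measure (Y × ℝ)).IsAddLeftInvariant := by
      rw [Measure.volume_eq_prod]; infer_instance
    rw [← integral_indicator (measurableSet_subgraph hφc),
      ← integral_indicator (measurableSet_subgraph hm),
      ← integral_add_right_eq_self ((subgraph fun y => φ (y - τ • w)).indicator g)
        (τ • ((w, 0) : Y × ℝ))]
    congr 1; funext z
    by_cases hz : z ∈ subgraph φ
    · have hz' : z + τ • ((w, 0) : Y × ℝ) ∈ subgraph (fun y => φ (y - τ • w)) := by
        simpa [subgraph] using hz
      rw [Set.indicator_of_mem hz, Set.indicator_of_mem hz']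
    · have hz' : z + τ • ((w, 0) : Y × ℝ) ∉ subgraph (fun y => φ (y - τ • w)) := by
        simpa [subgraph] using hz
      rw [Set.indicator_of_notMem hz, Set.indicator_of_notMem hz']
  -- The slack η bounds the variation of `g` between the original and the translated graph. It is
  -- paid for only over the shadow `K` of the support, which has finite volume, and then tends to 0.
  have main : ∀ η > 0, ‖∫ z in subgraph φ, fderiv ℝ g z (w, 0)‖ ≤
      L * ‖w‖ * ((∫ y, ‖g (y, φ y)‖) + η * volume.real K) := by
    intro η hη
    have huc := hc.uniformContinuous_of_continuous hg.continuous
    obtain ⟨δ, hδ, hδ'⟩ := Metric.uniformContinuous_iff.1 huc η hη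
    refine (hasDerivAt_setIntegral_translate hg hc (subgraph φ) (w, 0)).le_of_lip' (by positivity) ?_
    have hev : ∀ᶠ τ : ℝ in 𝓝 0, L * ‖τ • w‖ < δ := by
      have : Tendsto (fun τ : ℝ => L * ‖τ • w‖) (𝓝 0) (𝓝 (L * ‖(0 : ℝ) • w‖)) :=
        Continuous.tendsto (by fun_prop) 0
      exact this.eventually (gt_mem_nhds (by simpa using hδ))
    filter_upwards [hev] with τ hτ
    have h0 : ∫ z in subgraph φ, g (z + (0 : ℝ) • ((w, 0) : Y × ℝ)) = ∫ z in subgraph φ, g z := by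
      simp
    have hm : Continuous fun y => φ (y - τ • w) := by fun_prop
    obtain ⟨i1, e1⟩ := setIntegral_subgraph hm hgi
    obtain ⟨i2, e2⟩ := setIntegral_subgraph hφc hgi
    rw [h0, htrans, e1, e2, ← integral_sub i1 i2]
    have hb : ∀ y, ‖(∫ t in Set.Iic (φ (y - τ • w)), g (y, t)) - ∫ t in Set.Iic (φ y), g (y, t)‖ ≤
        (L * ‖τ • w‖) * (‖g (y, φ y)‖ + K.indicator (fun _ => η) y) := by
      intro y
      have hgy : Integrable fun t => g (y, t) :=
        (contDiff_section hg y).continuous.integrable_of_hasCompactSupport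
          (hasCompactSupport_section hc y)
      rw [intervalIntegral.integral_Iic_sub_Iic hgy.integrableOn hgy.integrableOn]
      have hd : |φ (y - τ • w) - φ y| ≤ L * ‖τ • w‖ := by
        have := hφ.dist_le_mul (y - τ • w) y
        rwa [Real.dist_eq, dist_eq_norm, sub_sub_cancel_left, norm_neg] at this
      refine (intervalIntegral.norm_integral_le_of_norm_le_const
        (C := ‖g (y, φ y)‖ + K.indicator (fun _ => η) y) fun t ht => ?_).trans ?_
      · by_cases hy : y ∈ K
        · rw [Set.indicator_of_mem hy]
          have h2 : |t - φ y| ≤ |φ (y - τ • w) - φ y| :=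
            Set.abs_sub_left_of_mem_uIcc (Set.uIoc_subset_uIcc ht)
          have h1 : dist (y, t) (y, φ y) < δ := by
            rw [Prod.dist_eq, dist_self, Real.dist_eq]
            exact max_lt hδ (by linarith)
          have h3 := (hδ' h1).le
          rw [dist_eq_norm] at h3
          calc ‖g (y, t)‖ = ‖g (y, φ y) + (g (y, t) - g (y, φ y))‖ := by congr 1; abel
            _ ≤ _ := (norm_add_le _ _).trans (by linarith)
        · simp [hzero y hy, Set.indicator_of_notMem hy]
      · rw [mul_comm]
        refine mul_le_mul_of_nonneg_right hd (add_nonneg (norm_nonneg _) ?_)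
        exact Set.indicator_nonneg (fun _ _ => hη.le) _
    have hKi : Integrable (K.indicator fun _ => η) :=
      (integrable_indicator_iff hK.measurableSet).2
        (integrableOn_const (hs := hK.measure_lt_top.ne))
    refine (norm_integral_le_of_norm_le ((hn.add hKi).const_mul _)
      (Eventually.of_forall hb)).trans (le_of_eq ?_)
    simp only [Pi.add_apply]
    rw [integral_const_mul, integral_add hn hKi, integral_indicator hK.measurableSet,
      setIntegral_const, norm_smul, sub_zero, smul_eq_mul]
    ring
  have ht : Tendsto (fun η : ℝ => L * ‖w‖ * ((∫ y, ‖g (y, φ y)‖) + η * volume.real K)) (𝓝[>] 0)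
      (𝓝 (L * ‖w‖ * ((∫ y, ‖g (y, φ y)‖) + 0 * volume.real K))) :=
    (Continuous.tendsto (by fun_prop) 0).mono_left nhdsWithin_le_nhds
  rw [zero_mul, add_zero] at ht
  exact ge_of_tendsto ht (by filter_upwards [self_mem_nhdsWithin] with η hη using main η hη)

/-- The divergence theorem for the subgraph of a Lipschitz function, up to an error controlled by
the Lipschitz constant. -/
lemma norm_setIntegral_subgraph_sub_le [CompleteSpace E] {φ : Y → ℝ} {L : NNReal}
    (hφ : LipschitzWith L φ) {g : Y × ℝ → E} (hg : ContDiff ℝ 1 g) (hc : HasCompactSupport g)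
    (w : Y) (s : ℝ) :
    ‖(∫ z in subgraph φ, fderiv ℝ g z (w, s)) - s • ∫ y, g (y, φ y)‖ ≤
      L * ‖w‖ * ∫ y, ‖g (y, φ y)‖ := by
  have hi : ∀ a, Integrable fun z => fderiv ℝ g z a := fun a =>
    ((hg.continuous_fderiv one_ne_zero).clm_apply continuous_const).integrable_of_hasCompactSupport
      (hc.fderiv_apply ℝ _)
  have h1 : ∀ z, fderiv ℝ g z (w, s) = fderiv ℝ g z (w, 0) + s • fderiv ℝ g z (0, 1) := by
    intro z
    rw [← map_smul, ← map_add]; simp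
  have hi2 : Integrable fun z => s • fderiv ℝ g z (0, 1) := (hi _).smul s
  simp only [h1]
  rw [integral_add (hi _).integrableOn hi2.integrableOn, integral_smul,
    setIntegral_subgraph_vertical hφ.continuous hg hc, add_sub_cancel_right]
  exact norm_setIntegral_subgraph_horizontal_le hφ hg hc w

end Subgraph

/-! ### Hausdorff measure of a Lipschitz graph compared with Lebesgue measure of its base. -/

section GraphMeasure

lemma hausdorff_image_le {X Z : Type*} [EMetricSpace X] [EMetricSpace Z] [MeasurableSpace X]
    [BorelSpace X] [MeasurableSpace Z] [BorelSpace Z] {K : NNReal} {f : X → Z}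
    (hf : LipschitzWith K f) (d : ℕ) (s : Set X) :
    (μHE[d] : Measure Z) (f '' s) ≤ (K : ℝ≥0∞) ^ d * (μHE[d] : Measure X) s := by
  simp only [Measure.euclideanHausdorffMeasure_def, Measure.smul_apply, ENNReal.smul_def,
    smul_eq_mul]
  have := hf.hausdorffMeasure_image_le (d := d) (by positivity) s
  rw [ENNReal.rpow_natCast] at this
  calc _ ≤ _ := mul_le_mul_right this _
    _ = _ := by ring

/-- The difference μ − ν is a positive measure, and against it ‖h‖ has integral at most c∫‖h‖ dν. -/
lemma norm_integral_sub_le_of_measure_le {X : Type*} [MeasurableSpace X] {E : Type*}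
    [NormedAddCommGroup E] [NormedSpace ℝ E] {μ ν : Measure X} [IsFiniteMeasure ν] {c : ℝ}
    (hc : 0 ≤ c) (h1 : ν ≤ μ) (h2 : μ ≤ ENNReal.ofReal (1 + c) • ν) {h : X → E}
    (hh : Integrable h ν) :
    Integrable h μ ∧ ‖(∫ x, h x ∂μ) - ∫ x, h x ∂ν‖ ≤ c * ∫ x, ‖h x‖ ∂ν := by
  have hi : Integrable h μ := (hh.smul_measure ENNReal.ofReal_ne_top).mono_measure h2
  refine ⟨hi, ?_⟩
  have hs := Measure.sub_add_cancel_of_le h1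
  have hi' : Integrable h (μ - ν) := hi.mono_measure Measure.sub_le
  have e1 : ∫ x, h x ∂μ = ∫ x, h x ∂(μ - ν) + ∫ x, h x ∂ν := by
    conv_lhs => rw [← hs]
    exact integral_add_measure hi' hh
  have e2 : ∫ x, ‖h x‖ ∂μ = ∫ x, ‖h x‖ ∂(μ - ν) + ∫ x, ‖h x‖ ∂ν := by
    conv_lhs => rw [← hs]
    exact integral_add_measure hi'.norm hh.norm
  have e3 : ∫ x, ‖h x‖ ∂μ ≤ (1 + c) * ∫ x, ‖h x‖ ∂ν := by
    refine (integral_mono_measure h2 (Eventually.of_forall fun x => norm_nonneg _)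
      (hh.smul_measure ENNReal.ofReal_ne_top).norm).trans (le_of_eq ?_)
    rw [integral_smul_measure, ENNReal.toReal_ofReal (by positivity), smul_eq_mul]
  rw [e1, add_sub_cancel_right]
  refine (norm_integral_le_integral_norm _).trans ?_
  linarith

variable {H : Type*} [NormedAddCommGroup H] [InnerProductSpace ℝ H] {d : ℕ}
  [FiniteDimensional ℝ H] [MeasurableSpace H] [BorelSpace H]

variable {n : H} {ψ : EuclideanSpace ℝ (Fin d) →ₗᵢ[ℝ] H}

namespace IsAxis

omit [MeasurableSpace H] [BorelSpace H] in
-- The adjoint of ψ has norm at most 1, inverts ψ and kills the axis `n`.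
lemma exists_projection (h : IsAxis n ψ) (p : H) : ∃ π : H → EuclideanSpace ℝ (Fin d),
    LipschitzWith 1 π ∧ ∀ z, π (cylCoord p n ψ z) = z.1 := by
  let A := ContinuousLinearMap.adjoint ψ.toContinuousLinearMap
  have hA : ‖A‖ ≤ 1 := by
    rw [LinearIsometryEquiv.norm_map]; exact ψ.norm_toContinuousLinearMap_le
  have hAψ : ∀ y, A (ψ y) = y := fun y => by
    refine ext_inner_right ℝ fun x => ?_
    rw [ContinuousLinearMap.adjoint_inner_left]
    exact ψ.inner_map_map y x
  have hAn : A n = 0 := by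
    refine ext_inner_right ℝ fun x => ?_
    rw [ContinuousLinearMap.adjoint_inner_left, inner_zero_left]
    exact h.inner_eq x
  refine ⟨fun q => A (q - p), ?_, fun z => ?_⟩
  · refine LipschitzWith.of_dist_le_mul fun a b => ?_
    rw [dist_eq_norm, dist_eq_norm, ← map_sub, sub_sub_sub_cancel_right]
    refine (A.le_opNorm _).trans ?_
    simpa using mul_le_mul_of_nonneg_right hA (norm_nonneg (a - b))
  · change A (cylCoord p n ψ z - p) = z.1
    rw [cylCoord_sub_self, map_add, map_smul, hAψ, hAn]; simp

omit [FiniteDimensional ℝ H] [MeasurableSpace H] [BorelSpace H] in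
lemma lipschitzWith_graph (h : IsAxis n ψ) (p : H) {φ : EuclideanSpace ℝ (Fin d) → ℝ} {L : NNReal}
    (hφ : LipschitzWith L φ) : LipschitzWith (1 + L) fun y => cylCoord p n ψ (y, φ y) := by
  refine LipschitzWith.of_dist_le_mul fun a b => ?_
  rw [dist_eq_norm, cylCoord_sub]
  refine (h.norm_le _ _).trans ?_
  have := hφ.dist_le_mul a b
  rw [Real.dist_eq] at this
  rw [← dist_eq_norm]
  push_cast
  linarith

/-- Orthogonal projection onto the base does not increase Hausdorff measure. Together with
`restrict_graph_le` this squeezes the surface measure between two multiples of Lebesgue measure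
whose ratio tends to 1 with the Lipschitz constant. -/
lemma map_graph_le (h : IsAxis n ψ) (p : H) {φ : EuclideanSpace ℝ (Fin d) → ℝ}
    (hφ : Continuous φ) (B : Set (EuclideanSpace ℝ (Fin d))) :
    (volume.restrict B).map (fun y => cylCoord p n ψ (y, φ y)) ≤
      (μHE[d] : Measure H).restrict ((fun y => cylCoord p n ψ (y, φ y)) '' B) := by
  set γ := fun y => cylCoord p n ψ (y, φ y)
  have hγ : Continuous γ := (continuous_cylCoord p).comp (by fun_prop)
  obtain ⟨π, hπ, hπc⟩ := h.exists_projection p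
  refine Measure.le_iff.2 fun A hA => ?_
  rw [Measure.map_apply hγ.measurable hA, Measure.restrict_apply (hγ.measurable hA),
    Measure.restrict_apply hA]
  have h1 : γ ⁻¹' A ∩ B ⊆ π '' (A ∩ γ '' B) := fun y hy =>
    ⟨γ y, ⟨hy.1, y, hy.2, rfl⟩, hπc _⟩
  refine (measure_mono h1).trans ?_
  rw [← EuclideanSpace.euclideanHausdorffMeasure_eq_volume]
  simpa using hausdorff_image_le hπ d (A ∩ γ '' B)

omit [FiniteDimensional ℝ H] in
-- The parametrization of the graph by its base is (1 + L)-Lipschitz. The crude constant suffices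
-- because L will be taken small.
lemma restrict_graph_le (h : IsAxis n ψ) (p : H) {φ : EuclideanSpace ℝ (Fin d) → ℝ} {L : NNReal}
    (hφ : LipschitzWith L φ) (B : Set (EuclideanSpace ℝ (Fin d))) :
    (μHE[d] : Measure H).restrict ((fun y => cylCoord p n ψ (y, φ y)) '' B) ≤
      ((1 + L : NNReal) : ℝ≥0∞) ^ d •
        (volume.restrict B).map (fun y => cylCoord p n ψ (y, φ y)) := by
  have hl := h.lipschitzWith_graph p hφ
  set γ := fun y => cylCoord p n ψ (y, φ y)
  refine Measure.le_iff.2 fun A hA => ?_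
  have hγ : Measurable γ := hl.continuous.measurable
  rw [Measure.smul_apply, Measure.map_apply hγ hA, Measure.restrict_apply (hγ hA),
    Measure.restrict_apply hA]
  have h1 : A ∩ γ '' B ⊆ γ '' (γ ⁻¹' A ∩ B) := by
    rintro _ ⟨hq, y, hy, rfl⟩
    exact ⟨y, ⟨hq, hy⟩, rfl⟩
  refine (measure_mono h1).trans ?_
  rw [← EuclideanSpace.euclideanHausdorffMeasure_eq_volume]
  exact hausdorff_image_le hl d _

end IsAxis

end GraphMeasure

/-! ### A C¹ boundary as a nearly flat graph, and the local defect in the divergence theorem. -/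

section LocalGraph

variable {H : Type*} [NormedAddCommGroup H] [InnerProductSpace ℝ H] {d : ℕ}
variable {n : H} {ψ : EuclideanSpace ℝ (Fin d) →ₗᵢ[ℝ] H}

/-- In the cylinder of radius and half-height `r` around `p` with axis `n`, the open set `U` is the
set of points below the graph of `φ`. -/
structure IsBelowGraph (U : Set H) (p n : H) (ψ : EuclideanSpace ℝ (Fin d) →ₗᵢ[ℝ] H) (r : ℝ)
    (φ : EuclideanSpace ℝ (Fin d) → ℝ) : Prop where
  mem_iff : ∀ y t, ‖y‖ < r → |t| < r → (cylCoord p n ψ (y, t) ∈ U ↔ t < φ y)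
  mem_frontier_iff : ∀ y t, ‖y‖ < r → |t| < r → (cylCoord p n ψ (y, t) ∈ frontier U ↔ t = φ y)

/-- Points strictly above the graph form an open set that misses U, so none of them lies in the
closure; points on the graph are limits of points of U from directly below. -/
lemma IsBelowGraph.of_mem_iff {U : Set H} (hU : IsOpen U) {p : H} {r : ℝ}
    {φ : EuclideanSpace ℝ (Fin d) → ℝ} (hφ : Continuous φ)
    (hopen : IsOpenMap (cylCoord p n ψ))
    (h : ∀ y t, ‖y‖ < r → |t| < r → (cylCoord p n ψ (y, t) ∈ U ↔ t < φ y)) :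
    IsBelowGraph U p n ψ r φ := by
  refine ⟨h, fun y t hy ht => ?_⟩
  rw [hU.frontier_eq]
  constructor
  · rintro ⟨hc, hnU⟩
    rw [h y t hy ht, not_lt] at hnU
    by_contra hne
    have hlt : φ y < t := lt_of_le_of_ne hnU (Ne.symm hne)
    let O : Set (EuclideanSpace ℝ (Fin d) × ℝ) := {z | ‖z.1‖ < r ∧ |z.2| < r ∧ φ z.1 < z.2}
    have hO : IsOpen O := by
      have h1 : IsOpen {z : EuclideanSpace ℝ (Fin d) × ℝ | ‖z.1‖ < r} :=
        isOpen_lt (by fun_prop) continuous_const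
      have h2 : IsOpen {z : EuclideanSpace ℝ (Fin d) × ℝ | |z.2| < r} :=
        isOpen_lt (by fun_prop) continuous_const
      have h3 : IsOpen {z : EuclideanSpace ℝ (Fin d) × ℝ | φ z.1 < z.2} :=
        isOpen_lt (by fun_prop) continuous_snd
      exact h1.inter (h2.inter h3)
    obtain ⟨q, ⟨z, hz, rfl⟩, hqU⟩ := mem_closure_iff.1 hc _ (hopen O hO) ⟨(y, t), ⟨hy, ht, hlt⟩, rfl⟩
    exact absurd ((h z.1 z.2 hz.1 hz.2.1).1 hqU) (not_lt.2 hz.2.2.le)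
  · intro heq
    refine ⟨?_, fun hm => absurd ((h y t hy ht).1 hm) (by rw [heq]; exact lt_irrefl _)⟩
    have hc : Tendsto (fun s : ℝ => cylCoord p n ψ (y, t - s)) (𝓝[>] 0)
        (𝓝 (cylCoord p n ψ (y, t))) := by
      have : Continuous fun s : ℝ => cylCoord p n ψ (y, t - s) :=
        (IsAxis.continuous_cylCoord p).comp (by fun_prop)
      simpa using (this.tendsto 0).mono_left nhdsWithin_le_nhds
    refine mem_closure_of_tendsto hc ?_
    have h1 : ∀ᶠ s : ℝ in 𝓝[>] 0, |t - s| < r := by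
      have : Tendsto (fun s : ℝ => |t - s|) (𝓝[>] 0) (𝓝 |t - 0|) :=
        (Continuous.tendsto (by fun_prop) 0).mono_left nhdsWithin_le_nhds
      exact this.eventually (gt_mem_nhds (by simpa using ht))
    filter_upwards [h1, self_mem_nhdsWithin] with s hs hs0
    rw [h y _ hy hs, ← heq]
    simpa using hs0

lemma IsAxis.antilipschitz_cylCoord (h : IsAxis n ψ) (p : H) :
    AntilipschitzWith 1 (cylCoord p n ψ) := by
  refine AntilipschitzWith.of_le_mul_dist fun z w => ?_
  rw [NNReal.coe_one, one_mul, dist_eq_norm, dist_eq_norm, IsAxis.cylCoord_sub, Prod.norm_def]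
  have := h.norm_sq (z.1 - w.1) (z.2 - w.2)
  refine max_le ?_ ?_
  · refine le_of_sq_le_sq ?_ (norm_nonneg _)
    rw [this, Prod.fst_sub]; nlinarith [sq_nonneg (z.2 - w.2)]
  · refine le_of_sq_le_sq ?_ (norm_nonneg _)
    rw [this, Prod.snd_sub, Real.norm_eq_abs, sq_abs]; nlinarith [sq_nonneg ‖z.1 - w.1‖]

lemma IsAxis.isClosedEmbedding_cylCoord (h : IsAxis n ψ) (p : H) :
    IsClosedEmbedding (cylCoord p n ψ) := by
  refine (h.antilipschitz_cylCoord p).isClosedEmbedding ?_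
  have : LipschitzWith 2 (cylCoord p n ψ) := by
    refine LipschitzWith.of_dist_le_mul fun z w => ?_
    rw [dist_eq_norm, dist_eq_norm, IsAxis.cylCoord_sub]
    refine (h.norm_le _ _).trans ?_
    have h1 : ‖z.1 - w.1‖ ≤ ‖z - w‖ := norm_fst_le (z - w)
    have h2 : |z.2 - w.2| ≤ ‖z - w‖ := norm_snd_le (z - w)
    push_cast
    linarith
  exact this.uniformContinuous

/-- A hypersurface `ρ = 0` with almost constant normal `n` is the graph of a function with small
Lipschitz constant. -/
lemma exists_isBelowGraph [FiniteDimensional ℝ H] (hd : Module.finrank ℝ H = d + 1)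
    (hax : IsAxis n ψ) {U : Set H} (hU : IsOpen U)
    {ρ : H → ℝ} {p : H} {R : ℝ} (hR : 0 < R) {c : NNReal} (hc : c ≤ 1 / 4) (h0 : ρ p = 0)
    (hρ : ∀ a ∈ Metric.ball p R, ∀ b ∈ Metric.ball p R,
      |ρ a - ρ b - inner ℝ n (a - b)| ≤ c * ‖a - b‖)
    (hρU : ∀ Z ∈ Metric.ball p R, Z ∈ U ↔ ρ Z < 0) :
    ∃ φ : EuclideanSpace ℝ (Fin d) → ℝ, LipschitzWith (2 * c) φ ∧
      IsBelowGraph U p n ψ (R / 4) φ := by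
  set r := R / 4 with hr
  have hr0 : 0 < r := by positivity
  have hc' : (c : ℝ) ≤ 1 / 4 := by exact_mod_cast hc
  have hc0 : (0 : ℝ) ≤ c := c.2
  have hball : ∀ y t, ‖y‖ < r → |t| ≤ r → cylCoord p n ψ (y, t) ∈ Metric.ball p R := by
    intro y t hy ht
    rw [Metric.mem_ball, dist_eq_norm, IsAxis.cylCoord_sub_self]
    refine (hax.norm_le _ _).trans_lt ?_
    simp only; linarith
  -- In these coordinates ρ differs from the height `t` by a function with Lipschitz constant c,
  -- since the `n`-component of a displacement is its height difference.
  have hest : ∀ y t y' t', ‖y‖ < r → |t| ≤ r → ‖y'‖ < r → |t'| ≤ r →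
      |ρ (cylCoord p n ψ (y, t)) - ρ (cylCoord p n ψ (y', t')) - (t - t')| ≤
        c * (‖y - y'‖ + |t - t'|) := by
    intro y t y' t' hy ht hy' ht'
    have h1 := hρ _ (hball y t hy ht) _ (hball y' t' hy' ht')
    rw [IsAxis.cylCoord_sub, hax.inner_cyl] at h1
    exact h1.trans (mul_le_mul_of_nonneg_left (hax.norm_le _ _) hc0)
  have hroot : ∀ y, ‖y‖ < r → ∃ t, |t| ≤ r ∧ ρ (cylCoord p n ψ (y, t)) = 0 := by
    intro y hy
    have hcont : ContinuousOn (fun t => ρ (cylCoord p n ψ (y, t))) (Set.Icc (-r) r) := by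
      have : LipschitzOnWith 2 (fun t => ρ (cylCoord p n ψ (y, t))) (Set.Icc (-r) r) := by
        refine LipschitzOnWith.of_dist_le_mul fun t ht t' ht' => ?_
        have h1 := hest y t y t' hy (abs_le.2 ht) hy (abs_le.2 ht')
        rw [Real.dist_eq, Real.dist_eq]
        rw [sub_self, norm_zero, zero_add] at h1
        have h2 := abs_sub_abs_le_abs_sub
          (ρ (cylCoord p n ψ (y, t)) - ρ (cylCoord p n ψ (y, t'))) (t - t')
        have : (c : ℝ) * |t - t'| ≤ 1 / 4 * |t - t'| :=
          mul_le_mul_of_nonneg_right hc' (abs_nonneg _)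
        push_cast
        linarith [abs_nonneg (t - t')]
      exact this.continuousOn
    have hp : cylCoord p n ψ ((0 : EuclideanSpace ℝ (Fin d)), (0 : ℝ)) = p := by simp [cylCoord]
    -- With c ≤ 1/4 the error c(‖y‖ + r) is at most r/2. Thus ρ is negative at height −r and
    -- positive at height r, and the intermediate value theorem gives a zero.
    have hend : ∀ t, |t| = r → |ρ (cylCoord p n ψ (y, t)) - t| ≤ r / 2 := by
      intro t ht
      have h1 := hest y t 0 0 hy ht.le (by simpa using hr0) (by simpa using hr0.le)
      rw [hp, h0, sub_zero, sub_zero, sub_zero, ht] at h1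
      nlinarith
    have h1 := hend r (abs_of_pos hr0)
    have h2 := hend (-r) (by rw [abs_neg, abs_of_pos hr0])
    rw [abs_le] at h1 h2
    obtain ⟨t, ht, ht0⟩ := intermediate_value_Icc (by linarith) hcont
      (show (0 : ℝ) ∈ Set.Icc _ _ from ⟨by linarith, by linarith⟩)
    exact ⟨t, abs_le.2 ht, ht0⟩
  choose! φ₀ hφ₀r hφ₀ using hroot
  -- At two zeros of ρ the estimate reads |Δφ| ≤ c(‖Δy‖ + |Δφ|); absorbing the last term with c ≤
  -- 1/4 gives the factor 2c.
  have hlip : LipschitzOnWith (2 * c) φ₀ (Metric.ball 0 r) := by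
    refine LipschitzOnWith.of_dist_le_mul fun y hy y' hy' => ?_
    rw [mem_ball_zero_iff] at hy hy'
    have h1 := hest y (φ₀ y) y' (φ₀ y') hy (hφ₀r y hy) hy' (hφ₀r y' hy')
    rw [hφ₀ y hy, hφ₀ y' hy', sub_self, zero_sub, abs_neg] at h1
    rw [Real.dist_eq, dist_eq_norm]
    push_cast
    nlinarith [abs_nonneg (φ₀ y - φ₀ y'), norm_nonneg (y - y')]
  obtain ⟨φ, hφ, hφeq⟩ := hlip.extend_real
  refine ⟨φ, hφ, IsBelowGraph.of_mem_iff hU hφ.continuous ?_ fun y t hy ht => ?_⟩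
  · intro O hO
    have hcl := (hax.isClosedEmbedding_cylCoord p).isEmbedding
    have hs := hax.surjective_cylCoord hd p
    exact (hcl.toHomeomorphOfSurjective hs).isOpenMap O hO
  · rw [hρU _ (hball y t hy ht.le), ← hφeq (show y ∈ Metric.ball 0 r by simpa using hy)]
    have h1 := hest y t y (φ₀ y) hy ht.le hy (hφ₀r y hy)
    rw [hφ₀ y hy, sub_zero, sub_self, norm_zero, zero_add] at h1
    have h2 : |ρ (cylCoord p n ψ (y, t)) - (t - φ₀ y)| ≤ 1 / 4 * |t - φ₀ y| :=
      h1.trans (mul_le_mul_of_nonneg_right hc' (abs_nonneg _))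
    rw [abs_le] at h2
    constructor
    · intro h
      by_contra hcon
      rw [not_lt] at hcon
      rw [abs_of_nonneg (by linarith)] at h2
      linarith
    · intro h
      rw [abs_of_neg (by linarith)] at h2
      linarith

lemma setIntegral_congr_of_zero {X F : Type*} [MeasurableSpace X] [NormedAddCommGroup F]
    [NormedSpace ℝ F] {μ : Measure X} {s t : Set X} (hs : MeasurableSet s) (ht : MeasurableSet t)
    {k : X → F} (h1 : ∀ x ∈ s \ t, k x = 0) (h2 : ∀ x ∈ t \ s, k x = 0) :
    ∫ x in s, k x ∂μ = ∫ x in t, k x ∂μ := by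
  rw [setIntegral_eq_of_subset_of_forall_sdiff_eq_zero hs (Set.inter_subset_left (t := t))
      fun x hx => h1 x ⟨hx.1, fun h => hx.2 ⟨hx.1, h⟩⟩,
    setIntegral_eq_of_subset_of_forall_sdiff_eq_zero ht (Set.inter_subset_right (s := s))
      fun x hx => h2 x ⟨hx.1, fun h => hx.2 ⟨h, hx.1⟩⟩]

variable [FiniteDimensional ℝ H] [MeasurableSpace H] [BorelSpace H]
variable {E : Type*} [NormedAddCommGroup E] [NormedSpace ℝ E] [CompleteSpace E]

/-- The three summands of the constant are three separate errors: L for replacing the divergence by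
its vertical part, (1 + L)^d − 1 for replacing surface measure by Lebesgue measure of the base, and
δ for replacing the varying normal by the constant `n`. -/
lemma norm_divergence_sub_boundary_le (hd : Module.finrank ℝ H = d + 1) (hax : IsAxis n ψ)
    {U : Set H} (hU : IsOpen U) (hfin : (μHE[d] : Measure H) (frontier U) < ∞) {p : H} {r : ℝ}
    {φ : EuclideanSpace ℝ (Fin d) → ℝ} {L : NNReal} (hφ : LipschitzWith L φ)
    (hgr : IsBelowGraph U p n ψ r φ) {N : H → H}
    (hN : AEStronglyMeasurable N ((μHE[d] : Measure H).restrict (frontier U))) {δ : ℝ}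
    (hNδ : ∀ z, ‖z.1‖ < r → |z.2| < r → cylCoord p n ψ z ∈ frontier U →
      ‖N (cylCoord p n ψ z) - n‖ ≤ δ)
    (v : H) {g : H → E} (hg : ContDiff ℝ 1 g) (hc : HasCompactSupport g)
    (hsupp : ∀ z, cylCoord p n ψ z ∈ tsupport g → ‖z.1‖ < r ∧ |z.2| < r) :
    ‖(∫ x in U, fderiv ℝ g x v) - ∫ q in frontier U, inner ℝ (N q) v • g q ∂μHE[d]‖ ≤
      (L + ((1 + L) ^ d - 1) + δ) * ‖v‖ * ∫ q in frontier U, ‖g q‖ ∂μHE[d] := by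
  set Φ := cylCoord p n ψ with hΦ
  have hΦc : Continuous Φ := IsAxis.continuous_cylCoord p
  set γ : EuclideanSpace ℝ (Fin d) → H := fun y => Φ (y, φ y) with hγdef
  have hφc := hφ.continuous
  have hγc : Continuous γ := hΦc.comp (by fun_prop)
  have hγinj : Function.Injective γ := fun a b hab =>
    congrArg Prod.fst (hax.injective_cylCoord p hab)
  have hγme : MeasurableEmbedding γ := hγc.measurableEmbedding hγinj
  set B : Set (EuclideanSpace ℝ (Fin d)) := Metric.ball 0 r
  have hBm : MeasurableSet (γ '' B) := hγme.measurableSet_image.2 measurableSet_ball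
  set ν := (volume.restrict B).map γ with hν
  set μ : Measure H := μHE[d]
  have hBfin : volume B < ∞ := measure_ball_lt_top
  have : IsFiniteMeasure (volume.restrict B) := ⟨by simpa using hBfin⟩
  have : IsFiniteMeasure ν := by rw [hν]; infer_instance
  have : IsFiniteMeasure (μ.restrict (frontier U)) := ⟨by simpa using hfin⟩
  have hz0 : ∀ x, g x ≠ 0 → ∃ z, ‖z.1‖ < r ∧ |z.2| < r ∧ Φ z = x := by
    intro x hx
    obtain ⟨z, rfl⟩ := hax.surjective_cylCoord hd p x
    have := hsupp z (subset_tsupport _ hx)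
    exact ⟨z, this.1, this.2, rfl⟩
  -- integrals over the frontier are integrals over the graph
  have hfr1 : ∀ x ∈ frontier U \ γ '' B, g x = 0 := by
    intro x hx
    by_contra hgx
    obtain ⟨z, hz1, hz2, rfl⟩ := hz0 x hgx
    refine hx.2 ⟨z.1, by simpa [B] using hz1, ?_⟩
    rw [hγdef]
    simp only
    rw [← (hgr.mem_frontier_iff z.1 z.2 hz1 hz2).1 hx.1]
  have hfr2 : ∀ x ∈ γ '' B \ frontier U, g x = 0 := by
    intro x hx
    by_contra hgx
    obtain ⟨y, hy, rfl⟩ := hx.1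
    obtain ⟨z, hz1, hz2, hz⟩ := hz0 _ hgx
    have hzy : z = (y, φ y) := hax.injective_cylCoord p hz
    subst hzy
    exact hx.2 ((hgr.mem_frontier_iff y (φ y) hz1 hz2).2 rfl)
  have hfr : ∫ q in frontier U, g q ∂μ = ∫ q in γ '' B, g q ∂μ :=
    setIntegral_congr_of_zero isClosed_frontier.measurableSet hBm hfr1 hfr2
  have hfrn : ∫ q in frontier U, ‖g q‖ ∂μ = ∫ q in γ '' B, ‖g q‖ ∂μ :=
    setIntegral_congr_of_zero isClosed_frontier.measurableSet hBm
      (fun x hx => by rw [hfr1 x hx, norm_zero]) (fun x hx => by rw [hfr2 x hx, norm_zero])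
  -- the volume integral
  obtain ⟨⟨w, s⟩, hws⟩ := hax.surjective_cylCoord hd 0 v
  have hv : v = ψ w + s • n := by rw [← hws]; simp [cylCoord]
  have hvn := hax.norm_sq w s
  rw [← hv] at hvn
  have hwv : ‖w‖ ≤ ‖v‖ := le_of_sq_le_sq (by nlinarith [sq_nonneg s]) (norm_nonneg _)
  have hsv : |s| ≤ ‖v‖ :=
    le_of_sq_le_sq (by rw [sq_abs]; nlinarith [sq_nonneg ‖w‖]) (norm_nonneg _)
  have hsn : inner ℝ n v = s := by rw [hv]; exact hax.inner_cyl w s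
  have hΦd : ∀ z, HasFDerivAt Φ (ψ.toContinuousLinearMap.comp (ContinuousLinearMap.fst ℝ _ _) +
      (ContinuousLinearMap.snd ℝ _ ℝ).smulRight n) z := by
    intro z
    have h1 := ((ψ.toContinuousLinearMap.comp
      (ContinuousLinearMap.fst ℝ (EuclideanSpace ℝ (Fin d)) ℝ)) +
      (ContinuousLinearMap.snd ℝ (EuclideanSpace ℝ (Fin d)) ℝ).smulRight n).hasFDerivAt (x := z)
    have h2 := h1.const_add p
    have h3 : Φ = fun x => p + ((ψ.toContinuousLinearMap.comp
      (ContinuousLinearMap.fst ℝ (EuclideanSpace ℝ (Fin d)) ℝ)) +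
      (ContinuousLinearMap.snd ℝ (EuclideanSpace ℝ (Fin d)) ℝ).smulRight n) x := by
      funext x
      simp [hΦ, cylCoord, add_assoc]
    rw [h3]; exact h2
  have hΦcd : ContDiff ℝ 1 Φ := by
    have h1 : ContDiff ℝ 1 fun z : EuclideanSpace ℝ (Fin d) × ℝ => ψ z.1 :=
      ψ.toContinuousLinearMap.contDiff.comp contDiff_fst
    exact (contDiff_const.add h1).add (contDiff_snd.smul contDiff_const)
  have hgΦ : ContDiff ℝ 1 (g ∘ Φ) := hg.comp hΦcd
  have hcΦ : HasCompactSupport (g ∘ Φ) :=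
    hc.comp_isClosedEmbedding (hax.isClosedEmbedding_cylCoord p)
  have hfd : ∀ z, fderiv ℝ (g ∘ Φ) z (w, s) = fderiv ℝ g (Φ z) v := by
    intro z
    rw [((hg.differentiable one_ne_zero (Φ z)).hasFDerivAt.comp z (hΦd z)).fderiv, hv]
    simp
  have hvol : ∫ x in U, fderiv ℝ g x v = ∫ z in subgraph φ, fderiv ℝ (g ∘ Φ) z (w, s) := by
    rw [← (hax.measurePreserving_cylCoord hd p).setIntegral_preimage_emb
      (hax.measurableEmbedding_cylCoord p), ← integral_indicator (measurableSet_subgraph hφc),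
      ← integral_indicator (hU.preimage hΦc).measurableSet]
    congr 1; funext z
    by_cases hz : fderiv ℝ g (Φ z) = 0
    · simp [Set.indicator, hfd, hz, ← hΦ]
    · have hzt := hsupp z (support_fderiv_subset ℝ hz)
      have hmem := hgr.mem_iff z.1 z.2 hzt.1 hzt.2
      by_cases hzU : Φ z ∈ U
      · rw [Set.indicator_of_mem (show z ∈ Φ ⁻¹' U from hzU),
          Set.indicator_of_mem (show z ∈ subgraph φ from hmem.1 hzU), hfd]
      · rw [Set.indicator_of_notMem (show z ∉ Φ ⁻¹' U from hzU),
          Set.indicator_of_notMem (show z ∉ subgraph φ from fun h => hzU (hmem.2 h))]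
  have hB0 : ∀ y ∉ B, g (γ y) = 0 := by
    intro y hy
    by_contra hgy
    obtain ⟨z, hz1, -, hz⟩ := hz0 _ hgy
    have hzy : z = (y, φ y) := hax.injective_cylCoord p hz
    subst hzy
    exact hy (by simpa [B] using hz1)
  have hIg : ∫ y, g (γ y) = ∫ q, g q ∂ν := by
    rw [hν, hγme.integral_map, setIntegral_eq_integral_of_forall_compl_eq_zero hB0]
  have hIn : ∫ y, ‖g (γ y)‖ = ∫ q, ‖g q‖ ∂ν := by
    rw [hν, hγme.integral_map, setIntegral_eq_integral_of_forall_compl_eq_zero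
      fun y hy => by rw [hB0 y hy, norm_zero]]
  have main1 := norm_setIntegral_subgraph_sub_le hφ hgΦ hcΦ w s
  rw [← hvol] at main1
  simp only [Function.comp_apply] at main1
  simp only [hγdef] at hIg hIn
  rw [hIg, hIn] at main1
  -- comparison of the graph measure with Hausdorff measure
  have hle1 : ν ≤ μ.restrict (γ '' B) := hax.map_graph_le p hφc B
  have hle2 : μ.restrict (γ '' B) ≤ ENNReal.ofReal (1 + (((1 : ℝ) + L) ^ d - 1)) • ν := by
    have h1 := hax.restrict_graph_le p hφ B
    have h2 : ENNReal.ofReal (1 + (((1 : ℝ) + L) ^ d - 1)) = ((1 + L : NNReal) : ℝ≥0∞) ^ d := by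
      rw [add_sub_cancel, ENNReal.ofReal_pow (by positivity)]
      congr 1
      rw [ENNReal.ofReal, ENNReal.coe_inj]
      ext
      rw [Real.coe_toNNReal _ (by positivity)]; simp
    rw [h2]; exact h1
  have hcn : (0 : ℝ) ≤ (1 + L) ^ d - 1 := by
    have : (1 : ℝ) ≤ (1 + L) ^ d := one_le_pow₀ (by simp)
    linarith
  have hgν : Integrable g ν := hg.continuous.integrable_of_hasCompactSupport hc
  obtain ⟨hgμ, main2⟩ := norm_integral_sub_le_of_measure_le hcn hle1 hle2 hgν
  have hnorm : ∫ x, ‖g x‖ ∂ν ≤ ∫ q in frontier U, ‖g q‖ ∂μ := by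
    rw [hfrn]
    exact integral_mono_measure hle1 (Eventually.of_forall fun x => norm_nonneg _) hgμ.norm
  rw [← hfr] at main2
  have hgf : Integrable g (μ.restrict (frontier U)) :=
    hg.continuous.integrable_of_hasCompactSupport hc
  -- variation of the normal
  have hpt : ∀ q ∈ frontier U, ‖(s - inner ℝ (N q) v) • g q‖ ≤ δ * ‖v‖ * ‖g q‖ := by
    intro q hq
    by_cases hgq : g q = 0
    · simp [hgq]
    · obtain ⟨z, hz1, hz2, rfl⟩ := hz0 q hgq
      rw [norm_smul, ← hsn, ← inner_sub_left]
      refine mul_le_mul_of_nonneg_right ((norm_inner_le_norm _ _).trans ?_) (norm_nonneg _)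
      rw [norm_sub_rev]
      exact mul_le_mul_of_nonneg_right (hNδ z hz1 hz2 hq) (norm_nonneg _)
  have hpt' : ∀ᵐ q ∂μ.restrict (frontier U), ‖(s - inner ℝ (N q) v) • g q‖ ≤ δ * ‖v‖ * ‖g q‖ :=
    (ae_restrict_iff' isClosed_frontier.measurableSet).2 (Eventually.of_forall hpt)
  have hmeas : AEStronglyMeasurable (fun q => (s - inner ℝ (N q) v) • g q)
      (μ.restrict (frontier U)) :=
    ((aestronglyMeasurable_const).sub (hN.inner aestronglyMeasurable_const)).smul
      hgf.aestronglyMeasurable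
  have hint : Integrable (fun q => (s - inner ℝ (N q) v) • g q) (μ.restrict (frontier U)) :=
    (hgf.norm.const_mul (δ * ‖v‖)).mono' hmeas hpt'
  have main3 : ‖s • (∫ q in frontier U, g q ∂μ) - ∫ q in frontier U, inner ℝ (N q) v • g q ∂μ‖ ≤
      δ * ‖v‖ * ∫ q in frontier U, ‖g q‖ ∂μ := by
    have h1 : ∀ q, inner ℝ (N q) v • g q = s • g q - (s - inner ℝ (N q) v) • g q := by
      intro q; rw [sub_smul]; abel
    have hsg : Integrable (fun q => s • g q) (μ.restrict (frontier U)) := hgf.smul s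
    simp only [h1]
    rw [integral_sub hsg hint, integral_smul, sub_sub_cancel, ← integral_const_mul]
    exact norm_integral_le_of_norm_le (hgf.norm.const_mul _) hpt'
  set J := ∫ q in frontier U, ‖g q‖ ∂μ
  have hJ : 0 ≤ ∫ x, ‖g x‖ ∂ν := integral_nonneg fun x => norm_nonneg _
  have e1 : ‖(∫ x in U, fderiv ℝ g x v) - s • ∫ q, g q ∂ν‖ ≤ L * ‖v‖ * J := by
    refine main1.trans (mul_le_mul ?_ hnorm hJ (by positivity))
    exact mul_le_mul_of_nonneg_left hwv L.2
  have e2 : ‖s • (∫ q in frontier U, g q ∂μ) - s • ∫ q, g q ∂ν‖ ≤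
      ((1 + L) ^ d - 1) * ‖v‖ * J := by
    rw [← smul_sub, norm_smul, Real.norm_eq_abs]
    calc |s| * _ ≤ ‖v‖ * (((1 + L) ^ d - 1) * J) :=
          mul_le_mul hsv (main2.trans (mul_le_mul_of_nonneg_left hnorm hcn)) (norm_nonneg _)
            (norm_nonneg _)
      _ = _ := by ring
  have e4 : (∫ x in U, fderiv ℝ g x v) - ∫ q in frontier U, inner ℝ (N q) v • g q ∂μ =
      ((∫ x in U, fderiv ℝ g x v) - s • ∫ q, g q ∂ν) -
      (s • (∫ q in frontier U, g q ∂μ) - s • ∫ q, g q ∂ν) +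
      (s • (∫ q in frontier U, g q ∂μ) - ∫ q in frontier U, inner ℝ (N q) v • g q ∂μ) := by abel
  rw [e4]
  refine (norm_add_le _ _).trans ((add_le_add_left (norm_sub_le _ _) _).trans ?_)
  calc _ ≤ L * ‖v‖ * J + ((1 + L) ^ d - 1) * ‖v‖ * J + δ * ‖v‖ * J := by gcongr
    _ = _ := by ring

end LocalGraph

/-! ### Regular boundary points and regularity of the outward normal. -/

section Normal

/-- The boundary points at which `U` has an outward unit normal. -/
def regularBoundary (U : Set ℍ) : Set ℍ := {p ∈ frontier U | ∃ n, IsOutwardUnitNormal U p n}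

lemma isOutwardUnitNormal_outwardNormal {U : Set ℍ} {p : ℍ}
    (h : ∃ n, IsOutwardUnitNormal U p n) : IsOutwardUnitNormal U p (outwardNormal U p) := by
  rw [outwardNormal, dif_pos h]; exact h.choose_spec

lemma IsOutwardUnitNormal.outwardNormal_eq {U : Set ℍ} {p n : ℍ} (h : IsOutwardUnitNormal U p n) :
    outwardNormal U p = n := (isOutwardUnitNormal_outwardNormal ⟨n, h⟩).eq h

lemma norm_outwardNormal_le (U : Set ℍ) (p : ℍ) : ‖outwardNormal U p‖ ≤ 1 := by
  by_cases h : ∃ n, IsOutwardUnitNormal U p n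
  · exact (isOutwardUnitNormal_outwardNormal h).1.le
  · rw [outwardNormal, dif_neg h]; simp

/-- One defining function ρ serves all nearby boundary points q: after division by ‖∇ρ(q)‖ it
witnesses the normal ∇ρ(q)/‖∇ρ(q)‖. Uniqueness of the normal then transfers the continuity of ∇ρ to
`outwardNormal`. -/
lemma IsOutwardUnitNormal.eventually {U : Set ℍ} (hU : IsOpen U) {p n : ℍ}
    (h : IsOutwardUnitNormal U p n) :
    (∀ᶠ q in 𝓝[frontier U] p, ∃ m, IsOutwardUnitNormal U q m) ∧
      ContinuousWithinAt (outwardNormal U) (frontier U) p := by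
  obtain ⟨hn, ρ, hρ, hρ0, hgrad, hρU⟩ := id h
  have hcont : ContinuousAt (gradient ρ) p := by
    have h1 : ContinuousAt (fderiv ℝ ρ) p :=
      (hρ.fderiv_right (m := 0) (by norm_num)).continuousAt
    exact (InnerProductSpace.toDual ℝ ℍ).symm.continuous.continuousAt.comp h1
  have hgp : gradient ρ p = n := hgrad.gradient
  have hne : ∀ᶠ q in 𝓝 p, gradient ρ q ≠ 0 :=
    hcont.eventually_ne (by rw [hgp]; intro h0; simp [h0] at hn)
  have hev : ∀ᶠ q in 𝓝[frontier U] p,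
      IsOutwardUnitNormal U q (‖gradient ρ q‖⁻¹ • gradient ρ q) := by
    filter_upwards [nhdsWithin_le_nhds hne, nhdsWithin_le_nhds (hρ.eventually (by simp)),
      nhdsWithin_le_nhds hρU.eventually_nhds, self_mem_nhdsWithin] with q hq1 hq2 hq3 hq4
    have hpos : 0 < ‖gradient ρ q‖ := norm_pos_iff.2 hq1
    -- A boundary point of the open set U is not in U, so ρ(q) ≥ 0; if ρ(q) > 0, no point of U would
    -- lie near q.
    have hq0 : ρ q = 0 := by
      rw [hU.frontier_eq] at hq4
      refine le_antisymm ?_ (not_lt.1 fun hlt => hq4.2 (hq3.self_of_nhds.2 hlt))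
      by_contra! hlt
      have h1 : ∀ᶠ Z in 𝓝 q, 0 < ρ Z := hq2.continuousAt.eventually (lt_mem_nhds hlt)
      obtain ⟨Z, hZ, hZ1, hZ2⟩ := ((mem_closure_iff_frequently.1 hq4.1).and_eventually
        (h1.and hq3)).exists
      have := hZ2.1 hZ
      linarith
    refine ⟨by rw [norm_smul, norm_inv, norm_norm, inv_mul_cancel₀ hpos.ne'],
      fun Z => ‖gradient ρ q‖⁻¹ * ρ Z, contDiffAt_const.mul hq2, by simp only [hq0, mul_zero], ?_, ?_⟩
    · have h1 := (hq2.differentiableAt one_ne_zero).hasGradientAt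
      rw [hasGradientAt_iff_hasFDerivAt] at h1 ⊢
      rw [map_smul]
      exact h1.const_mul _
    · filter_upwards [hq3] with Z hZ
      rw [hZ, mul_neg_iff]
      have : 0 < ‖gradient ρ q‖⁻¹ := inv_pos.2 hpos
      constructor
      · exact fun h => Or.inl ⟨this, h⟩
      · rintro (h | h)
        · exact h.2
        · linarith [h.1]
  refine ⟨hev.mono fun q hq => ⟨_, hq⟩, ?_⟩
  have h1 : ContinuousWithinAt (fun q => ‖gradient ρ q‖⁻¹ • gradient ρ q) (frontier U) p := by
    refine ContinuousAt.continuousWithinAt ?_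
    refine ContinuousAt.smul (hcont.norm.inv₀ ?_) hcont
    rw [hgp, hn]; exact one_ne_zero
  refine h1.congr_of_eventuallyEq (hev.mono fun q hq => hq.outwardNormal_eq) ?_
  rw [h.outwardNormal_eq, hgp, hn, inv_one, one_smul]

/-- Relative openness makes the regular part measurable and, for bounded U, makes the singular part
compact. -/
lemma exists_isOpen_regularBoundary {U : Set ℍ} (hU : IsOpen U) :
    ∃ O, IsOpen O ∧ regularBoundary U = frontier U ∩ O := by
  let S := {O : Set ℍ | IsOpen O ∧ ∀ q ∈ frontier U ∩ O, ∃ m, IsOutwardUnitNormal U q m}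
  refine ⟨⋃₀ S, isOpen_sUnion fun O hO => hO.1, Set.Subset.antisymm ?_ ?_⟩
  · rintro p ⟨hp, n, hn⟩
    obtain ⟨O, hO, hpO, hsub⟩ := mem_nhdsWithin.1 (hn.eventually hU).1
    exact ⟨hp, O, ⟨hO, fun q hq => hsub ⟨hq.2, hq.1⟩⟩, hpO⟩
  · rintro p ⟨hp, O, hO, hpO⟩
    exact ⟨hp, hO.2 p ⟨hp, hpO⟩⟩

lemma HasPiecewiseC1Boundary.aestronglyMeasurable_outwardNormal {U : Set ℍ} (hUo : IsOpen U)
    (hU : HasPiecewiseC1Boundary U) :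
    AEStronglyMeasurable (outwardNormal U) ((μHE[3] : Measure ℍ).restrict (frontier U)) := by
  obtain ⟨O, hO, hR⟩ := exists_isOpen_regularBoundary hUo
  have hRm : MeasurableSet (regularBoundary U) := by
    rw [hR]; exact isClosed_frontier.measurableSet.inter hO.measurableSet
  have hae : regularBoundary U =ᵐ[μHE[3]] frontier U := by
    refine (Set.inter_subset_left.eventuallyLE : _ ≤ᶠ[_] _).antisymm ?_
    rw [ae_le_set]
    refine measure_mono_null ?_ hU.null_singular
    rintro p ⟨hp, hp'⟩
    exact ⟨hp, fun h => hp' ⟨hp, h⟩⟩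
  rw [← Measure.restrict_congr_set hae]
  refine ContinuousOn.aestronglyMeasurable (fun p hp => ?_) hRm
  obtain ⟨hp, n, hn⟩ := hp
  exact (hn.eventually hUo).2.mono Set.inter_subset_left

lemma finrank_quaternion : Module.finrank ℝ ℍ = 3 + 1 := Quaternion.finrank_eq_four

end Normal

/-! ### From local defects to the divergence theorem away from singular points. -/

section GaussGreen

variable {E : Type*} [NormedAddCommGroup E] [NormedSpace ℝ E]

/-- The defect in the divergence theorem for the vector field `g v` is at most `ε` times the
integral of `‖g‖` over the boundary, for all test functions `g` supported in `O`. -/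
def DefectLE (E : Type*) [NormedAddCommGroup E] [NormedSpace ℝ E] (U : Set ℍ) (v : ℍ) (ε : ℝ)
    (O : Set ℍ) : Prop :=
  ∀ g : ℍ → E, ContDiff ℝ 1 g → HasCompactSupport g → tsupport g ⊆ O →
    ‖(∫ x in U, fderiv ℝ g x v) - ∫ q in frontier U, inner ℝ (outwardNormal U q) v • g q ∂μHE[3]‖ ≤
      ε * ∫ q in frontier U, ‖g q‖ ∂μHE[3]

lemma integral_fderiv_eq_zero {g : ℍ → E} (hg : ContDiff ℝ 1 g) (hc : HasCompactSupport g)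
    (v : ℍ) : ∫ x, fderiv ℝ g x v = 0 := by
  have hgi := hg.continuous.integrable_of_hasCompactSupport hc (μ := (volume : Measure ℍ))
  have hi : Integrable fun x => fderiv ℝ g x v :=
    ((hg.continuous_fderiv one_ne_zero).clm_apply continuous_const).integrable_of_hasCompactSupport
      (hc.fderiv_apply ℝ _)
  have h := integral_bilinear_hasLineDerivAt_right_eq_neg_left_of_integrable
    (B := ContinuousLinearMap.lsmul ℝ ℝ) (f := fun _ : ℍ => (1 : ℝ)) (f' := fun _ => 0)
    (g := g) (g' := fun x => fderiv ℝ g x v) (v := v) (μ := volume) (by simp) (by simpa using hi)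
    (by simpa using hgi) (fun x _ => by
      simpa using (hasFDerivAt_const (1 : ℝ) x).hasLineDerivAt v)
    (fun x _ => ((hg.differentiable one_ne_zero) x).hasFDerivAt.hasLineDerivAt v)
  simpa using h

lemma defectLE_of_subset {U : Set ℍ} (hU : IsOpen U) (v : ℍ) {ε : ℝ} (hε : 0 ≤ ε) :
    DefectLE E U v ε U := by
  intro g hg hc hs
  have h1 : ∫ x in U, fderiv ℝ g x v = 0 := by
    rw [setIntegral_eq_integral_of_forall_compl_eq_zero, integral_fderiv_eq_zero hg hc]
    intro x hx
    have : fderiv ℝ g x = 0 := by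
      by_contra h
      exact hx (hs (support_fderiv_subset ℝ h))
    simp [this]
  have h2 : ∀ q ∈ frontier U, g q = 0 := fun q hq => by
    by_contra h
    rw [hU.frontier_eq] at hq
    exact hq.2 (hs (subset_tsupport _ h))
  rw [h1, setIntegral_eq_zero_of_forall_eq_zero fun q hq => by rw [h2 q hq, smul_zero],
    sub_zero, norm_zero]
  exact mul_nonneg hε (integral_nonneg fun _ => norm_nonneg _)

lemma defectLE_of_disjoint {U : Set ℍ} (v : ℍ) {ε : ℝ} (hε : 0 ≤ ε) :
    DefectLE E U v ε (closure U)ᶜ := by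
  intro g hg hc hs
  have h1 : ∫ x in U, fderiv ℝ g x v = 0 := by
    refine setIntegral_eq_zero_of_forall_eq_zero fun x hx => ?_
    have : fderiv ℝ g x = 0 := by
      by_contra h
      exact (hs (support_fderiv_subset ℝ h)) (subset_closure hx)
    simp [this]
  have h2 : ∀ q ∈ frontier U, g q = 0 := fun q hq => by
    by_contra h
    exact hs (subset_tsupport _ h) hq.1
  rw [h1, setIntegral_eq_zero_of_forall_eq_zero fun q hq => by rw [h2 q hq, smul_zero],
    sub_zero, norm_zero]
  exact mul_nonneg hε (integral_nonneg fun _ => norm_nonneg _)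

/-- On a small ball strict differentiability of ρ makes the boundary a graph of small slope, and
continuity of the normal makes its variation small; `norm_divergence_sub_boundary_le` then applies.
-/
lemma IsOutwardUnitNormal.exists_defectLE [CompleteSpace E] {U : Set ℍ} (hUo : IsOpen U)
    (hU : HasPiecewiseC1Boundary U)
    {p n : ℍ} (h : IsOutwardUnitNormal U p n) (v : ℍ) {ε : ℝ} (hε : 0 < ε) :
    ∃ O ∈ 𝓝 p, IsOpen O ∧ DefectLE E U v ε O := by
  obtain ⟨hn, ρ, hρ, hρ0, hgrad, hρU⟩ := id h
  obtain ⟨ψ, hax⟩ := exists_isAxis finrank_quaternion hn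
  -- choice of the constants
  obtain ⟨c, hc0, hc4, hcε⟩ : ∃ c : NNReal, 0 < c ∧ c ≤ 1 / 4 ∧
      (((2 * c : NNReal) : ℝ) + ((1 + ((2 * c : NNReal) : ℝ)) ^ 3 - 1) + c) * ‖v‖ ≤ ε := by
    have ht : Tendsto (fun c : NNReal =>
        (((2 * c : NNReal) : ℝ) + ((1 + ((2 * c : NNReal) : ℝ)) ^ 3 - 1) + c) * ‖v‖)
        (𝓝[>] 0) (𝓝 0) := by
      have h1 : Continuous fun c : NNReal =>
          (((2 * c : NNReal) : ℝ) + ((1 + ((2 * c : NNReal) : ℝ)) ^ 3 - 1) + c) * ‖v‖ := by fun_prop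
      have := (h1.tendsto 0).mono_left (nhdsWithin_le_nhds (s := Set.Ioi 0))
      simpa using this
    have h2 : ∀ᶠ c : NNReal in 𝓝[>] 0, c ≤ 1 / 4 :=
      nhdsWithin_le_nhds (eventually_le_nhds (by norm_num))
    obtain ⟨c, h3, h4, h5⟩ := ((ht.eventually (gt_mem_nhds hε)).and
      (h2.and self_mem_nhdsWithin)).exists
    exact ⟨c, h5, h4, h3.le⟩
  obtain ⟨s, hs, hlin⟩ := (hρ.hasStrictFDerivAt' hgrad.hasFDerivAt
    one_ne_zero).approximates_deriv_on_nhds (c := c) (Or.inr hc0)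
  have hnear : ∀ᶠ q in 𝓝 p, q ∈ frontier U → ‖outwardNormal U q - n‖ ≤ c := by
    have h1 := (h.eventually hUo).2
    rw [ContinuousWithinAt, h.outwardNormal_eq] at h1
    have h2 := h1.eventually (Metric.closedBall_mem_nhds n (ε := (c : ℝ)) (by exact_mod_cast hc0))
    rw [eventually_nhdsWithin_iff] at h2
    filter_upwards [h2] with q hq hqf
    simpa [dist_eq_norm] using hq hqf
  obtain ⟨R, hR, hRball⟩ := Metric.mem_nhds_iff.1 (inter_mem hs (inter_mem hρU hnear))
  obtain ⟨φ, hφ, hgr⟩ := exists_isBelowGraph finrank_quaternion hax hUo hR hc4 hρ0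
    (fun a ha b hb => by
      have := hlin a (hRball ha).1 b (hRball hb).1
      rwa [InnerProductSpace.toDual_apply_apply, Real.norm_eq_abs] at this)
    (fun Z hZ => (hRball hZ).2.1)
  have hR4 : 0 < R / 4 := by positivity
  refine ⟨Metric.ball p (R / 4), Metric.ball_mem_nhds _ hR4, Metric.isOpen_ball, ?_⟩
  intro g hg hcg hsg
  refine (norm_divergence_sub_boundary_le finrank_quaternion hax hUo hU.finite_area hφ hgr
    (hU.aestronglyMeasurable_outwardNormal hUo) (δ := c) ?_ v hg hcg ?_).trans ?_
  · intro z hz1 hz2 hzf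
    refine (hRball ?_).2.2 hzf
    rw [Metric.mem_ball, dist_eq_norm, IsAxis.cylCoord_sub_self]
    refine (hax.norm_le _ _).trans_lt ?_
    linarith
  · intro z hz
    have h1 := hsg hz
    rw [Metric.mem_ball, dist_eq_norm, IsAxis.cylCoord_sub_self] at h1
    have h2 := hax.norm_sq z.1 z.2
    constructor
    · refine lt_of_le_of_lt (le_of_sq_le_sq ?_ (norm_nonneg _)) h1
      rw [h2]; nlinarith [sq_nonneg z.2]
    · refine lt_of_le_of_lt (le_of_sq_le_sq ?_ (norm_nonneg _)) h1
      rw [h2, sq_abs]; nlinarith [sq_nonneg ‖z.1‖]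
  · exact mul_le_mul_of_nonneg_right hcε (integral_nonneg fun _ => norm_nonneg _)

lemma exists_contDiff_cutoff {K O : Set ℍ} (hK : IsClosed K) (hO : IsOpen O) (hKO : K ⊆ O) :
    ∃ χ : ℍ → ℝ, ContDiff ℝ 1 χ ∧ (∀ᶠ x in 𝓝ˢ K, χ x = 1) ∧ tsupport χ ⊆ O ∧
      ∀ x, χ x ∈ Set.Icc 0 1 := by
  obtain ⟨O', hO', hKO', hO'O⟩ := normal_exists_closure_subset hK hO hKO
  obtain ⟨f, hf1, hf0, hf⟩ := exists_contMDiffMap_one_nhds_of_subset_interior (n := 1)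
    (modelWithCornersSelf ℝ ℍ) hK (hKO'.trans hO'.interior_eq.symm.subset)
  refine ⟨f, f.contMDiff.contDiff, hf1, ?_, hf⟩
  refine (closure_mono fun x hx => ?_).trans hO'O
  by_contra h
  exact hx (hf0 x h)

/-- For a cutoff χ with values in [0, 1] the norms add exactly, ‖χg‖ + ‖(1 − χ)g‖ = ‖g‖. The same ε
therefore survives any number of unions, although the gradients of χ are not controlled. -/
lemma DefectLE.union [CompleteSpace E] {U : Set ℍ} (hUo : IsOpen U)
    (hU : HasPiecewiseC1Boundary U) {v : ℍ} {ε : ℝ} {O O' : Set ℍ} (hO : IsOpen O)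
    (hO' : IsOpen O') (h : DefectLE E U v ε O) (h' : DefectLE E U v ε O') :
    DefectLE E U v ε (O ∪ O') := by
  intro g hg hc hs
  -- χ is made equal to 1 near the part of the support outside `O'`, which forces (1 − χ)g to be
  -- supported in `O'`.
  have hKc : IsClosed (tsupport g \ O') := (isClosed_tsupport g).sdiff hO'
  obtain ⟨χ, hχ, hχ1, hχs, hχ01⟩ := exists_contDiff_cutoff hKc hO
    (fun x hx => (hs hx.1).resolve_right hx.2)
  have : IsFiniteMeasure ((μHE[3] : Measure ℍ).restrict (frontier U)) :=
    ⟨by simpa using hU.finite_area⟩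
  set g1 : ℍ → E := fun x => χ x • g x
  set g2 : ℍ → E := fun x => (1 - χ x) • g x
  have hg1 : ContDiff ℝ 1 g1 := hχ.smul hg
  have hg2 : ContDiff ℝ 1 g2 := (contDiff_const.sub hχ).smul hg
  have hc1 : HasCompactSupport g1 := hc.smul_left
  have hc2 : HasCompactSupport g2 := hc.smul_left
  have hs1 : tsupport g1 ⊆ O := (tsupport_smul_subset_left _ _).trans hχs
  have hs2 : tsupport g2 ⊆ O' := by
    intro x hx
    by_contra hxO
    have hxg : x ∈ tsupport g := tsupport_smul_subset_right _ _ hx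
    have h1 : ∀ᶠ y in 𝓝 x, χ y = 1 := (eventually_nhdsSet_iff_forall.1 hχ1) x ⟨hxg, hxO⟩
    have h2 : g2 =ᶠ[𝓝 x] 0 := by
      filter_upwards [h1] with y hy
      simp [g2, hy]
    exact (notMem_tsupport_iff_eventuallyEq.2 h2) hx
  have hsum : g = fun x => g1 x + g2 x := by
    funext x; simp only [g1, g2]; rw [← add_smul]; simp
  have hiv : ∀ {k : ℍ → E}, ContDiff ℝ 1 k → HasCompactSupport k →
      IntegrableOn (fun x => fderiv ℝ k x v) U := fun hk hkc =>
    (((hk.continuous_fderiv one_ne_zero).clm_apply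
      continuous_const).integrable_of_hasCompactSupport (hkc.fderiv_apply ℝ _)).integrableOn
  have hib : ∀ {k : ℍ → E}, ContDiff ℝ 1 k → HasCompactSupport k →
      IntegrableOn (fun q => inner ℝ (outwardNormal U q) v • k q) (frontier U) μHE[3] := by
    intro k hk hkc
    have hki := hk.continuous.integrable_of_hasCompactSupport hkc
      (μ := (μHE[3] : Measure ℍ).restrict (frontier U))
    refine (hki.norm.const_mul ‖v‖).mono' (((hU.aestronglyMeasurable_outwardNormal hUo).inner
      aestronglyMeasurable_const).smul hki.aestronglyMeasurable) (Eventually.of_forall fun q => ?_)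
    rw [norm_smul]
    refine mul_le_mul_of_nonneg_right ((norm_inner_le_norm _ _).trans ?_) (norm_nonneg _)
    exact mul_le_of_le_one_left (norm_nonneg _) (norm_outwardNormal_le U q)
  have hin : ∀ {k : ℍ → E}, ContDiff ℝ 1 k → HasCompactSupport k →
      IntegrableOn (fun q => ‖k q‖) (frontier U) μHE[3] := fun hk hkc =>
    (hk.continuous.integrable_of_hasCompactSupport hkc).norm
  have e1 : ∫ x in U, fderiv ℝ g x v =
      (∫ x in U, fderiv ℝ g1 x v) + ∫ x in U, fderiv ℝ g2 x v := by
    rw [← integral_add (hiv hg1 hc1) (hiv hg2 hc2)]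
    congr 1; funext x
    conv_lhs => rw [hsum]
    rw [fderiv_fun_add (hg1.differentiable one_ne_zero x) (hg2.differentiable one_ne_zero x)]
    rfl
  have e2 : ∫ q in frontier U, inner ℝ (outwardNormal U q) v • g q ∂μHE[3] =
      (∫ q in frontier U, inner ℝ (outwardNormal U q) v • g1 q ∂μHE[3]) +
      ∫ q in frontier U, inner ℝ (outwardNormal U q) v • g2 q ∂μHE[3] := by
    rw [← integral_add (hib hg1 hc1) (hib hg2 hc2)]
    congr 1; funext x
    rw [← smul_add, ← congrFun hsum x]
  have e3 : ∫ q in frontier U, ‖g q‖ ∂μHE[3] =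
      (∫ q in frontier U, ‖g1 q‖ ∂μHE[3]) + ∫ q in frontier U, ‖g2 q‖ ∂μHE[3] := by
    rw [← integral_add (hin hg1 hc1) (hin hg2 hc2)]
    congr 1; funext x
    simp only [g1, g2]
    rw [norm_smul, norm_smul, Real.norm_of_nonneg (hχ01 x).1,
      Real.norm_of_nonneg (sub_nonneg.2 (hχ01 x).2)]
    ring
  rw [e1, e2, e3, add_sub_add_comm, mul_add]
  exact (norm_add_le _ _).trans (add_le_add (h g1 hg1 hc1 hs1) (h' g2 hg2 hc2 hs2))

/-- The divergence theorem for vector fields supported away from the singular boundary points. -/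
lemma gaussGreen_of_regular [CompleteSpace E] {U : Set ℍ} (hUo : IsOpen U)
    (hU : HasPiecewiseC1Boundary U) (v : ℍ) {g : ℍ → E} (hg : ContDiff ℝ 1 g)
    (hc : HasCompactSupport g) (hreg : tsupport g ∩ frontier U ⊆ regularBoundary U) :
    ∫ x in U, fderiv ℝ g x v =
      ∫ q in frontier U, inner ℝ (outwardNormal U q) v • g q ∂μHE[3] := by
  have key : ∀ ε > 0, ‖(∫ x in U, fderiv ℝ g x v) -
      ∫ q in frontier U, inner ℝ (outwardNormal U q) v • g q ∂μHE[3]‖ ≤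
      ε * ∫ q in frontier U, ‖g q‖ ∂μHE[3] := by
    intro ε hε
    -- Compactness of the support reduces the claim to neighbourhoods of single points: in U and off
    -- its closure both sides vanish, and regular boundary points have the local estimate.
    have h1 : ∃ O, IsOpen O ∧ tsupport g ⊆ O ∧ DefectLE E U v ε O := by
      refine hc.isCompact.induction_on (p := fun s => ∃ O, IsOpen O ∧ s ⊆ O ∧ DefectLE E U v ε O)
        ⟨U, hUo, Set.empty_subset _, defectLE_of_subset hUo v hε.le⟩
        (fun s t hst ⟨O, h1, h2, h3⟩ => ⟨O, h1, hst.trans h2, h3⟩)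
        (fun s t ⟨O, h1, h2, h3⟩ ⟨O', h1', h2', h3'⟩ => ⟨O ∪ O', h1.union h1',
          Set.union_subset_union h2 h2', h3.union hUo hU h1 h1' h3'⟩) fun p hp => ?_
      by_cases hpU : p ∈ U
      · exact ⟨U, nhdsWithin_le_nhds (hUo.mem_nhds hpU), U, hUo, subset_rfl,
          defectLE_of_subset hUo v hε.le⟩
      by_cases hpc : p ∈ closure U
      · have hpf : p ∈ frontier U := by rw [hUo.frontier_eq]; exact ⟨hpc, hpU⟩
        obtain ⟨-, n, hn⟩ := hreg ⟨hp, hpf⟩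
        obtain ⟨O, hpO, hO, hd⟩ := hn.exists_defectLE (E := E) hUo hU v hε
        exact ⟨O, nhdsWithin_le_nhds hpO, O, hO, subset_rfl, hd⟩
      · have ho : IsOpen (closure U)ᶜ := isClosed_closure.isOpen_compl
        exact ⟨_, nhdsWithin_le_nhds (ho.mem_nhds hpc), _, ho, subset_rfl,
          defectLE_of_disjoint v hε.le⟩
    obtain ⟨O, -, hO, hd⟩ := h1
    exact hd g hg hc hO
  have ht : Tendsto (fun ε : ℝ => ε * ∫ q in frontier U, ‖g q‖ ∂μHE[3]) (𝓝[>] 0) (𝓝 0) := by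
    have : Tendsto (fun ε : ℝ => ε * ∫ q in frontier U, ‖g q‖ ∂μHE[3]) (𝓝[>] 0)
        (𝓝 (0 * ∫ q in frontier U, ‖g q‖ ∂μHE[3])) :=
      (tendsto_id.mono_left nhdsWithin_le_nhds).mul_const _
    simpa using this
  have h0 := ge_of_tendsto ht (by filter_upwards [self_mem_nhdsWithin] with ε hε using key ε hε)
  exact sub_eq_zero.1 (norm_le_zero_iff.1 h0)

end GaussGreen

/-! ### Cutoff functions around a compact set of vanishing area. -/

section SingularSet

/-- Each set of an efficient Hausdorff cover that meets S is enclosed in a ball centred at a point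
of S. Its radius is the diameter plus a positive padding, which keeps balls around single points
nondegenerate and makes the cover open; compactness then leaves finitely many balls. -/
lemma exists_ball_cover {X : Type*} [MetricSpace X] [MeasurableSpace X] [BorelSpace X]
    {S : Set X} (hS : IsCompact S) {d : ℕ} (hd : d ≠ 0) (h0 : (μHE[d] : Measure X) S = 0) {ε : ℝ} (hε : 0 < ε) :
    ∃ (ι : Type) (m : Finset ι) (x : ι → X) (r : ι → ℝ), (∀ i, 0 < r i ∧ r i ≤ ε ∧ x i ∈ S) ∧
      S ⊆ ⋃ i ∈ m, Metric.ball (x i) (r i) ∧ ∑ i ∈ m, r i ^ d ≤ ε := by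
  have hH : (μH[d] : Measure X) S = 0 := by
    rw [Measure.euclideanHausdorffMeasure_def, Measure.smul_apply, ENNReal.smul_def,
      smul_eq_mul, mul_eq_zero] at h0
    exact h0.resolve_left (by
      simpa using Measure.addHaarScalarFactor_volume_hausdorffMeasure_ne_zero d)
  rw [Measure.hausdorffMeasure_apply] at hH
  have hε2 : (0 : ℝ≥0∞) < ENNReal.ofReal (ε / 2) := ENNReal.ofReal_pos.2 (by positivity)
  have h1 := ENNReal.iSup_eq_zero.1 (ENNReal.iSup_eq_zero.1 hH (ENNReal.ofReal (ε / 2))) hε2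
  -- the total budget
  obtain ⟨κ, hκ, hκε⟩ : ∃ κ : ℝ, 0 < κ ∧ (2 : ℝ) ^ d * (κ + κ) ≤ ε := by
    refine ⟨ε / (2 ^ d * 2), by positivity, le_of_eq ?_⟩
    field_simp
    norm_num
  have h2 := h1.trans_lt (ENNReal.ofReal_pos.2 hκ)
  simp only [iInf_lt_iff] at h2
  obtain ⟨t, hSt, hdiam, hsum⟩ := h2
  obtain ⟨a, ha0, haκ⟩ := ENNReal.exists_pos_sum_of_countable (ENNReal.ofReal_pos.2 hκ).ne' ℕ
  -- The bound 1 gives b^d ≤ b, so the summable sequence `a` controls the d-th powers; the bound ε/2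
  -- keeps the radii below ε.
  let b : ℕ → ℝ := fun n => min (ε / 2) (min 1 (a n))
  have hb0 : ∀ n, 0 < b n := fun n =>
    lt_min (by positivity) (lt_min one_pos (by exact_mod_cast ha0 n))
  let I := {n // (t n ∩ S).Nonempty}
  have hdfin : ∀ n, Metric.ediam (t n) ≠ ∞ := fun n =>
    ((hdiam n).trans_lt ENNReal.ofReal_lt_top).ne
  let D : ℕ → ℝ := fun n => (Metric.ediam (t n)).toReal
  have hD : ∀ n, D n ≤ ε / 2 := fun n => ENNReal.toReal_le_of_le_ofReal (by positivity) (hdiam n)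
  have hD0 : ∀ n, 0 ≤ D n := fun n => ENNReal.toReal_nonneg
  choose x hx using fun i : I => i.2
  obtain ⟨m, hm⟩ := hS.elim_finite_subcover
    (fun i : I => Metric.ball (x i) (D i + b i)) (fun i => Metric.isOpen_ball) (by
      intro q hq
      obtain ⟨n, hn⟩ := Set.mem_iUnion.1 (hSt hq)
      refine Set.mem_iUnion.2 ⟨⟨n, q, hn, hq⟩, ?_⟩
      set i : I := ⟨n, q, hn, hq⟩
      rw [Metric.mem_ball]
      have h3 : dist q (x i) ≤ D n := by
        rw [dist_edist]
        exact ENNReal.toReal_mono (hdfin n) (Metric.edist_le_ediam_of_mem hn (hx i).1)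
      exact h3.trans_lt (lt_add_of_pos_right _ (hb0 n)))
  refine ⟨I, m, x, fun i => D i + b i, fun i => ⟨?_, ?_, (hx i).2⟩, hm, ?_⟩
  · have := hb0 i; have := hD0 i; positivity
  · have := hD i
    have : b i ≤ ε / 2 := min_le_left _ _
    linarith
  -- the sum of the powers of the radii
  have hpow : ∀ i : I, (D i + b i) ^ d ≤ 2 ^ d * (D i ^ d + a i) := by
    intro i
    have h3 : b i ≤ 1 := (min_le_right _ _).trans (min_le_left _ _)
    have h4 : b i ≤ a i := (min_le_right _ _).trans (min_le_right _ _)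
    have h5 : b i ^ d ≤ a i := (pow_le_of_le_one (hb0 i).le h3 hd).trans h4
    refine (add_pow_le (hD0 i) (hb0 i).le d).trans ?_
    refine mul_le_mul (pow_le_pow_right₀ one_le_two (Nat.sub_le _ _)) (by linarith) ?_
      (by positivity)
    have := hD0 i; have := (hb0 i).le; positivity
  have hsumD : ∑ i ∈ m, D i ^ d ≤ κ := by
    rw [← ENNReal.ofReal_le_ofReal_iff hκ.le, ENNReal.ofReal_sum_of_nonneg
      (f := fun i : I => D i ^ d) fun i _ => pow_nonneg (hD0 i) d]
    refine le_trans ?_ hsum.le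
    calc ∑ i ∈ m, ENNReal.ofReal (D i ^ d)
        = ∑ i ∈ m, ⨆ _ : (t i).Nonempty, Metric.ediam (t i) ^ (d : ℝ) := by
          refine Finset.sum_congr rfl fun i _ => ?_
          rw [ciSup_pos ⟨x i, (hx i).1⟩, ENNReal.rpow_natCast, ENNReal.ofReal_pow (hD0 i),
            ENNReal.ofReal_toReal (hdfin i)]
      _ ≤ ∑' i : I, ⨆ _ : (t i).Nonempty, Metric.ediam (t i) ^ (d : ℝ) := ENNReal.sum_le_tsum m
      _ ≤ _ := ENNReal.tsum_comp_le_tsum_of_injective Subtype.val_injective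
          (fun n => ⨆ _ : (t n).Nonempty, Metric.ediam (t n) ^ (d : ℝ))
  have hsuma : ∑ i ∈ m, (a i : ℝ) ≤ κ := by
    rw [← ENNReal.ofReal_le_ofReal_iff hκ.le, ENNReal.ofReal_sum_of_nonneg
      (f := fun i : I => (a i : ℝ)) fun i _ => (a i).2]
    refine le_trans ?_ haκ.le
    calc ∑ i ∈ m, ENNReal.ofReal (a i) = ∑ i ∈ m, (a i : ℝ≥0∞) := by simp
      _ ≤ ∑' i : I, (a i : ℝ≥0∞) := ENNReal.sum_le_tsum m
      _ ≤ _ := ENNReal.tsum_comp_le_tsum_of_injective Subtype.val_injective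
          (fun n => (a n : ℝ≥0∞))
  calc ∑ i ∈ m, (D i + b i) ^ d ≤ ∑ i ∈ m, 2 ^ d * (D i ^ d + a i) :=
        Finset.sum_le_sum fun i _ => hpow i
    _ = 2 ^ d * (∑ i ∈ m, D i ^ d + ∑ i ∈ m, (a i : ℝ)) := by
        rw [← Finset.mul_sum, Finset.sum_add_distrib]
    _ ≤ 2 ^ d * (κ + κ) := by gcongr
    _ ≤ ε := hκε

variable {H : Type*} [NormedAddCommGroup H] [InnerProductSpace ℝ H]

/-- A product of cutoff functions vanishing on small balls. -/
lemma exists_cutoff_finset {ι : Type} (m : Finset ι) (x : ι → H) (r : ι → ℝ)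
    (hr : ∀ i, 0 < r i) {θ : H → ℝ} (hθ : ContDiff ℝ 1 θ) (hθ01 : ∀ x, θ x ∈ Set.Icc 0 1)
    (hθ1 : ∀ x ∈ Metric.ball 0 1, θ x = 1) (hθ0 : ∀ x ∉ Metric.closedBall 0 2, θ x = 0) {C : ℝ}
    (hC : ∀ x, ‖fderiv ℝ θ x‖ ≤ C) :
    ∃ η : H → ℝ, ContDiff ℝ 1 η ∧ (∀ y, η y ∈ Set.Icc 0 1) ∧
      (∀ i ∈ m, ∀ y ∈ Metric.ball (x i) (r i), η y = 0) ∧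
      (∀ y, (∀ i ∈ m, y ∉ Metric.closedBall (x i) (2 * r i)) → η y = 1) ∧
      ∀ y, ‖fderiv ℝ η y‖ ≤
        ∑ i ∈ m, (Metric.closedBall (x i) (2 * r i)).indicator (fun _ => C / r i) y := by
  classical
  induction m using Finset.induction_on with
  | empty =>
    exact ⟨fun _ => 1, contDiff_const, fun _ => ⟨zero_le_one, le_rfl⟩, by simp, by simp, fun y => by
      have h0 : fderiv ℝ (fun _ : H => (1 : ℝ)) y = 0 := fderiv_const_apply 1
      rw [h0, Finset.sum_empty, norm_zero]⟩
  | insert j m hj ih =>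
    obtain ⟨η, h1, h2, h3, h4, h5⟩ := ih
    let A : H → H := fun y => (r j)⁻¹ • (y - x j)
    have hAn : ∀ y, ‖A y‖ = (r j)⁻¹ * dist y (x j) := fun y => by
      rw [norm_smul, Real.norm_of_nonneg (inv_nonneg.2 (hr j).le), dist_eq_norm]
    have hA : ContDiff ℝ 1 A := by fun_prop
    have hA' : ∀ y, HasFDerivAt A ((r j)⁻¹ • ContinuousLinearMap.id ℝ H) y := fun y =>
      ((hasFDerivAt_id y).sub_const (x j)).fun_const_smul _
    let κ : H → ℝ := fun y => 1 - θ (A y)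
    have hκ : ContDiff ℝ 1 κ := contDiff_const.sub (hθ.comp hA)
    have hκ01 : ∀ y, κ y ∈ Set.Icc 0 1 := fun y =>
      ⟨sub_nonneg.2 (hθ01 _).2, sub_le_self _ (hθ01 _).1⟩
    have hκ1 : ∀ y ∉ Metric.closedBall (x j) (2 * r j), κ y = 1 := by
      intro y hy
      have : θ (A y) = 0 := hθ0 _ (by
        rw [mem_closedBall_zero_iff, hAn, not_le, lt_inv_mul_iff₀ (hr j), mul_comm]
        simpa using hy)
      simp [κ, this]
    have hκd : ∀ y, ‖fderiv ℝ κ y‖ ≤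
        (Metric.closedBall (x j) (2 * r j)).indicator (fun _ => C / r j) y := by
      intro y
      by_cases hy : y ∈ Metric.closedBall (x j) (2 * r j)
      · rw [Set.indicator_of_mem hy]
        have h6 := ((hθ.differentiable one_ne_zero (A y)).hasFDerivAt.comp y (hA' y)).const_sub 1
        have h7 : fderiv ℝ κ y = _ := h6.fderiv
        rw [h7, norm_neg, ContinuousLinearMap.comp_smul, ContinuousLinearMap.comp_id, norm_smul,
          Real.norm_of_nonneg (inv_nonneg.2 (hr j).le), div_eq_inv_mul]
        exact mul_le_mul_of_nonneg_left (hC _) (inv_nonneg.2 (hr j).le)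
      · rw [Set.indicator_of_notMem hy]
        have h6 : κ =ᶠ[𝓝 y] fun _ => 1 := by
          filter_upwards [Metric.isClosed_closedBall.isOpen_compl.mem_nhds hy] with z hz
          exact hκ1 z hz
        rw [h6.fderiv_eq]; simp
    refine ⟨fun y => κ y * η y, hκ.mul h1, fun y => ⟨mul_nonneg (hκ01 y).1 (h2 y).1,
      mul_le_one₀ (hκ01 y).2 (h2 y).1 (h2 y).2⟩, ?_, ?_, ?_⟩
    · intro i hi y hy
      rcases Finset.mem_insert.1 hi with rfl | hi
      · have : θ (A y) = 1 := hθ1 _ (by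
          rw [mem_ball_zero_iff, hAn, inv_mul_lt_iff₀ (hr i), mul_one]
          simpa using hy)
        simp [κ, this]
      · simp [h3 i hi y hy]
    · intro y hy
      have e1 := hκ1 y (hy j (Finset.mem_insert_self _ _))
      have e2 := h4 y fun i hi => hy i (Finset.mem_insert_of_mem hi)
      simp only [e1, e2, mul_one]
    · intro y
      rw [Finset.sum_insert hj, fderiv_fun_mul (hκ.differentiable one_ne_zero y)
        (h1.differentiable one_ne_zero y), add_comm (Set.indicator _ _ _)]
      refine (norm_add_le _ _).trans (add_le_add ?_ ?_)
      · rw [norm_smul, Real.norm_of_nonneg (hκ01 y).1]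
        exact (mul_le_of_le_one_left (norm_nonneg _) (hκ01 y).2).trans (h5 y)
      · rw [norm_smul, Real.norm_of_nonneg (h2 y).1]
        exact (mul_le_of_le_one_left (norm_nonneg _) (h2 y).2).trans (hκd y)

set_option maxHeartbeats 400000 in
/-- Cutoff functions near a compact set of vanishing area, with small gradients in the mean. -/
lemma exists_cutoff_seq [FiniteDimensional ℝ H] [MeasurableSpace H] [BorelSpace H]
    {d : ℕ} (hd : d ≠ 0) (hH : Module.finrank ℝ H = d + 1) {S : Set H} (hS : IsCompact S)
    (h0 : (μHE[d] : Measure H) S = 0) (v : H) :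
    ∃ η : ℕ → H → ℝ, (∀ k, ContDiff ℝ 1 (η k)) ∧ (∀ k y, η k y ∈ Set.Icc 0 1) ∧
      (∀ k, ∃ O, IsOpen O ∧ S ⊆ O ∧ ∀ y ∈ O, η k y = 0) ∧
      (∀ y ∉ S, Tendsto (fun k => η k y) atTop (𝓝 1)) ∧
      (∀ k, Integrable fun y => fderiv ℝ (η k) y v) ∧
      Tendsto (fun k => ∫ y, ‖fderiv ℝ (η k) y v‖) atTop (𝓝 0) := by
  let θ : ContDiffBump (0 : H) := ⟨1, 2, one_pos, one_lt_two⟩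
  have hθ : ContDiff ℝ 1 θ := θ.contDiff
  obtain ⟨C, hC⟩ := (θ.hasCompactSupport.fderiv ℝ).exists_bound_of_continuous
    (hθ.continuous_fderiv one_ne_zero)
  have hC0 : 0 ≤ C := (norm_nonneg _).trans (hC 0)
  have hθ0 : ∀ x ∉ Metric.closedBall (0 : H) 2, θ x = 0 := fun x hx => by
    rw [mem_closedBall_zero_iff, not_le] at hx
    exact θ.zero_of_le_dist (by simpa using hx.le)
  have hε : ∀ k : ℕ, (0 : ℝ) < 1 / (k + 1) := fun k => by positivity
  choose ι m x r hr hcov hsum using fun k => exists_ball_cover hS hd h0 (hε k)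
  choose η hη1 hη2 hη3 hη4 hη5 using fun k => exists_cutoff_finset (m k) (x k) (r k)
    (fun i => (hr k i).1) hθ (fun x => ⟨θ.nonneg, θ.le_one⟩)
    (fun x hx => θ.one_of_mem_closedBall (Metric.ball_subset_closedBall hx)) hθ0 hC
  set c := (volume (Metric.ball (0 : H) 1)).toReal
  have hc0 : 0 ≤ c := ENNReal.toReal_nonneg
  have hvol : ∀ (a : H) {R : ℝ}, 0 < R → volume.real (Metric.closedBall a R) = R ^ (d + 1) * c := by
    intro a R hR
    rw [measureReal_def, Measure.addHaar_closedBall _ _ hR.le, hH,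
      ENNReal.toReal_mul, ENNReal.toReal_ofReal (by positivity)]
  have hind : ∀ k i, Integrable
      ((Metric.closedBall (x k i) (2 * r k i)).indicator fun _ => C / r k i) := fun k i =>
    (integrable_indicator_iff measurableSet_closedBall).2
      (integrableOn_const (hs := measure_closedBall_lt_top.ne))
  have hbd : ∀ k y, ‖fderiv ℝ (η k) y v‖ ≤ (∑ i ∈ m k,
      (Metric.closedBall (x k i) (2 * r k i)).indicator (fun _ => C / r k i) y) * ‖v‖ := fun k y =>
    ((fderiv ℝ (η k) y).le_opNorm v).trans (mul_le_mul_of_nonneg_right (hη5 k y) (norm_nonneg _))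
  have hbi : ∀ k, Integrable fun y => (∑ i ∈ m k,
      (Metric.closedBall (x k i) (2 * r k i)).indicator (fun _ => C / r k i) y) * ‖v‖ := fun k =>
    (integrable_finsetSum (m k) fun i _ => hind k i).mul_const _
  have hint : ∀ k, Integrable fun y => fderiv ℝ (η k) y v := fun k =>
    (hbi k).mono' (((hη1 k).continuous_fderiv one_ne_zero).clm_apply
      continuous_const).aestronglyMeasurable (Eventually.of_forall (hbd k))
  refine ⟨η, hη1, hη2, fun k => ⟨⋃ i ∈ m k, Metric.ball (x k i) (r k i),
    isOpen_biUnion fun i _ => Metric.isOpen_ball, hcov k, fun y hy => ?_⟩, fun y hy => ?_, hint, ?_⟩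
  · obtain ⟨i, hi, hy⟩ := Set.mem_iUnion₂.1 hy
    exact hη3 k i hi y hy
  · refine tendsto_const_nhds.congr' ?_
    have hpos : ∀ᶠ k : ℕ in atTop, 2 * (1 / ((k : ℝ) + 1)) < Metric.infDist y S ∨ S = ∅ := by
      rcases S.eq_empty_or_nonempty with h | h
      · exact Eventually.of_forall fun _ => Or.inr h
      · have h1 : 0 < Metric.infDist y S :=
          (hS.isClosed.notMem_iff_infDist_pos h).1 hy
        have h2 : Tendsto (fun k : ℕ => 2 * (1 / ((k : ℝ) + 1))) atTop (𝓝 (2 * 0)) :=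
          tendsto_one_div_add_atTop_nhds_zero_nat.const_mul 2
        rw [mul_zero] at h2
        exact (h2.eventually (gt_mem_nhds h1)).mono fun k hk => Or.inl hk
    filter_upwards [hpos] with k hk
    refine (hη4 k y fun i hi hyi => ?_).symm
    rcases hk with hk | hk
    · have h1 : Metric.infDist y S ≤ dist y (x k i) := Metric.infDist_le_dist_of_mem (hr k i).2.2
      have h2 : dist y (x k i) ≤ 2 * r k i := hyi
      have h3 := (hr k i).2.1
      linarith
    · have := (hr k i).2.2
      rw [hk] at this; exact this
  -- A gradient of size C/r on a ball of volume (2r)^(d+1)c contributes a multiple of r^d, exactly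
  -- the quantity whose sum is small.
  · have hb : ∀ k, ∫ y, ‖fderiv ℝ (η k) y v‖ ≤
        2 ^ (d + 1) * C * c * ‖v‖ * (1 / ((k : ℝ) + 1)) := by
      intro k
      calc ∫ y, ‖fderiv ℝ (η k) y v‖ ≤ ∫ y, (∑ i ∈ m k,
            (Metric.closedBall (x k i) (2 * r k i)).indicator (fun _ => C / r k i) y) * ‖v‖ :=
            integral_mono (hint k).norm (hbi k) (hbd k)
        _ = (∑ i ∈ m k, 2 ^ (d + 1) * C * c * r k i ^ d) * ‖v‖ := by
            rw [integral_mul_const, integral_finsetSum _ fun i _ => hind k i]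
            congr 1
            refine Finset.sum_congr rfl fun i _ => ?_
            have := (hr k i).1
            rw [integral_indicator measurableSet_closedBall, setIntegral_const,
              hvol _ (by positivity), smul_eq_mul, mul_pow, pow_succ (r k i)]
            field_simp
        _ = 2 ^ (d + 1) * C * c * ‖v‖ * ∑ i ∈ m k, r k i ^ d := by
            rw [← Finset.mul_sum]; ring
        _ ≤ _ := mul_le_mul_of_nonneg_left (hsum k) (by positivity)
    refine squeeze_zero (fun k => integral_nonneg fun _ => norm_nonneg _) hb ?_
    simpa using tendsto_one_div_add_atTop_nhds_zero_nat.const_mul (2 ^ (d + 1) * C * c * ‖v‖)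

end SingularSet

/-! ### The divergence theorem with singular boundary points. -/

section GaussGreen

variable {E : Type*} [NormedAddCommGroup E] [NormedSpace ℝ E] [CompleteSpace E]

/-- The theorem is applied to ηₖg, where ηₖ vanishes near the singular set. The product rule adds
the term ∇ηₖ · g, which tends to 0 because g is bounded and ∇ηₖ tends to 0 in L¹; the other terms
converge dominatedly. -/
lemma gaussGreen_of_hasCompactSupport {U : Set ℍ} (hUo : IsOpen U) (hUb : Bornology.IsBounded U)
    (hU : HasPiecewiseC1Boundary U) (v : ℍ) {g : ℍ → E} (hg : ContDiff ℝ 1 g)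
    (hc : HasCompactSupport g) :
    ∫ x in U, fderiv ℝ g x v =
      ∫ q in frontier U, inner ℝ (outwardNormal U q) v • g q ∂μHE[3] := by
  set S := frontier U \ regularBoundary U with hSdef
  have hS0 : (μHE[3] : Measure ℍ) S = 0 := by
    refine measure_mono_null (fun p hp => ?_) hU.null_singular
    exact ⟨hp.1, fun h => hp.2 ⟨hp.1, h⟩⟩
  have hSc : IsCompact S := by
    obtain ⟨O, hO, hR⟩ := exists_isOpen_regularBoundary hUo
    have h1 : S = frontier U \ O := by rw [hSdef, hR, Set.sdiff_self_inter]
    rw [h1]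
    exact (Metric.isCompact_of_isClosed_isBounded isClosed_frontier
      (hUb.closure.subset frontier_subset_closure)).diff hO
  -- Volume is 4-dimensional Hausdorff measure, which vanishes on a set of zero 3-dimensional
  -- measure. This gives ηₖ → 1 almost everywhere in U as well as on the boundary.
  have hSv : (volume : Measure ℍ) S = 0 := by
    have h1 : (volume : Measure ℍ) = μHE[4] := by
      rw [← InnerProductSpace.euclideanHausdorffMeasure_eq_volume, finrank_quaternion]
    rw [h1]
    refine (Measure.euclideanHausdorffMeasure_zero_or_top (show 3 < 4 by norm_num) S).resolve_right
      fun h => ?_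
    rw [hS0] at h; exact ENNReal.zero_ne_top h
  obtain ⟨η, hη1, hη01, hη0, hηlim, hηi, hηint⟩ :=
    exists_cutoff_seq three_ne_zero finrank_quaternion hSc hS0 v
  have : IsFiniteMeasure ((μHE[3] : Measure ℍ).restrict (frontier U)) :=
    ⟨by simpa using hU.finite_area⟩
  have hgb : Integrable g ((μHE[3] : Measure ℍ).restrict (frontier U)) :=
    hg.continuous.integrable_of_hasCompactSupport hc
  have hdc : Continuous fun x => fderiv ℝ g x v :=
    (hg.continuous_fderiv one_ne_zero).clm_apply continuous_const
  have hdi : Integrable fun x => fderiv ℝ g x v :=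
    hdc.integrable_of_hasCompactSupport (hc.fderiv_apply ℝ _)
  obtain ⟨M, hM⟩ := hc.exists_bound_of_continuous hg.continuous
  have hNm := hU.aestronglyMeasurable_outwardNormal hUo
  have hk : ∀ k, (∫ x in U, η k x • fderiv ℝ g x v) + ∫ x in U, fderiv ℝ (η k) x v • g x =
      ∫ q in frontier U, η k q • (inner ℝ (outwardNormal U q) v • g q) ∂μHE[3] := by
    intro k
    obtain ⟨O, hO, hSO, hO0⟩ := hη0 k
    have h1 := gaussGreen_of_regular hUo hU v ((hη1 k).smul hg) hc.smul_left (by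
      rintro p ⟨hp, hpf⟩
      by_contra hpr
      have hpO : p ∈ O := hSO ⟨hpf, hpr⟩
      refine (notMem_tsupport_iff_eventuallyEq.2 ?_) hp
      filter_upwards [hO.mem_nhds hpO] with y hy
      simp [hO0 y hy])
    have h2 : ∀ x, fderiv ℝ (η k • g) x v = η k x • fderiv ℝ g x v + fderiv ℝ (η k) x v • g x := by
      intro x
      rw [fderiv_smul ((hη1 k).differentiable one_ne_zero x) (hg.differentiable one_ne_zero x)]
      rfl
    simp only [h2] at h1
    rw [← integral_add, h1]
    · congr 1; funext q
      exact smul_comm _ _ _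
    · refine (hdi.norm.mono' (((hη1 k).continuous.smul hdc).aestronglyMeasurable)
        (Eventually.of_forall fun x => ?_)).integrableOn
      rw [Pi.smul_apply', norm_smul, Real.norm_of_nonneg (hη01 k x).1]
      exact mul_le_of_le_one_left (norm_nonneg _) (hη01 k x).2
    · refine Integrable.integrableOn (((hηi k).norm.mul_const M).mono'
        ((hηi k).aestronglyMeasurable.smul hg.continuous.aestronglyMeasurable)
        (Eventually.of_forall fun x => ?_))
      rw [norm_smul]
      exact mul_le_mul_of_nonneg_left (hM x) (norm_nonneg _)
  have t1 : Tendsto (fun k => ∫ x in U, η k x • fderiv ℝ g x v) atTop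
      (𝓝 (∫ x in U, fderiv ℝ g x v)) := by
    refine tendsto_integral_of_dominated_convergence (fun x => ‖fderiv ℝ g x v‖)
      (fun k => ((hη1 k).continuous.smul hdc).aestronglyMeasurable) hdi.norm.integrableOn
      (fun k => Eventually.of_forall fun x => ?_) ?_
    · rw [norm_smul, Real.norm_of_nonneg (hη01 k x).1]
      exact mul_le_of_le_one_left (norm_nonneg _) (hη01 k x).2
    · have h1 : ∀ᵐ x ∂(volume : Measure ℍ), x ∉ S := measure_eq_zero_iff_ae_notMem.1 hSv
      filter_upwards [ae_restrict_of_ae h1] with x hx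
      simpa using (hηlim x hx).smul_const (fderiv ℝ g x v)
  have t2 : Tendsto (fun k => ∫ x in U, fderiv ℝ (η k) x v • g x) atTop (𝓝 0) := by
    have h1 : ∀ k, ‖∫ x in U, fderiv ℝ (η k) x v • g x‖ ≤ (∫ x, ‖fderiv ℝ (η k) x v‖) * M := by
      intro k
      rw [← integral_mul_const]
      have hi := (hηi k).norm.mul_const M
      refine (norm_integral_le_of_norm_le hi.integrableOn (Eventually.of_forall fun x => ?_)).trans
        (setIntegral_le_integral hi (Eventually.of_forall fun x => ?_))
      · rw [norm_smul]
        exact mul_le_mul_of_nonneg_left (hM x) (norm_nonneg _)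
      · exact mul_nonneg (norm_nonneg _) ((norm_nonneg _).trans (hM x))
    refine squeeze_zero_norm h1 ?_
    simpa using hηint.mul_const M
  have t3 : Tendsto (fun k => ∫ q in frontier U, η k q • (inner ℝ (outwardNormal U q) v • g q)
      ∂μHE[3]) atTop (𝓝 (∫ q in frontier U, inner ℝ (outwardNormal U q) v • g q ∂μHE[3])) := by
    have hm : AEStronglyMeasurable (fun q => inner ℝ (outwardNormal U q) v • g q)
        ((μHE[3] : Measure ℍ).restrict (frontier U)) :=
      (hNm.inner aestronglyMeasurable_const).smul hgb.aestronglyMeasurable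
    refine tendsto_integral_of_dominated_convergence (fun q => ‖v‖ * ‖g q‖)
      (fun k => (hη1 k).continuous.aestronglyMeasurable.smul hm) (hgb.norm.const_mul _)
      (fun k => Eventually.of_forall fun x => ?_) ?_
    · rw [norm_smul, norm_smul, Real.norm_of_nonneg (hη01 k x).1]
      refine (mul_le_of_le_one_left (by positivity) (hη01 k x).2).trans ?_
      refine mul_le_mul_of_nonneg_right ((norm_inner_le_norm _ _).trans ?_) (norm_nonneg _)
      exact mul_le_of_le_one_left (norm_nonneg _) (norm_outwardNormal_le U x)
    · have h1 : ∀ᵐ x ∂(μHE[3] : Measure ℍ), x ∉ S := measure_eq_zero_iff_ae_notMem.1 hS0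
      filter_upwards [ae_restrict_of_ae h1] with x hx
      simpa using (hηlim x hx).smul_const (inner ℝ (outwardNormal U x) v • g x)
  simp only [← hk] at t3
  have t4 := t1.add t2
  rw [add_zero] at t4
  exact tendsto_nhds_unique t4 t3

/-- The divergence theorem for bounded open sets with piecewise `C¹` boundary. -/
theorem gaussGreen {U : Set ℍ} (hUo : IsOpen U) (hUb : Bornology.IsBounded U)
    (hU : HasPiecewiseC1Boundary U) {V : Set ℍ} (hV : IsOpen V) (hUV : closure U ⊆ V) (v : ℍ)
    {g : ℍ → E} (hg : ContDiffOn ℝ 1 g V) :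
    ∫ x in U, fderiv ℝ g x v =
      ∫ q in frontier U, inner ℝ (outwardNormal U q) v • g q ∂μHE[3] := by
  obtain ⟨R, hR⟩ := hUb.closure.subset_ball (0 : ℍ)
  obtain ⟨χ, hχ, hχ1, hχs, -⟩ := exists_contDiff_cutoff isClosed_closure
    (hV.inter (Metric.isOpen_ball (x := (0 : ℍ)) (ε := R))) (Set.subset_inter hUV hR)
  have hc : HasCompactSupport χ :=
    (isCompact_closedBall (0 : ℍ) R).of_isClosed_subset (isClosed_tsupport _)
      ((hχs.trans Set.inter_subset_right).trans Metric.ball_subset_closedBall)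
  have hχg : ContDiff ℝ 1 fun x => χ x • g x := by
    rw [contDiff_iff_contDiffAt]
    intro x
    by_cases hx : x ∈ tsupport χ
    · exact hχ.contDiffAt.smul (hg.contDiffAt (hV.mem_nhds (hχs hx).1))
    · refine contDiffAt_const (c := (0 : E)) |>.congr_of_eventuallyEq ?_
      filter_upwards [notMem_tsupport_iff_eventuallyEq.1 hx] with y hy
      simp [hy]
  have h1 := gaussGreen_of_hasCompactSupport hUo hUb hU v hχg hc.smul_right
  have h2 : ∀ x ∈ closure U, (fun x => χ x • g x) =ᶠ[𝓝 x] g := fun x hx => by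
    filter_upwards [(eventually_nhdsSet_iff_forall.1 hχ1) x hx] with y hy
    simp [hy]
  rw [setIntegral_congr_fun hUo.measurableSet fun x hx => by
    rw [(h2 x (subset_closure hx)).fderiv_eq]] at h1
  rw [h1]
  refine setIntegral_congr_fun isClosed_frontier.measurableSet fun x hx => ?_
  rw [(h2 x hx.1).eq_of_nhds]

end GaussGreen

/-! ### Algebraic identities for two commuting Clifford actions. -/

section Clifford

lemma coord_eq_inner (i : Fin 4) (p : ℍ) : coord i p = inner ℝ (e i) p := by
  fin_cases i <;> simp [coord, e, Quaternion.inner_def] <;> rfl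

lemma inner_e (i j : Fin 4) : inner ℝ (e i) (e j) = if i = j then (1 : ℝ) else 0 := by
  fin_cases i <;> fin_cases j <;> simp [e, Quaternion.inner_def, -inner_self_eq_norm_sq_to_K]

/-- Two commuting linear maps on the quaternions, each satisfying the Clifford relations. -/
structure CliffordPair {R : Type*} [Ring R] [Algebra ℝ R] (A B : ℍ →ₗ[ℝ] R) : Prop where
  comm : ∀ p q, A p * B q = B q * A p
  left : ∀ p q, A (star p) * A q + A (star q) * A p = (2 * inner ℝ p q : ℝ) • 1
  right : ∀ p q, B (star p) * B q + B (star q) * B p = (2 * inner ℝ p q : ℝ) • 1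

variable {R : Type*} [Ring R] [Algebra ℝ R]

/-- `∑ A(eᵢ) B(eᵢ)`. -/
def contraction (A B : ℍ →ₗ[ℝ] R) : R := ∑ i, A (e i) * B (e i)

/-- `∑ A(eᵢ) B(eᵢ⁺)`. -/
def contractionStar (A B : ℍ →ₗ[ℝ] R) : R := ∑ i, A (e i) * B (star (e i))

/-- `∑ A(eᵢ⁺) B(eᵢ⁺)`. -/
def contractionStarStar (A B : ℍ →ₗ[ℝ] R) : R := ∑ i, A (star (e i)) * B (star (e i))

/-- The kernel `2 A(X⁺) B(X⁺) / N(X)³ - (1 / 2) ∑ A(eᵢ⁺) B(eᵢ⁺) / N(X)²`. -/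
def kernel (A B : ℍ →ₗ[ℝ] R) (X : ℍ) : R :=
  (2 * (‖X‖ ^ 2)⁻¹ ^ 3) • (A (star X) * B (star X)) -
    (1 / 2 * (‖X‖ ^ 2)⁻¹ ^ 2) • contractionStarStar A B

/-- The partial derivatives of the kernel. -/
def kernelDeriv (A B : ℍ →ₗ[ℝ] R) (X : ℍ) (i : Fin 4) : R :=
  (2 * (‖X‖ ^ 2)⁻¹ ^ 3) • (A (star (e i)) * B (star X) + A (star X) * B (star (e i))) -
    (12 * coord i X * (‖X‖ ^ 2)⁻¹ ^ 4) • (A (star X) * B (star X)) +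
    (2 * coord i X * (‖X‖ ^ 2)⁻¹ ^ 3) • contractionStarStar A B

/-- `B(X⁺) + (1 / 2) A(X⁺) ∑ A(eᵢ) B(eᵢ⁺)`. -/
def radialSymbol (A B : ℍ →ₗ[ℝ] R) (X : ℍ) : R :=
  B (star X) + (1 / 2 : ℝ) • (A (star X) * contractionStar A B)

lemma sum_coord_smul_map (L : ℍ →ₗ[ℝ] R) (X : ℍ) : ∑ i, coord i X • L (e i) = L X := by
  conv_rhs => rw [← sum_coord_smul_e X]
  simp [map_sum]

lemma sum_coord_smul_map_star (L : ℍ →ₗ[ℝ] R) (X : ℍ) :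
    ∑ i, coord i X • L (star (e i)) = L (star X) := by
  conv_rhs => rw [← sum_coord_smul_e X]
  simp [map_sum, star_sum]

namespace CliffordPair

variable {A B : ℍ →ₗ[ℝ] R}

lemma swap (h : CliffordPair A B) : CliffordPair B A :=
  ⟨fun p q => (h.comm q p).symm, h.right, h.left⟩

lemma star_mul_self (h : CliffordPair A B) (X : ℍ) :
    A (star X) * A X = (‖X‖ ^ 2) • (1 : R) := by
  have h1 := h.left X X
  rw [← two_smul ℝ, real_inner_self_eq_norm_sq, mul_smul] at h1
  exact smul_right_injective R (two_ne_zero (α := ℝ)) h1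

lemma star_mul (h : CliffordPair A B) (p q : ℍ) :
    A (star p) * A q = (2 * inner ℝ p q : ℝ) • 1 - A (star q) * A p :=
  eq_sub_of_add_eq (h.left p q)

lemma norm_e (i : Fin 4) : ‖e i‖ ^ 2 = 1 := by
  rw [← real_inner_self_eq_norm_sq, inner_e, if_pos rfl]

/-- The Clifford relation moves A(X) to the left past each A(eᵢ⁺); the scalars 2⟨eᵢ, X⟩ reassemble
B(X⁺). -/
lemma contractionStarStar_mul (h : CliffordPair A B) (X : ℍ) :
    contractionStarStar A B * A X = (2 : ℝ) • B (star X) - A (star X) * contractionStar A B := by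
  have h1 : ∀ i, A (star (e i)) * B (star (e i)) * A X =
      (2 : ℝ) • coord i X • B (star (e i)) - A (star X) * (A (e i) * B (star (e i))) := by
    intro i
    rw [mul_assoc, ← h.comm X, ← mul_assoc, h.star_mul, sub_mul, ← coord_eq_inner, smul_mul_assoc,
      one_mul, mul_smul, mul_assoc]
  rw [contractionStarStar, Finset.sum_mul]
  simp only [h1]
  rw [Finset.sum_sub_distrib, ← Finset.smul_sum, sum_coord_smul_map_star, contractionStar,
    Finset.mul_sum]

lemma contractionStar_mul (h : CliffordPair A B) (X : ℍ) :
    contractionStar A B * B X = (2 : ℝ) • A X - B (star X) * contraction A B := by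
  have h1 : ∀ i, A (e i) * B (star (e i)) * B X =
      (2 : ℝ) • coord i X • A (e i) - B (star X) * (A (e i) * B (e i)) := by
    intro i
    rw [mul_assoc, h.swap.star_mul, mul_sub, ← coord_eq_inner, mul_smul_comm, mul_one, mul_smul,
      ← mul_assoc, h.comm, mul_assoc]
  rw [contractionStar, Finset.sum_mul]
  simp only [h1]
  rw [Finset.sum_sub_distrib, ← Finset.smul_sum, sum_coord_smul_map, contraction, Finset.mul_sum]

/-- In the radial direction A(X⁺)A(X) = N(X) cancels one power of the singularity. The two terms of
the kernel contribute 2 and −1 times N(X)⁻² B(X⁺). -/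
lemma kernel_mul (h : CliffordPair A B) {X : ℍ} (hX : X ≠ 0) :
    kernel A B X * A X = (‖X‖ ^ 2)⁻¹ ^ 2 • radialSymbol A B X := by
  have hN : ‖X‖ ^ 2 ≠ 0 := by simpa using hX
  have h1 : A (star X) * B (star X) * A X = (‖X‖ ^ 2) • B (star X) := by
    rw [mul_assoc, ← h.comm, ← mul_assoc, h.star_mul_self, smul_mul_assoc, one_mul]
  rw [kernel, sub_mul, smul_mul_assoc, smul_mul_assoc, h1, h.contractionStarStar_mul,
    radialSymbol, smul_smul]
  have h2 : 2 * (‖X‖ ^ 2)⁻¹ ^ 3 * ‖X‖ ^ 2 = 2 * (‖X‖ ^ 2)⁻¹ ^ 2 := by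
    rw [pow_succ _ 2, mul_assoc, mul_assoc, inv_mul_cancel₀ hN, mul_one]
  rw [h2]
  module

/-- This is the regularity of the kernel itself. With ν = 1/N(X), the coefficients of B(X⁺) are 8ν³
− 12ν³ + 4ν³ = 0, the 8 coming from 2 times dimension 4, and those of A(X⁺)ΣA(eᵢ)B(eᵢ⁺) are 2ν³ −
2ν³ = 0. -/
lemma sum_kernelDeriv_mul (h : CliffordPair A B) {X : ℍ} (hX : X ≠ 0) :
    ∑ i, kernelDeriv A B X i * A (e i) = 0 := by
  have hN : ‖X‖ ^ 2 ≠ 0 := by simpa using hX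
  set ν := (‖X‖ ^ 2)⁻¹ with hν
  have h1 : ∀ i, kernelDeriv A B X i * A (e i) =
      (2 * ν ^ 3) • (B (star X) + A (star X) * (A (e i) * B (star (e i)))) -
      (12 * ν ^ 4) • (A (star X) * B (star X)) * (coord i X • A (e i)) +
      (2 * ν ^ 3) • contractionStarStar A B * (coord i X • A (e i)) := by
    intro i
    have e1 : A (star (e i)) * B (star X) * A (e i) = B (star X) := by
      rw [mul_assoc, ← h.comm, ← mul_assoc, h.star_mul_self, norm_e, one_smul, one_mul]
    have e2 : A (star X) * B (star (e i)) * A (e i) = A (star X) * (A (e i) * B (star (e i))) := by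
      rw [mul_assoc, ← h.comm]
    rw [kernelDeriv, ← hν, add_mul, sub_mul, smul_mul_assoc, add_mul, e1, e2]
    simp only [smul_mul_assoc, mul_smul_comm, smul_smul]
    module
  have h2 : A (star X) * B (star X) * A X = (‖X‖ ^ 2) • B (star X) := by
    rw [mul_assoc, ← h.comm, ← mul_assoc, h.star_mul_self, smul_mul_assoc, one_mul]
  simp only [h1]
  rw [Finset.sum_add_distrib, Finset.sum_sub_distrib, ← Finset.smul_sum, ← Finset.mul_sum,
    ← Finset.mul_sum, sum_coord_smul_map, smul_mul_assoc, h2, smul_mul_assoc,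
    h.contractionStarStar_mul, Finset.sum_add_distrib, ← Finset.mul_sum, ← contractionStar,
    Finset.sum_const, Finset.card_univ, Fintype.card_fin, smul_smul]
  have h3 : 12 * ν ^ 4 * ‖X‖ ^ 2 = 12 * ν ^ 3 := by
    rw [pow_succ _ 3, mul_assoc, mul_assoc, hν, inv_mul_cancel₀ hN, mul_one]
  rw [h3]
  module

/-- Arranged so that, applied to ∂ᵢf and summed over i, every term but the scalar one dies: B(eᵢ)
and A(eᵢ) meet the regularity equations, and the contraction annihilates symmetric values. -/
lemma radialSymbol_mul (h : CliffordPair A B) (i : Fin 4) (W : ℍ) :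
    radialSymbol A B (e i) * B W = (4 * coord i W) • 1 - B (star W) * B (e i) -
      A (star W) * A (e i) - (1 / 2 : ℝ) • (A (star (e i)) * B (star W) * contraction A B) := by
  rw [radialSymbol, add_mul, smul_mul_assoc, mul_assoc, h.contractionStar_mul, mul_sub,
    mul_smul_comm, h.star_mul, h.swap.star_mul, ← coord_eq_inner, mul_assoc]
  module

end CliffordPair

end Clifford

/-! ### The divergence-free field and its flux. -/

section Field

variable {E : Type*} [NormedAddCommGroup E] [NormedSpace ℝ E]
variable {A B : ℍ →ₗ[ℝ] (E →L[ℝ] E)}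

/-- The components of the vector field whose flux is the Cauchy-Fueter integral. -/
def fluxField (A B : ℍ →ₗ[ℝ] (E →L[ℝ] E)) (f : ℍ → E) (W : ℍ) (i : Fin 4) (Z : ℍ) : E :=
  (kernel A B (Z - W) * A (e i) * B Z) (f Z)

/-- The abstract form of double regularity. -/
structure IsRegularFor (A B : ℍ →ₗ[ℝ] (E →L[ℝ] E)) (f : ℍ → E) (V : Set ℍ) : Prop where
  contDiffOn : ContDiffOn ℝ 1 f V
  contraction : ∀ Z ∈ V, contraction A B (f Z) = 0
  left : ∀ Z ∈ V, ∑ i, A (e i) (pd i f Z) = 0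
  right : ∀ Z ∈ V, ∑ i, B (e i) (pd i f Z) = 0

/-- Precomposition of a linear map on the quaternions with conjugation. -/
def compStar {R : Type*} [AddCommGroup R] [Module ℝ R] (L : ℍ →ₗ[ℝ] R) : ℍ →ₗ[ℝ] R where
  toFun X := L (star X)
  map_add' X Y := by rw [star_add, map_add]
  map_smul' r X := by simp

lemma hasDerivAt_line (X v : ℍ) : HasDerivAt (fun t : ℝ => X + t • v) v 0 := by
  simpa using ((hasDerivAt_id (0 : ℝ)).smul_const v).const_add X

section LinearMap

variable {R : Type*} [NormedAddCommGroup R] [NormedSpace ℝ R] (L : ℍ →ₗ[ℝ] R)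

lemma contDiff_linearMap {n : WithTop ℕ∞} : ContDiff ℝ n fun X => L X :=
  (LinearMap.toContinuousLinearMap L).contDiff

lemma hasDerivAt_linearMap_line (X v : ℍ) : HasDerivAt (fun t : ℝ => L (X + t • v)) (L v) 0 := by
  simp only [map_add, map_smul]
  simpa using ((hasDerivAt_id (0 : ℝ)).smul_const (L v)).const_add (L X)

end LinearMap

lemma contDiffAt_kernel {n : WithTop ℕ∞} {X : ℍ} (hX : X ≠ 0) :
    ContDiffAt ℝ n (kernel A B) X := by
  have h1 : ContDiffAt ℝ n (fun X : ℍ => (‖X‖ ^ 2)⁻¹) X :=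
    (contDiff_norm_sq ℝ).contDiffAt.inv (by simpa using hX)
  have h2 := (contDiff_linearMap (compStar A)).contDiffAt (x := X) (n := n)
  have h3 := (contDiff_linearMap (compStar B)).contDiffAt (x := X) (n := n)
  exact ((contDiffAt_const.mul (h1.pow 3)).smul (h2.mul h3)).sub
    ((contDiffAt_const.mul (h1.pow 2)).smul contDiffAt_const)

lemma hasDerivAt_kernel_line {X : ℍ} (hX : X ≠ 0) (i : Fin 4) :
    HasDerivAt (fun t : ℝ => kernel A B (X + t • e i)) (kernelDeriv A B X i) 0 := by
  have hN : ‖X‖ ^ 2 ≠ 0 := by simpa using hX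
  have h0 : X + (0 : ℝ) • e i = X := by simp
  have h1 : HasDerivAt (fun t : ℝ => ‖X + t • e i‖ ^ 2) (2 * coord i X) 0 := by
    have := (hasDerivAt_line X (e i)).norm_sq
    rw [h0, real_inner_comm, ← coord_eq_inner] at this
    exact this
  have h2 := h1.fun_inv (by rw [h0]; exact hN)
  have h3 := hasDerivAt_linearMap_line (compStar A) X (e i)
  have h4 := hasDerivAt_linearMap_line (compStar B) X (e i)
  have h5 := (((h2.fun_pow 3).const_mul 2).fun_smul (h3.fun_mul h4)).fun_sub
    (((h2.fun_pow 2).const_mul (1 / 2)).smul_const (contractionStarStar A B))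
  refine h5.congr_deriv ?_
  simp only [h0, compStar, LinearMap.coe_mk, AddHom.coe_mk, kernelDeriv]
  have h6 : -(2 * coord i X) / (‖X‖ ^ 2) ^ 2 = -(2 * coord i X) * (‖X‖ ^ 2)⁻¹ ^ 2 := by
    rw [div_eq_mul_inv, inv_pow]
  rw [h6]
  push_cast
  module

lemma contDiffAt_fluxField {n : WithTop ℕ∞} {f : ℍ → E} {W Z : ℍ} (hf : ContDiffAt ℝ n f Z)
    (hZ : Z ≠ W) (i : Fin 4) : ContDiffAt ℝ n (fluxField A B f W i) Z := by
  have h1 : ContDiffAt ℝ n (fun Z => kernel A B (Z - W)) Z :=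
    (contDiffAt_kernel (sub_ne_zero.2 hZ)).comp Z (contDiffAt_id.sub contDiffAt_const)
  exact ((h1.mul contDiffAt_const).mul (contDiff_linearMap B).contDiffAt).clm_apply hf

/-- Separates existence of the derivative, supplied by smoothness, from its value, computed in one
real variable. -/
lemma fderiv_apply_eq_of_line {F : ℍ → E} {Z v : ℍ} {F' : E} (hF : DifferentiableAt ℝ F Z)
    (h : HasDerivAt (fun t : ℝ => F (Z + t • v)) F' 0) : fderiv ℝ F Z v = F' := by
  have h1 : HasFDerivAt F (fderiv ℝ F Z) (Z + (0 : ℝ) • v) := by simpa using hF.hasFDerivAt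
  exact (h1.comp_hasDerivAt (0 : ℝ) (hasDerivAt_line Z v)).unique h

lemma hasDerivAt_of_differentiableAt_line {F : ℍ → E} {Z : ℍ} (hF : DifferentiableAt ℝ F Z)
    (v : ℍ) : HasDerivAt (fun t : ℝ => F (Z + t • v)) (fderiv ℝ F Z v) 0 := by
  have h1 : HasFDerivAt F (fderiv ℝ F Z) (Z + (0 : ℝ) • v) := by simpa using hF.hasFDerivAt
  exact h1.comp_hasDerivAt (0 : ℝ) (hasDerivAt_line Z v)

lemma pd_fluxField {f : ℍ → E} {W Z : ℍ} (hf : ContDiffAt ℝ 1 f Z) (hZ : Z ≠ W) (i : Fin 4) :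
    fderiv ℝ (fluxField A B f W i) Z (e i) =
      (kernelDeriv A B (Z - W) i * A (e i) * B Z) (f Z) +
      (kernel A B (Z - W) * (A (e i) * B (e i))) (f Z) +
      (kernel A B (Z - W) * (A (e i) * B Z)) (pd i f Z) := by
  refine fderiv_apply_eq_of_line ((contDiffAt_fluxField hf hZ i).differentiableAt one_ne_zero) ?_
  have h1 : HasDerivAt (fun t : ℝ => kernel A B (Z + t • e i - W)) (kernelDeriv A B (Z - W) i) 0 := by
    have := hasDerivAt_kernel_line (A := A) (B := B) (sub_ne_zero.2 hZ) i
    simpa only [add_sub_right_comm] using this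
  have h2 := hasDerivAt_linearMap_line B Z (e i)
  have h3 := hasDerivAt_of_differentiableAt_line (hf.differentiableAt one_ne_zero) (e i)
  have h4 := ((h1.fun_mul (hasDerivAt_const (0 : ℝ) (A (e i)))).fun_mul h2).clm_apply h3
  refine h4.congr_deriv ?_
  have h0 : Z + (0 : ℝ) • e i = Z := by simp
  simp only [h0, mul_zero, add_zero, pd, mul_assoc, _root_.add_apply]

/-- The product rule gives three sums, vanishing respectively by regularity of the kernel, by
symmetry of the values of f, and by the equation ΣA(eᵢ)∂ᵢf = 0 after commuting B(Z) to the left. -/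
lemma CliffordPair.sum_pd_fluxField (h : CliffordPair A B) {f : ℍ → E} {V : Set ℍ}
    (hV : IsOpen V) (hf : IsRegularFor A B f V) {W Z : ℍ} (hZV : Z ∈ V) (hZ : Z ≠ W) :
    ∑ i, fderiv ℝ (fluxField A B f W i) Z (e i) = 0 := by
  have hfZ : ContDiffAt ℝ 1 f Z := hf.contDiffOn.contDiffAt (hV.mem_nhds hZV)
  simp only [pd_fluxField hfZ hZ]
  rw [Finset.sum_add_distrib, Finset.sum_add_distrib]
  have e1 : ∑ i, (kernelDeriv A B (Z - W) i * A (e i) * B Z) (f Z) = 0 := by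
    have := h.sum_kernelDeriv_mul (sub_ne_zero.2 hZ)
    have h2 := congrArg (fun T => (T * B Z) (f Z)) this
    simpa [Finset.sum_mul, _root_.sum_apply] using h2
  have e2 : ∑ i, (kernel A B (Z - W) * (A (e i) * B (e i))) (f Z) = 0 := by
    have := congrArg (⇑(kernel A B (Z - W) : E →L[ℝ] E)) (hf.contraction Z hZV)
    simpa [DoublyRegular.contraction, _root_.sum_apply, map_sum] using this
  have e3 : ∑ i, (kernel A B (Z - W) * (A (e i) * B Z)) (pd i f Z) = 0 := by
    have := congrArg (⇑(kernel A B (Z - W) * B Z : E →L[ℝ] E)) (hf.left Z hZV)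
    simp only [h.comm]
    simpa [map_sum] using this
  rw [e1, e2, e3, add_zero, add_zero]

lemma kernel_mul_eq_sum (f : ℍ → E) (W Z n : ℍ) :
    (kernel A B (Z - W) * A n * B Z) (f Z) = ∑ i, coord i n • fluxField A B f W i Z := by
  rw [← sum_coord_smul_map A n]
  simp only [fluxField, Finset.mul_sum, Finset.sum_mul, _root_.sum_apply,
    mul_smul_comm, smul_mul_assoc, _root_.smul_apply]

variable {U : Set ℍ}

omit [NormedSpace ℝ E] in
lemma HasPiecewiseC1Boundary.integrableOn_of_continuousOn (hUb : Bornology.IsBounded U)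
    (hU : HasPiecewiseC1Boundary U) {F : ℍ → E} (hF : ContinuousOn F (frontier U)) :
    IntegrableOn F (frontier U) μHE[3] := by
  have hK : IsCompact (frontier U) := Metric.isCompact_of_isClosed_isBounded isClosed_frontier
    (hUb.closure.subset frontier_subset_closure)
  obtain ⟨M, hM⟩ := hK.exists_bound_of_continuousOn hF
  have : IsFiniteMeasure ((μHE[3] : Measure ℍ).restrict (frontier U)) :=
    ⟨by rw [Measure.restrict_apply_univ]; exact hU.finite_area⟩
  refine Integrable.of_bound (hF.aestronglyMeasurable isClosed_frontier.measurableSet) M ?_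
  exact (ae_restrict_iff' isClosed_frontier.measurableSet).2 (Eventually.of_forall hM)

lemma norm_e (i : Fin 4) : ‖e i‖ = 1 :=
  (pow_eq_one_iff_of_nonneg (norm_nonneg _) two_ne_zero).1 (CliffordPair.norm_e i)

lemma HasPiecewiseC1Boundary.integrableOn_coord_smul (hUo : IsOpen U)
    (hUb : Bornology.IsBounded U) (hU : HasPiecewiseC1Boundary U) {F : ℍ → E}
    (hF : ContinuousOn F (frontier U)) (i : Fin 4) :
    IntegrableOn (fun q => coord i (outwardNormal U q) • F q) (frontier U) μHE[3] := by
  have hFi := hU.integrableOn_of_continuousOn hUb hF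
  have hm := (hU.aestronglyMeasurable_outwardNormal hUo)
  simp only [coord_eq_inner]
  refine hFi.norm.mono' ((aestronglyMeasurable_const.inner hm).smul hFi.aestronglyMeasurable)
    (Eventually.of_forall fun q => ?_)
  rw [norm_smul]
  refine mul_le_of_le_one_left (norm_nonneg _) ((norm_inner_le_norm _ _).trans ?_)
  rw [norm_e, one_mul]
  exact norm_outwardNormal_le U q

/-- The flux through the boundary, written as a volume integral by means of a cutoff function. -/
lemma CliffordPair.boundary_integral_eq [CompleteSpace E] (h : CliffordPair A B) (hUo : IsOpen U)
    (hUb : Bornology.IsBounded U) (hU : HasPiecewiseC1Boundary U) {V : Set ℍ} (hV : IsOpen V)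
    (hUV : closure U ⊆ V) {f : ℍ → E} (hf : IsRegularFor A B f V) {W : ℍ} {χ : ℍ → ℝ}
    (hχ : ContDiff ℝ 1 χ) (hχ1 : ∀ q ∈ frontier U, χ q = 1)
    (hχW : W ∈ closure U → ∀ᶠ Z in 𝓝 W, χ Z = 0) :
    IntegrableOn (fun q => (kernel A B (q - W) * A (outwardNormal U q) * B q) (f q))
      (frontier U) μHE[3] ∧
    ∫ q in frontier U, (kernel A B (q - W) * A (outwardNormal U q) * B q) (f q) ∂μHE[3] =
      ∫ x in U, ∑ i, pd i χ x • fluxField A B f W i x := by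
  set F := fluxField A B f W with hFdef
  -- On this open set χF is C¹: a point either avoids the pole W or has a neighbourhood on which χ
  -- is zero.
  set V' : Set ℍ := {Z | Z ∈ V ∧ (Z ≠ W ∨ ∀ᶠ Y in 𝓝 Z, χ Y = 0)} with hV'
  have hV'o : IsOpen V' := by
    have h1 : IsOpen {Z : ℍ | Z ≠ W} := isOpen_ne
    have h2 : IsOpen {Z : ℍ | ∀ᶠ Y in 𝓝 Z, χ Y = 0} := isOpen_setOfPred_eventually_nhds
    exact hV.inter (h1.union h2)
  have hUV' : closure U ⊆ V' := by
    intro Z hZ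
    refine ⟨hUV hZ, ?_⟩
    by_cases hZW : Z = W
    · right; rw [hZW]; exact hχW (hZW ▸ hZ)
    · left; exact hZW
  -- W on the boundary is excluded by the hypotheses on χ, which would have to be both 1 and 0
  -- there.
  have hfr : ∀ q ∈ frontier U, q ≠ W := by
    rintro q hq rfl
    have h1 := (hχW (frontier_subset_closure hq)).self_of_nhds
    rw [hχ1 q hq] at h1
    exact one_ne_zero h1
  have hfat : ∀ Z ∈ V, ContDiffAt ℝ 1 f Z := fun Z hZ => hf.contDiffOn.contDiffAt (hV.mem_nhds hZ)
  let G : Fin 4 → ℍ → E := fun i Z => χ Z • F i Z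
  have hG : ∀ i, ContDiffOn ℝ 1 (G i) V' := by
    rintro i Z ⟨hZV, hZ⟩
    refine ContDiffAt.contDiffWithinAt ?_
    rcases hZ with hZ | hZ
    · exact hχ.contDiffAt.smul (contDiffAt_fluxField (hfat Z hZV) hZ i)
    · refine (contDiffAt_const (c := (0 : E))).congr_of_eventuallyEq ?_
      filter_upwards [hZ] with Y hY
      simp [G, hY]
  have hGG : ∀ i, ∫ x in U, fderiv ℝ (G i) x (e i) =
      ∫ q in frontier U, coord i (outwardNormal U q) • F i q ∂μHE[3] := by
    intro i
    rw [gaussGreen hUo hUb hU hV'o hUV' (e i) (hG i)]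
    refine setIntegral_congr_fun isClosed_frontier.measurableSet fun q hq => ?_
    change inner ℝ (outwardNormal U q) (e i) • (χ q • F i q) = _
    rw [hχ1 q hq, one_smul, coord_eq_inner, real_inner_comm]
  have hint : ∀ i, IntegrableOn (fun x => fderiv ℝ (G i) x (e i)) U := by
    intro i
    have h1 : ContinuousOn (fun x => fderiv ℝ (G i) x (e i)) (closure U) :=
      (((hG i).continuousOn_fderiv_of_isOpen hV'o le_rfl).clm_apply continuousOn_const).mono hUV'
    exact (h1.integrableOn_compact (Metric.isCompact_of_isClosed_isBounded isClosed_closure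
      hUb.closure)).mono_set subset_closure
  have hFi : ∀ i, IntegrableOn (fun q => coord i (outwardNormal U q) • F i q) (frontier U) μHE[3] :=
    fun i => hU.integrableOn_coord_smul hUo hUb (fun q hq =>
      (contDiffAt_fluxField (hfat q (hUV (frontier_subset_closure hq))) (hfr q hq)
        i).continuousAt.continuousWithinAt) i
  simp only [kernel_mul_eq_sum]
  refine ⟨integrable_finsetSum _ fun i _ => hFi i, ?_⟩
  rw [integral_finsetSum _ fun i _ => hFi i]
  simp only [← hGG]
  rw [← integral_finsetSum _ fun i _ => hint i]
  refine setIntegral_congr_fun hUo.measurableSet fun x hx => ?_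
  obtain ⟨hxV, hxW⟩ := hUV' (subset_closure hx)
  rcases hxW with hxW | hxW
  · have hd : ∀ i, fderiv ℝ (G i) x (e i) =
        χ x • fderiv ℝ (F i) x (e i) + pd i χ x • F i x := by
      intro i
      rw [fderiv_fun_smul (hχ.differentiable one_ne_zero x)
        ((contDiffAt_fluxField (hfat x hxV) hxW i).differentiableAt one_ne_zero)]
      rfl
    simp only [hd]
    rw [Finset.sum_add_distrib, ← Finset.smul_sum, h.sum_pd_fluxField hV hf hxV hxW, smul_zero,
      zero_add]
  · have h1 : χ =ᶠ[𝓝 x] fun _ => 0 := hxW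
    have h2 : ∀ i, G i =ᶠ[𝓝 x] fun _ => 0 := fun i => by
      filter_upwards [hxW] with Y hY
      simp [G, hY]
    refine Finset.sum_congr rfl fun i _ => ?_
    rw [(h2 i).fderiv_eq, pd, h1.fderiv_eq, fderiv_const_apply, fderiv_const_apply]
    simp

end Field

/-! ### Moments of radial weights, by symmetry. -/

section Radial

variable {H : Type*} [NormedAddCommGroup H] [InnerProductSpace ℝ H] [FiniteDimensional ℝ H]
  [MeasurableSpace H] [BorelSpace H]

lemma integral_comp_linearIsometryEquiv {E : Type*} [NormedAddCommGroup E] [NormedSpace ℝ E]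
    (T : H ≃ₗᵢ[ℝ] H) (F : H → E) : ∫ Y, F (T Y) = ∫ Y, F Y :=
  T.measurePreserving.integral_comp T.toHomeomorph.measurableEmbedding F

omit [FiniteDimensional ℝ H] [MeasurableSpace H] [BorelSpace H] in
lemma inner_reflection (a b Y : H) :
    inner ℝ b ((ℝ ∙ a)ᗮ.reflection Y) = inner ℝ ((ℝ ∙ a)ᗮ.reflection b) Y := by
  rw [← (ℝ ∙ a)ᗮ.reflection.inner_map_map ((ℝ ∙ a)ᗮ.reflection b) Y,
    Submodule.reflection_reflection]

/-- The reflection in the hyperplane orthogonal to `a` sends `a` to `-a` and fixes `b`, so the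
integral equals its negative. Invariance holds for any integrand, so integrability plays no role. -/
lemma integral_radial_mul_inner_mul_inner (φ : ℝ → ℝ) {a b : H} (hab : inner ℝ a b = 0) :
    ∫ Y : H, φ ‖Y‖ * (inner ℝ a Y * inner ℝ b Y) = 0 := by
  have h := integral_comp_linearIsometryEquiv (ℝ ∙ a)ᗮ.reflection
    fun Y : H => φ ‖Y‖ * (inner ℝ a Y * inner ℝ b Y)
  have h1 : (ℝ ∙ a)ᗮ.reflection b = b := by
    refine Submodule.reflection_mem_subspace_eq_self ?_
    rwa [Submodule.mem_orthogonal_singleton_iff_inner_right]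
  have h2 : (ℝ ∙ a)ᗮ.reflection a = -a :=
    Submodule.reflection_orthogonalComplement_singleton_eq_neg a
  simp only [inner_reflection, h1, h2, LinearIsometryEquiv.norm_map, inner_neg_left, neg_mul,
    mul_neg, integral_neg] at h
  linarith

/-- The reflection along `a - b` carries `a` to `b` when their norms agree. -/
lemma integral_radial_mul_inner_mul_self (φ : ℝ → ℝ) {a b : H} (hab : ‖a‖ = ‖b‖) :
    ∫ Y : H, φ ‖Y‖ * (inner ℝ a Y * inner ℝ a Y) = ∫ Y : H, φ ‖Y‖ * (inner ℝ b Y * inner ℝ b Y) := by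
  have h := integral_comp_linearIsometryEquiv (ℝ ∙ (a - b))ᗮ.reflection
    fun Y : H => φ ‖Y‖ * (inner ℝ a Y * inner ℝ a Y)
  have h1 : (ℝ ∙ (a - b))ᗮ.reflection a = b := Submodule.reflection_sub hab
  simp only [inner_reflection, h1, LinearIsometryEquiv.norm_map] at h
  exact h.symm

lemma integral_radial_smul_linear {E : Type*} [NormedAddCommGroup E] [NormedSpace ℝ E]
    (φ : ℝ → ℝ) (L : H →ₗ[ℝ] E) : ∫ Y : H, φ ‖Y‖ • L Y = 0 := by
  have h := integral_comp_linearIsometryEquiv (LinearIsometryEquiv.neg ℝ)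
    fun Y : H => φ ‖Y‖ • L Y
  simp only [LinearIsometryEquiv.coe_neg, norm_neg, map_neg, smul_neg, integral_neg] at h
  have h2 : (2 : ℝ) • ∫ Y : H, φ ‖Y‖ • L Y = 0 := by
    rw [two_smul]
    nth_rewrite 1 [← h]
    exact neg_add_cancel _
  exact (smul_eq_zero.1 h2).resolve_left two_ne_zero

end Radial

lemma sum_coord_sq (Y : ℍ) : ∑ i, coord i Y * coord i Y = ‖Y‖ ^ 2 := by
  have h := congrArg (inner ℝ Y) (sum_coord_smul_e Y)
  rw [inner_sum, real_inner_self_eq_norm_sq] at h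
  rw [← h]
  refine Finset.sum_congr rfl fun i _ => ?_
  rw [inner_smul_right, real_inner_comm, ← coord_eq_inner]

lemma continuous_coord (i : Fin 4) : Continuous fun Y : ℍ => coord i Y :=
  (LinearMap.toContinuousLinearMap (coord i)).continuous

/-- The four diagonal moments agree and add up to the moment of ‖Y‖², whence the factor 1/4. -/
lemma integral_radial_mul_coord_mul_coord {φ : ℝ → ℝ} (hφ : Continuous fun Y : ℍ => φ ‖Y‖)
    (hφ' : HasCompactSupport fun Y : ℍ => φ ‖Y‖) (i j : Fin 4) :
    ∫ Y : ℍ, φ ‖Y‖ * (coord i Y * coord j Y) =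
      if i = j then (1 / 4) * ∫ Y : ℍ, φ ‖Y‖ * ‖Y‖ ^ 2 else 0 := by
  split_ifs with hij
  · subst hij
    have h1 : ∀ j, ∫ Y : ℍ, φ ‖Y‖ * (coord j Y * coord j Y) =
        ∫ Y : ℍ, φ ‖Y‖ * (coord i Y * coord i Y) := fun j => by
      simp only [coord_eq_inner]
      exact integral_radial_mul_inner_mul_self φ (by rw [norm_e, norm_e])
    have h2 : ∫ Y : ℍ, φ ‖Y‖ * ‖Y‖ ^ 2 = ∑ j, ∫ Y : ℍ, φ ‖Y‖ * (coord j Y * coord j Y) := by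
      rw [← integral_finsetSum]
      · simp only [← sum_coord_sq, Finset.mul_sum]
      · intro j _
        exact (hφ.mul ((continuous_coord j).mul (continuous_coord j))).integrable_of_hasCompactSupport
          hφ'.mul_right
    rw [h2]
    simp only [h1, Finset.sum_const, Finset.card_univ, Fintype.card_fin, nsmul_eq_mul]
    push_cast
    ring
  · simp only [coord_eq_inner]
    exact integral_radial_mul_inner_mul_inner φ (by rw [inner_e, if_neg hij])

lemma integral_radial_smul_bilinear {E : Type*} [NormedAddCommGroup E] [NormedSpace ℝ E]
    {φ : ℝ → ℝ} (hφ : Continuous fun Y : ℍ => φ ‖Y‖)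
    (hφ' : HasCompactSupport fun Y : ℍ => φ ‖Y‖) (Q : ℍ →ₗ[ℝ] ℍ →ₗ[ℝ] E) [CompleteSpace E] :
    ∫ Y : ℍ, φ ‖Y‖ • Q Y Y = ((1 / 4) * ∫ Y : ℍ, φ ‖Y‖ * ‖Y‖ ^ 2) • ∑ i, Q (e i) (e i) := by
  have h1 : ∀ Y : ℍ, φ ‖Y‖ • Q Y Y =
      ∑ i, ∑ j, (φ ‖Y‖ * (coord i Y * coord j Y)) • Q (e i) (e j) := by
    intro Y
    have h2 : Q Y Y = ∑ i, ∑ j, (coord i Y * coord j Y) • Q (e i) (e j) := by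
      conv_lhs => rw [← sum_coord_smul_e Y]
      simp only [map_sum, map_smul, LinearMap.sum_apply, LinearMap.smul_apply, Finset.smul_sum,
        smul_smul]
      rw [Finset.sum_comm]
      simp only [mul_comm]
    simp only [h2, Finset.smul_sum, smul_smul]
  have hint : ∀ i j, Integrable fun Y : ℍ => (φ ‖Y‖ * (coord i Y * coord j Y)) • Q (e i) (e j) :=
    fun i j => ((hφ.mul ((continuous_coord i).mul
      (continuous_coord j))).integrable_of_hasCompactSupport hφ'.mul_right).smul_const _
  simp only [h1]
  rw [integral_finsetSum _ fun i _ => integrable_finsetSum _ fun j _ => hint i j, Finset.smul_sum]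
  refine Finset.sum_congr rfl fun i _ => ?_
  rw [integral_finsetSum _ fun j _ => hint i j]
  simp only [integral_smul_const, integral_radial_mul_coord_mul_coord hφ hφ', ite_smul, zero_smul,
    Finset.sum_ite_eq, Finset.mem_univ, if_true]

/-! ### The radial cutoff and the constant 2π². -/

/-- A smooth transition from `0` to `1`. -/
def step (s : ℝ) : ℝ := Real.smoothTransition (2 * s - 1)

lemma contDiff_step : ContDiff ℝ 2 step :=
  Real.smoothTransition.contDiff.comp ((contDiff_const.mul contDiff_id).sub contDiff_const)

lemma step_of_le {s : ℝ} (hs : s ≤ 1 / 2) : step s = 0 :=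
  Real.smoothTransition.zero_of_nonpos (by linarith)

lemma step_of_ge {s : ℝ} (hs : 1 ≤ s) : step s = 1 :=
  Real.smoothTransition.one_of_one_le (by linarith)

lemma deriv_step_of_lt {s : ℝ} (hs : s < 1 / 2) : deriv step s = 0 := by
  have h : step =ᶠ[𝓝 s] fun _ => 0 := by
    filter_upwards [gt_mem_nhds hs] with t ht using step_of_le ht.le
  rw [h.deriv_eq, deriv_const]

lemma deriv_step_of_gt {s : ℝ} (hs : 1 < s) : deriv step s = 0 := by
  have h : step =ᶠ[𝓝 s] fun _ => 1 := by
    filter_upwards [lt_mem_nhds hs] with t ht using step_of_ge ht.le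
  rw [h.deriv_eq, deriv_const]

lemma continuous_deriv_step : Continuous (deriv step) :=
  contDiff_step.continuous_deriv one_le_two

/-- The radial weight produced by the cutoff function `step (‖Y‖ ^ 2)`. -/
def weight (s : ℝ) : ℝ := 2 * deriv step (s ^ 2) * (s ^ 2)⁻¹ ^ 2

/-- The derivative of `step` vanishes below 1/2, so the factor s⁻⁴ is cut off before its pole. -/
lemma continuous_weight : Continuous weight := by
  rw [continuous_iff_continuousAt]
  intro s
  by_cases hs : s = 0
  · have h : weight =ᶠ[𝓝 s] fun _ => 0 := by
      have h1 : ∀ᶠ t : ℝ in 𝓝 s, t ^ 2 < 1 / 2 :=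
        (continuous_pow 2).continuousAt.eventually (gt_mem_nhds (by rw [hs]; norm_num))
      filter_upwards [h1] with t ht
      rw [weight, deriv_step_of_lt ht, mul_zero, zero_mul]
    exact continuousAt_const.congr h.symm
  · exact ((continuous_const.mul (continuous_deriv_step.comp (continuous_pow 2))).continuousAt).mul
      (((continuous_pow 2).continuousAt.inv₀ (pow_ne_zero 2 hs)).pow 2)

lemma weight_of_gt {s : ℝ} (hs : 1 < s) : weight s = 0 := by
  rw [weight, deriv_step_of_gt (one_lt_pow₀ hs two_ne_zero), mul_zero, zero_mul]

lemma continuous_weight_norm : Continuous fun Y : ℍ => weight ‖Y‖ :=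
  continuous_weight.comp continuous_norm

lemma hasCompactSupport_weight_norm : HasCompactSupport fun Y : ℍ => weight ‖Y‖ := by
  refine HasCompactSupport.intro (isCompact_closedBall (0 : ℍ) 1) fun Y hY => weight_of_gt ?_
  simpa using hY

lemma integral_deriv_step_sq : ∫ y in Set.Ioi (0 : ℝ), 2 * y * deriv step (y ^ 2) = 1 := by
  have hc : Continuous fun y : ℝ => 2 * y * deriv step (y ^ 2) :=
    (continuous_const.mul continuous_id).mul (continuous_deriv_step.comp (continuous_pow 2))
  have hs : HasCompactSupport fun y : ℝ => 2 * y * deriv step (y ^ 2) := by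
    refine HasCompactSupport.intro (isCompact_closedBall (0 : ℝ) 1) fun y hy => ?_
    have h1 : 1 < |y| := by simpa using hy
    rw [deriv_step_of_gt (by rw [← sq_abs]; exact one_lt_pow₀ h1 two_ne_zero), mul_zero]
  have h := integral_Ioi_of_hasDerivAt_of_tendsto (a := 0) (m := 1) (f := fun y : ℝ => step (y ^ 2))
    (f' := fun y : ℝ => 2 * y * deriv step (y ^ 2)) ?_ ?_
    (hc.integrable_of_hasCompactSupport hs).integrableOn ?_
  · rw [h, step_of_le (by norm_num), sub_zero]
  · exact (contDiff_step.continuous.comp (continuous_pow 2)).continuousWithinAt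
  · intro y _
    have h1 := (contDiff_step.differentiable two_ne_zero (y ^ 2)).hasDerivAt.comp y (hasDerivAt_pow 2 y)
    refine h1.congr_deriv ?_
    push_cast
    ring
  · refine tendsto_const_nhds.congr' ?_
    filter_upwards [eventually_ge_atTop (1 : ℝ)] with y hy
    exact (step_of_ge (one_le_pow₀ hy)).symm

/-- In polar coordinates the value is 4 · (π²/2), the area of the unit 3-sphere, times the total
increase 1 of s ↦ `step (s ^ 2)`. It does not depend on the shape of the transition. -/
lemma integral_weight : ∫ Y : ℍ, weight ‖Y‖ * ‖Y‖ ^ 2 = 2 * Real.pi ^ 2 := by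
  have h := integral_fun_norm_addHaar (volume : Measure ℍ) fun s => weight s * s ^ 2
  rw [h]
  have h1 : Module.finrank ℝ ℍ = 4 := finrank_quaternion
  have h2 : (volume : Measure ℍ).real (Metric.ball 0 1) = Real.pi ^ 2 / 2 := by
    rw [Measure.real, InnerProductSpace.volume_ball_of_dim_even (k := 2) (by rw [h1])]
    simp only [ENNReal.toReal_mul, h1]
    simp
    positivity
  have h3 : ∫ y in Set.Ioi (0 : ℝ), y ^ (4 - 1) • (weight y * y ^ 2) = 1 := by
    rw [← integral_deriv_step_sq]
    refine setIntegral_congr_fun measurableSet_Ioi fun y hy => ?_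
    have hy : y ≠ 0 := ne_of_gt hy
    simp only [weight, smul_eq_mul]
    field_simp
  rw [h1, h2, h3]
  simp only [nsmul_eq_mul, smul_eq_mul]
  push_cast
  ring

/-- A cutoff function vanishing near `W` and equal to `1` outside the ball of radius `r`. -/
def cutoff (W : ℍ) (r : ℝ) (Z : ℍ) : ℝ := step (r⁻¹ ^ 2 * ‖Z - W‖ ^ 2)

lemma contDiff_cutoff (W : ℍ) (r : ℝ) : ContDiff ℝ 1 (cutoff W r) :=
  (contDiff_step.of_le one_le_two).comp
    (contDiff_const.mul ((contDiff_id.sub contDiff_const).norm_sq ℝ))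

lemma cutoff_of_le {W Z : ℍ} {r : ℝ} (hr : 0 < r) (h : r ≤ ‖Z - W‖) : cutoff W r Z = 1 := by
  refine step_of_ge ?_
  rw [← mul_pow]
  exact one_le_pow₀ (by rwa [inv_mul_eq_div, one_le_div₀ hr])

lemma cutoff_eventually_eq_zero (W : ℍ) (r : ℝ) : ∀ᶠ Z in 𝓝 W, cutoff W r Z = 0 := by
  have h : Continuous fun Z : ℍ => r⁻¹ ^ 2 * ‖Z - W‖ ^ 2 := by fun_prop
  have h1 := (h.continuousAt (x := W)).eventually 
    (gt_mem_nhds (show r⁻¹ ^ 2 * ‖W - W‖ ^ 2 < 1 / 2 by simp))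
  filter_upwards [h1] with Z hZ using step_of_le hZ.le

lemma pd_cutoff (W : ℍ) (r : ℝ) (Z : ℍ) (i : Fin 4) :
    pd i (cutoff W r) Z =
      deriv step (r⁻¹ ^ 2 * ‖Z - W‖ ^ 2) * (r⁻¹ ^ 2 * (2 * coord i (Z - W))) := by
  refine fderiv_apply_eq_of_line ((contDiff_cutoff W r).differentiable one_ne_zero Z) ?_
  have h0 : Z + (0 : ℝ) • e i = Z := by simp
  have h1 : HasDerivAt (fun t : ℝ => ‖Z + t • e i - W‖ ^ 2) (2 * coord i (Z - W)) 0 := by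
    have := ((hasDerivAt_line Z (e i)).sub_const W).norm_sq
    rw [h0, real_inner_comm, ← coord_eq_inner] at this
    exact this
  have h2 := (contDiff_step.differentiable two_ne_zero
    (r⁻¹ ^ 2 * ‖Z + (0 : ℝ) • e i - W‖ ^ 2)).hasDerivAt.comp (0 : ℝ) (h1.const_mul (r⁻¹ ^ 2))
  rw [h0] at h2
  exact h2

/-! ### Blow-up at the pole and evaluation of the limit. -/

section Field

variable {E : Type*} [NormedAddCommGroup E] [NormedSpace ℝ E]
variable {A B : ℍ →ₗ[ℝ] (E →L[ℝ] E)}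

lemma kernel_smul {r : ℝ} (hr : 0 < r) (Y : ℍ) :
    kernel A B (r • Y) = (r ^ 4)⁻¹ • kernel A B Y := by
  have h1 : (‖r • Y‖ ^ 2)⁻¹ = r⁻¹ ^ 2 * (‖Y‖ ^ 2)⁻¹ := by
    rw [norm_smul, Real.norm_of_nonneg hr.le, mul_pow, mul_inv, inv_pow]
  have h2 : star (r • Y) = r • star Y := by simp
  simp only [kernel, h1, h2, map_smul, smul_mul_assoc, mul_smul_comm, smul_sub, smul_smul]
  have h3 : r ≠ 0 := hr.ne'
  congr 2
  · field_simp
  · field_simp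

lemma radialSymbol_add (X Y : ℍ) :
    radialSymbol A B (X + Y) = radialSymbol A B X + radialSymbol A B Y := by
  simp only [radialSymbol, star_add, map_add, add_mul, smul_add]
  abel

lemma radialSymbol_smul (r : ℝ) (Y : ℍ) : radialSymbol A B (r • Y) = r • radialSymbol A B Y := by
  have h2 : star (r • Y) = r • star Y := by simp
  simp only [radialSymbol, h2, map_smul, smul_mul_assoc, smul_add]
  rw [smul_comm]

lemma continuous_linearMap {R : Type*} [NormedAddCommGroup R] [NormedSpace ℝ R] (L : ℍ →ₗ[ℝ] R) :
    Continuous fun X => L X :=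
  (LinearMap.toContinuousLinearMap L).continuous

lemma continuous_radialSymbol : Continuous (radialSymbol A B) :=
  (continuous_linearMap (compStar B)).add
    (((continuous_linearMap (compStar A)).mul continuous_const).const_smul (1 / 2 : ℝ))

/-- ∇χ is radial, so `kernel_mul` applies. Homogeneity gives r⁻⁴ from the kernel and r⁻¹ from ∇χ,
and the latter is distributed over B(W + rY) = B(W) + rB(Y). -/
lemma CliffordPair.sum_pd_cutoff_smul_fluxField (h : CliffordPair A B) (f : ℍ → E) (W Y : ℍ) {r : ℝ}
    (hr : 0 < r) :
    ∑ i, pd i (cutoff W r) (W + r • Y) • fluxField A B f W i (W + r • Y) =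
      (r ^ 4)⁻¹ • weight ‖Y‖ • radialSymbol A B Y
        (r⁻¹ • B W (f (W + r • Y)) + B Y (f (W + r • Y))) := by
  have hr0 : r ≠ 0 := hr.ne'
  have h1 : r⁻¹ ^ 2 * ‖r • Y‖ ^ 2 = ‖Y‖ ^ 2 := by
    rw [norm_smul, Real.norm_of_nonneg hr.le, ← mul_pow, inv_mul_cancel_left₀ hr0]
  have h2 : ∀ i, pd i (cutoff W r) (W + r • Y) = (r⁻¹ * (2 * deriv step (‖Y‖ ^ 2))) * coord i Y := by
    intro i
    rw [pd_cutoff, add_sub_cancel_left, h1, map_smul, smul_eq_mul]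
    field_simp
  simp only [h2, mul_smul (_ * _) (coord _ _)]
  rw [← Finset.smul_sum, ← kernel_mul_eq_sum, add_sub_cancel_left]
  -- At the centre `kernel_mul` is unavailable, but there the derivative of `step` vanishes and both
  -- sides are 0.
  by_cases hY : Y = 0
  · subst hY
    simp [weight, deriv_step_of_lt]
  · rw [kernel_smul hr, smul_mul_assoc, h.kernel_mul hY, weight, map_add, map_smul]
    simp only [smul_mul_assoc, mul_apply_eq_comp, _root_.smul_apply, _root_.add_apply,
      map_add, map_smul, smul_add, smul_smul]
    congr 2
    · ring
    · field_simp

lemma integrable_weight_smul_of_continuousOn {F : ℍ → E}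
    (hF : ContinuousOn F (Metric.closedBall 0 1)) : Integrable fun Y => weight ‖Y‖ • F Y := by
  have h1 : IntegrableOn (fun Y => weight ‖Y‖ • F Y) (Metric.closedBall 0 1) :=
    (continuous_weight_norm.continuousOn.smul hF).integrableOn_compact (isCompact_closedBall _ _)
  refine (integrableOn_iff_integrable_of_support_subset fun Y hY => ?_).1 h1
  by_contra hY'
  refine hY ?_
  simp only [weight_of_gt (show 1 < ‖Y‖ by simpa using hY'), zero_smul]

/-- The Jacobian r⁴ of x = W + rY cancels r⁻⁴. The remaining r⁻¹ is tamed by inserting −f(W), which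
is free because `radialSymbol` is odd and its weighted integral against a constant vector vanishes.
-/
lemma CliffordPair.setIntegral_sum_pd_cutoff (h : CliffordPair A B) {f : ℍ → E} {W : ℍ} {r : ℝ}
    (hr : 0 < r) {U : Set ℍ} (hU : Metric.closedBall W r ⊆ U)
    (hf : ContinuousOn f (Metric.closedBall W r)) :
    ∫ x in U, ∑ i, pd i (cutoff W r) x • fluxField A B f W i x =
      ∫ Y : ℍ, weight ‖Y‖ • radialSymbol A B Y
        (B W (r⁻¹ • (f (W + r • Y) - f W)) + B Y (f (W + r • Y))) := by
  rw [setIntegral_eq_integral_of_forall_compl_eq_zero]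
  · rw [← integral_add_left_eq_self _ W]
    have h1 := Measure.integral_comp_smul (volume : Measure ℍ) (fun x => ∑ i,
      pd i (cutoff W r) (W + x) • fluxField A B f W i (W + x)) r
    rw [show Module.finrank ℝ ℍ = 4 from finrank_quaternion, abs_of_pos (by positivity)] at h1
    simp only [h.sum_pd_cutoff_smul_fluxField f W _ hr, integral_smul] at h1
    have h2 := smul_right_injective E (inv_ne_zero (pow_ne_zero 4 hr.ne')) h1
    rw [← h2]
    have h3 := integral_radial_smul_linear (H := ℍ) weight
      (E := E) (IsLinearMap.mk' (fun Y => radialSymbol A B Y (B W (r⁻¹ • f W)))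
        ⟨fun X Y => by rw [radialSymbol_add, _root_.add_apply],
          fun c X => by rw [radialSymbol_smul, _root_.smul_apply]⟩)
    simp only [IsLinearMap.mk'_apply] at h3
    have hfc : ContinuousOn (fun Y : ℍ => f (W + r • Y)) (Metric.closedBall 0 1) := by
      refine hf.comp (by fun_prop) fun Y hY => ?_
      have hY : ‖Y‖ ≤ 1 := by simpa using hY
      rw [Metric.mem_closedBall, dist_eq_norm, add_sub_cancel_left, norm_smul,
        Real.norm_of_nonneg hr.le]
      exact mul_le_of_le_one_right hr.le hY
    rw [← sub_zero (∫ Y : ℍ, _), ← h3, ← integral_sub]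
    · refine integral_congr_ae (Eventually.of_forall fun Y => ?_)
      simp only [← smul_sub, ← map_sub]
      congr 2
      rw [smul_sub, map_sub, map_smul, map_smul]
      abel
    · exact integrable_weight_smul_of_continuousOn (continuous_radialSymbol.continuousOn.clm_apply
        ((((B W).continuous.comp_continuousOn hfc).const_smul _).add
          ((continuous_linearMap B).continuousOn.clm_apply hfc)))
    · exact integrable_weight_smul_of_continuousOn
        (continuous_radialSymbol.clm_apply continuous_const).continuousOn
  · intro x hx
    refine Finset.sum_eq_zero fun i _ => ?_
    have hx1 : r < ‖x - W‖ := by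
      by_contra hx2
      exact hx (hU (by rwa [Metric.mem_closedBall, dist_eq_norm, ← not_lt]))
    rw [pd_cutoff, deriv_step_of_gt, zero_mul, zero_smul]
    rw [← mul_pow]
    exact one_lt_pow₀ (by rwa [inv_mul_eq_div, one_lt_div₀ hr]) two_ne_zero

/-- Dominated convergence: differentiability at W bounds the difference quotient by C‖Y‖, and the
weight vanishes for ‖Y‖ > 1. -/
lemma tendsto_integral_weight_smul_radialSymbol {f : ℍ → E} {W : ℍ} (hf : ContDiffAt ℝ 1 f W) :
    Tendsto (fun r : ℝ => ∫ Y : ℍ, weight ‖Y‖ • radialSymbol A B Y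
        (B W (r⁻¹ • (f (W + r • Y) - f W)) + B Y (f (W + r • Y)))) (𝓝[>] 0)
      (𝓝 (∫ Y : ℍ, weight ‖Y‖ • radialSymbol A B Y (B W (fderiv ℝ f W Y) + B Y (f W)))) := by
  have hd : DifferentiableAt ℝ f W := hf.differentiableAt one_ne_zero
  obtain ⟨C, hC⟩ := hd.hasFDerivAt.isBigO_sub.bound
  have hc : ∀ᶠ Z in 𝓝 W, ContinuousAt f Z := by
    filter_upwards [hf.eventually (by simp)] with Z hZ using hZ.continuousAt
  have hb : ∀ᶠ Z in 𝓝 W, ‖f Z‖ ≤ ‖f W‖ + 1 :=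
    (hd.continuousAt.norm.eventually (gt_mem_nhds (lt_add_one ‖f W‖))).mono fun _ h => h.le
  obtain ⟨δ, hδ, hball⟩ := Metric.eventually_nhds_iff_ball.1 (hC.and (hc.and hb))
  have hmem : ∀ r : ℝ, 0 < r → r < δ → ∀ Y : ℍ, ‖Y‖ ≤ 1 → W + r • Y ∈ Metric.ball W δ := by
    intro r hr hrδ Y hY
    rw [Metric.mem_ball, dist_eq_norm, add_sub_cancel_left, norm_smul, Real.norm_of_nonneg hr.le]
    exact (mul_le_of_le_one_right hr.le hY).trans_lt hrδ
  have hsmall : ∀ᶠ r : ℝ in 𝓝[>] 0, 0 < r ∧ r < δ :=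
    Ioo_mem_nhdsGT hδ
  let b : ℍ → ℝ := fun Y => weight ‖Y‖ •
    (‖radialSymbol A B Y‖ * (‖B W‖ * (C * ‖Y‖) + ‖B Y‖ * (‖f W‖ + 1)))
  refine tendsto_integral_filter_of_dominated_convergence (fun Y => ‖b Y‖) ?_ ?_ ?_ ?_
  · filter_upwards [hsmall] with r hr
    have hfc : ContinuousOn (fun Y : ℍ => f (W + r • Y)) (Metric.closedBall 0 1) := by
      intro Y hY
      have h1 := (hball _ (hmem r hr.1 hr.2 Y (by simpa using hY))).2.1
      exact (h1.comp (f := fun Y : ℍ => W + r • Y) (by fun_prop)).continuousWithinAt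
    exact (integrable_weight_smul_of_continuousOn (continuous_radialSymbol.continuousOn.clm_apply
      (((B W).continuous.comp_continuousOn ((hfc.sub continuousOn_const).const_smul _)).add
        ((continuous_linearMap B).continuousOn.clm_apply hfc)))).aestronglyMeasurable
  · filter_upwards [hsmall] with r hr
    refine Eventually.of_forall fun Y => ?_
    by_cases hY : ‖Y‖ ≤ 1
    · obtain ⟨h1, -, h2⟩ := hball _ (hmem r hr.1 hr.2 Y hY)
      rw [add_sub_cancel_left, norm_smul, Real.norm_of_nonneg hr.1.le] at h1
      have h3 : ‖r⁻¹ • (f (W + r • Y) - f W)‖ ≤ C * ‖Y‖ := by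
        rw [norm_smul, Real.norm_of_nonneg (inv_nonneg.2 hr.1.le), inv_mul_le_iff₀ hr.1]
        linarith
      simp only [b]
      rw [norm_smul, norm_smul]
      refine mul_le_mul_of_nonneg_left ?_ (norm_nonneg _)
      refine le_trans ?_ (le_abs_self _)
      refine ((radialSymbol A B Y).le_opNorm _).trans (mul_le_mul_of_nonneg_left ?_ (norm_nonneg _))
      refine (norm_add_le _ _).trans (add_le_add ?_ ?_)
      · exact ((B W).le_opNorm _).trans (mul_le_mul_of_nonneg_left h3 (norm_nonneg _))
      · exact ((B Y).le_opNorm _).trans (mul_le_mul_of_nonneg_left h2 (norm_nonneg _))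
    · rw [weight_of_gt (not_le.1 hY), zero_smul, norm_zero]
      exact norm_nonneg _
  · exact (integrable_weight_smul_of_continuousOn ((continuous_radialSymbol.norm.mul
      ((continuous_const.mul (continuous_const.mul continuous_norm)).add
        ((continuous_linearMap B).norm.mul continuous_const))).continuousOn)).norm
  · refine Eventually.of_forall fun Y => ?_
    have h1 : Tendsto (fun r : ℝ => r⁻¹ • (f (W + r • Y) - f W)) (𝓝[>] 0) (𝓝 (fderiv ℝ f W Y)) := by
      have := (hasDerivAt_iff_tendsto_slope_zero.1 (hasDerivAt_of_differentiableAt_line hd Y)).mono_left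
        (nhdsWithin_mono (0 : ℝ) (s := Set.Ioi 0) (fun x hx => ne_of_gt hx))
      simpa using this
    have h2 : Tendsto (fun r : ℝ => f (W + r • Y)) (𝓝[>] 0) (𝓝 (f W)) := by
      have h3 : Tendsto (fun r : ℝ => W + r • Y) (𝓝[>] 0) (𝓝 W) := by
        have : Continuous fun t : ℝ => W + t • Y := by fun_prop
        simpa using (this.tendsto 0).mono_left nhdsWithin_le_nhds
      exact hd.continuousAt.tendsto.comp h3
    exact (((radialSymbol A B Y).continuous.tendsto _).comp ((((B W).continuous.tendsto _).comp h1).add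
      (((B Y).continuous.tendsto _).comp h2))).const_smul _

/-- The contraction is a constant operator that kills f on an open set, so it kills the derivatives
of f. -/
lemma IsRegularFor.contraction_pd {f : ℍ → E} {V : Set ℍ} (hf : IsRegularFor A B f V)
    (hV : IsOpen V) {W : ℍ} (hW : W ∈ V) (j : Fin 4) : DoublyRegular.contraction A B (pd j f W) = 0 := by
  have hd : DifferentiableAt ℝ f W :=
    (hf.contDiffOn.contDiffAt (hV.mem_nhds hW)).differentiableAt one_ne_zero
  have h1 := (DoublyRegular.contraction A B).hasFDerivAt.comp_hasDerivAt (0 : ℝ)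
    (hasDerivAt_of_differentiableAt_line hd (e j))
  have h2 : (fun t : ℝ => DoublyRegular.contraction A B (f (W + t • e j))) =ᶠ[𝓝 0] fun _ => 0 := by
    have hc : ContinuousAt (fun t : ℝ => W + t • e j) 0 := by fun_prop
    have : ∀ᶠ t : ℝ in 𝓝 0, W + t • e j ∈ V :=
      hc.eventually (hV.mem_nhds (by simpa using hW))
    filter_upwards [this] with t ht using hf.contraction _ ht
  exact h1.unique ((hasDerivAt_const (0 : ℝ) (0 : E)).congr_of_eventuallyEq h2)

/-- The integrand is bilinear in Y, so its integral is (2π²/4) ΣQ(eᵢ, eᵢ). By `radialSymbol_mul` the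
derivative part sums to 4ΣWᵢ∂ᵢf; the other part contributes 4 − 1 − 1 = 2 for each of the four
units, that is 8f(W). -/
lemma CliffordPair.integral_weight_smul_radialSymbol [CompleteSpace E] (h : CliffordPair A B)
    {f : ℍ → E} {V : Set ℍ} (hf : IsRegularFor A B f V) (hV : IsOpen V) {W : ℍ} (hW : W ∈ V) :
    ∫ Y : ℍ, weight ‖Y‖ • radialSymbol A B Y (B W (fderiv ℝ f W Y) + B Y (f W)) =
      (2 * Real.pi ^ 2) • (∑ i, coord i W • pd i f W + (2 : ℝ) • f W) := by
  let Q : ℍ →ₗ[ℝ] ℍ →ₗ[ℝ] E := LinearMap.mk₂ ℝ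
    (fun X Y => radialSymbol A B X (B W (fderiv ℝ f W Y) + B Y (f W)))
    (fun X X' Y => by rw [radialSymbol_add, _root_.add_apply])
    (fun c X Y => by rw [radialSymbol_smul, _root_.smul_apply])
    (fun X Y Y' => by
      simp only [map_add, _root_.add_apply]
      abel)
    (fun c X Y => by simp only [map_smul, _root_.smul_apply, map_add, smul_add])
  have h1 := integral_radial_smul_bilinear continuous_weight_norm hasCompactSupport_weight_norm Q
  simp only [Q, LinearMap.mk₂_apply, integral_weight] at h1
  rw [h1]
  have h2 : ∀ i, radialSymbol A B (e i) (B W (fderiv ℝ f W (e i)) + B (e i) (f W)) =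
      ((4 * coord i W) • pd i f W - B (star W) (B (e i) (pd i f W))
        - A (star W) (A (e i) (pd i f W))) + (2 : ℝ) • f W := by
    intro i
    have h3 := congrArg (fun T : E →L[ℝ] E => T (pd i f W)) (h.radialSymbol_mul i W)
    have h4 := congrArg (fun T : E →L[ℝ] E => T (f W)) (h.radialSymbol_mul i (e i))
    have h5 : coord i (e i) = 1 := by rw [coord_eq_inner, inner_e, if_pos rfl]
    rw [h.star_mul_self, h.swap.star_mul_self, CliffordPair.norm_e, h5] at h4
    simp only [mul_apply_eq_comp, _root_.sub_apply, _root_.smul_apply,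
      one_apply_eq_self, hf.contraction_pd hV hW, hf.contraction W hW, map_zero,
      smul_zero, sub_zero] at h3 h4
    rw [map_add]
    change radialSymbol A B (e i) (B W (pd i f W)) + _ = _
    rw [h3, h4]
    module
  simp only [h2]
  rw [Finset.sum_add_distrib, Finset.sum_sub_distrib, Finset.sum_sub_distrib, ← map_sum, ← map_sum,
    hf.left W hW, hf.right W hW, map_zero, map_zero]
  simp only [mul_smul, Finset.sum_const, Finset.card_univ, Fintype.card_fin, sub_zero]
  rw [← Finset.smul_sum]
  module

variable {U : Set ℍ}

/-- The Cauchy-Fueter formula for a pair of commuting Clifford actions, at interior points. -/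
theorem CliffordPair.boundary_integral_of_mem [CompleteSpace E] (h : CliffordPair A B)
    (hUo : IsOpen U) (hUb : Bornology.IsBounded U) (hU : HasPiecewiseC1Boundary U) {V : Set ℍ}
    (hV : IsOpen V) (hUV : closure U ⊆ V) {f : ℍ → E} (hf : IsRegularFor A B f V) {W : ℍ}
    (hW : W ∈ U) :
    IntegrableOn (fun q => (kernel A B (q - W) * A (outwardNormal U q) * B q) (f q))
      (frontier U) μHE[3] ∧
    ∫ q in frontier U, (kernel A B (q - W) * A (outwardNormal U q) * B q) (f q) ∂μHE[3] =
      (2 * Real.pi ^ 2) • (∑ i, coord i W • pd i f W + (2 : ℝ) • f W) := by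
  have hWV : W ∈ V := hUV (subset_closure hW)
  obtain ⟨δ, hδ, hball⟩ := Metric.isOpen_iff.1 hUo W hW
  have key : ∀ r : ℝ, 0 < r → r < δ → _ := fun r hr hrδ =>
    h.boundary_integral_eq hUo hUb hU hV hUV hf (W := W) (contDiff_cutoff W r)
      (fun q hq => cutoff_of_le hr (by
        by_contra hlt
        have hqU : q ∈ U := hball (by
          rw [Metric.mem_ball, dist_eq_norm]; exact (not_le.1 hlt).trans hrδ)
        exact (hUo.inter_frontier_eq.subset ⟨hqU, hq⟩).elim))
      (fun _ => cutoff_eventually_eq_zero W r)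
  refine ⟨(key (δ / 2) (half_pos hδ) (half_lt_self hδ)).1, ?_⟩
  have hlim := tendsto_integral_weight_smul_radialSymbol (A := A) (B := B)
    (hf.contDiffOn.contDiffAt (hV.mem_nhds hWV))
  rw [h.integral_weight_smul_radialSymbol hf hV hWV] at hlim
  -- The boundary integral does not depend on r, so it equals the limit of its volume expressions as
  -- r → 0.
  refine tendsto_nhds_unique (tendsto_const_nhds.congr' ?_) hlim
  filter_upwards [Ioo_mem_nhdsGT hδ] with r hr
  have hsub : Metric.closedBall W r ⊆ U := (Metric.closedBall_subset_ball hr.2).trans hball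
  rw [(key r hr.1 hr.2).2, h.setIntegral_sum_pd_cutoff hr.1 hsub
    (hf.contDiffOn.continuousOn.mono (hsub.trans (subset_closure.trans hUV)))]

/-- The Cauchy-Fueter formula for a pair of commuting Clifford actions, at exterior points. -/
theorem CliffordPair.boundary_integral_of_notMem [CompleteSpace E] (h : CliffordPair A B)
    (hUo : IsOpen U) (hUb : Bornology.IsBounded U) (hU : HasPiecewiseC1Boundary U) {V : Set ℍ}
    (hV : IsOpen V) (hUV : closure U ⊆ V) {f : ℍ → E} (hf : IsRegularFor A B f V) {W : ℍ}
    (hW : W ∉ closure U) :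
    IntegrableOn (fun q => (kernel A B (q - W) * A (outwardNormal U q) * B q) (f q))
      (frontier U) μHE[3] ∧
    ∫ q in frontier U, (kernel A B (q - W) * A (outwardNormal U q) * B q) (f q) ∂μHE[3] = 0 := by
  have h1 := h.boundary_integral_eq hUo hUb hU hV hUV hf (W := W) (χ := fun _ => 1) contDiff_const
    (fun _ _ => rfl) (fun hW' => (hW hW').elim)
  refine ⟨h1.1, h1.2.trans ?_⟩
  simp [pd]

end Field

/-! ### The spinor actions as Clifford pairs. -/

lemma tens_mul_tens (p q p' q' : ℍ) : tens p q * tens p' q' = tens (p * p') (q * q') := by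
  rw [tens, tens, tens, map_mul, map_mul, Matrix.mul_kronecker_mul]

lemma tens_one_one : tens 1 1 = 1 := by
  rw [tens, map_one, Matrix.one_kronecker_one]

/-- The left action of `ℍ_ℂ ⊗ ℍ_ℂ` on `𝕊 ⊗ 𝕊`. -/
def leftAction : Mat4 →ₗ[ℝ] (Spinor2 →L[ℝ] Spinor2) where
  toFun M := LinearMap.toContinuousLinearMap ((Matrix.mulVecLin M).restrictScalars ℝ)
  map_add' M N := by ext1 t; exact Matrix.add_mulVec M N t
  map_smul' r M := by ext1 t; exact Matrix.smul_mulVec r M t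

/-- The right action of `ℍ_ℂ ⊗ ℍ_ℂ` on `𝕊' ⊗ 𝕊'`. -/
def rightAction : Mat4 →ₗ[ℝ] (Spinor2 →L[ℝ] Spinor2) where
  toFun M := LinearMap.toContinuousLinearMap ((Matrix.vecMulLinear M).restrictScalars ℝ)
  map_add' M N := by ext1 t; exact Matrix.vecMul_add M N t
  map_smul' r M := by ext1 t; exact Matrix.vecMul_smul t r M

lemma leftAction_apply (M : Mat4) (t : Spinor2) : leftAction M t = M *ᵥ t := rfl

lemma rightAction_apply (M : Mat4) (t : Spinor2) : rightAction M t = t ᵥ* M := rfl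

lemma leftAction_mul (M N : Mat4) : leftAction M * leftAction N = leftAction (M * N) := by
  ext1 t; exact Matrix.mulVec_mulVec t M N

lemma rightAction_mul (M N : Mat4) : rightAction M * rightAction N = rightAction (N * M) := by
  ext1 t; exact Matrix.vecMul_vecMul t N M

lemma leftAction_one : leftAction 1 = 1 := by
  ext1 t; exact Matrix.one_mulVec t

lemma rightAction_one : rightAction 1 = 1 := by
  ext1 t; exact Matrix.vecMul_one t

lemma star_mul_add_star_mul (p q : ℍ) : star p * q + star q * p = ((2 * inner ℝ p q : ℝ) : ℍ) := by
  apply Quaternion.ext <;> simp [Quaternion.inner_def] <;> ring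

/-- The right action reverses products, so its Clifford relation needs the factors in the opposite
order. -/
lemma mul_star_add_mul_star (p q : ℍ) : q * star p + p * star q = ((2 * inner ℝ p q : ℝ) : ℍ) := by
  apply Quaternion.ext <;> simp [Quaternion.inner_def] <;> ring

lemma tensRight_coe (r : ℝ) : tensRight 1 (r : ℍ) = r • 1 := by
  rw [← tens_one_one, show (r : ℍ) = r • (1 : ℍ) by apply Quaternion.ext <;> simp, map_smul]
  rfl

lemma tensLeft_coe (r : ℝ) : tensLeft 1 (r : ℍ) = r • 1 := by
  rw [← tens_one_one, show (r : ℍ) = r • (1 : ℍ) by apply Quaternion.ext <;> simp, map_smul]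
  rfl

lemma tensRight_mul (p q : ℍ) : tensRight 1 p * tensRight 1 q = tensRight 1 (p * q) :=
  (tens_mul_tens _ _ _ _).trans (by rw [one_mul]; rfl)

lemma tensLeft_mul (p q : ℍ) : tensLeft 1 p * tensLeft 1 q = tensLeft 1 (p * q) :=
  (tens_mul_tens _ _ _ _).trans (by rw [one_mul]; rfl)

lemma tensRight_mul_tensLeft (p q : ℍ) : tensRight 1 p * tensLeft 1 q = tens p q :=
  (tens_mul_tens _ _ _ _).trans (by rw [one_mul, mul_one])

lemma tensLeft_mul_tensRight (p q : ℍ) : tensLeft 1 q * tensRight 1 p = tens p q :=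
  (tens_mul_tens _ _ _ _).trans (by rw [one_mul, mul_one])

lemma cliffordPair_leftAction :
    CliffordPair (leftAction ∘ₗ tensRight 1) (leftAction ∘ₗ tensLeft 1) where
  comm p q := by
    simp only [LinearMap.comp_apply, leftAction_mul, tensRight_mul_tensLeft, tensLeft_mul_tensRight]
  left p q := by
    simp only [LinearMap.comp_apply, leftAction_mul, tensRight_mul]
    rw [← map_add, ← map_add, star_mul_add_star_mul, tensRight_coe, map_smul, leftAction_one]
  right p q := by
    simp only [LinearMap.comp_apply, leftAction_mul, tensLeft_mul]
    rw [← map_add, ← map_add, star_mul_add_star_mul, tensLeft_coe, map_smul, leftAction_one]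

lemma cliffordPair_rightAction :
    CliffordPair (rightAction ∘ₗ tensRight 1) (rightAction ∘ₗ tensLeft 1) where
  comm p q := by
    simp only [LinearMap.comp_apply, rightAction_mul, tensRight_mul_tensLeft,
      tensLeft_mul_tensRight]
  left p q := by
    simp only [LinearMap.comp_apply, rightAction_mul, tensRight_mul]
    rw [← map_add, ← map_add, mul_star_add_mul_star, tensRight_coe, map_smul, rightAction_one]
  right p q := by
    simp only [LinearMap.comp_apply, rightAction_mul, tensLeft_mul]
    rw [← map_add, ← map_add, mul_star_add_mul_star, tensLeft_coe, map_smul, rightAction_one]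

/-- Σ eᵢ ⊗ eᵢ is twice the difference of the identity and the swap of the two factors. This is where
symmetry of the values of f enters. -/
lemma sum_tens_mulVec {t : Spinor2} (ht : IsSymmTensor t) : (∑ i, tens (e i) (e i)) *ᵥ t = 0 := by
  have h := ht 0 1
  ext ⟨a, b⟩
  fin_cases a <;> fin_cases b <;>
    simp [Fin.sum_univ_four, tens, toMat, e, Matrix.mulVec, dotProduct, Fintype.sum_prod_type,
      Matrix.add_apply, Matrix.kroneckerMap_apply, h] <;> ring

lemma vecMul_sum_tens {t : Spinor2} (ht : IsSymmTensor t) : t ᵥ* (∑ i, tens (e i) (e i)) = 0 := by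
  have h := ht 0 1
  ext ⟨a, b⟩
  fin_cases a <;> fin_cases b <;>
    simp [Fin.sum_univ_four, tens, toMat, e, Matrix.vecMul, dotProduct, Fintype.sum_prod_type,
      Matrix.add_apply, Matrix.kroneckerMap_apply, h] <;> ring

lemma contraction_leftAction : contraction (leftAction ∘ₗ tensRight 1) (leftAction ∘ₗ tensLeft 1) =
    leftAction (∑ i, tens (e i) (e i)) := by
  simp only [contraction, LinearMap.comp_apply, leftAction_mul, tensRight_mul_tensLeft, map_sum]

lemma contraction_rightAction :
    contraction (rightAction ∘ₗ tensRight 1) (rightAction ∘ₗ tensLeft 1) =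
      rightAction (∑ i, tens (e i) (e i)) := by
  simp only [contraction, LinearMap.comp_apply, rightAction_mul, tensLeft_mul_tensRight, map_sum]

lemma CliffordPair.contraction_swap {R : Type*} [Ring R] [Algebra ℝ R] {A B : ℍ →ₗ[ℝ] R}
    (h : CliffordPair A B) : contraction B A = contraction A B := by
  simp only [contraction, h.comm]

lemma CliffordPair.kernel_swap {R : Type*} [Ring R] [Algebra ℝ R] {A B : ℍ →ₗ[ℝ] R}
    (h : CliffordPair A B) (X : ℍ) : kernel B A X = kernel A B X := by
  simp only [kernel, contractionStarStar, h.comm]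

lemma CliffordPair.isRegularFor_swap {E : Type*} [NormedAddCommGroup E] [NormedSpace ℝ E]
    {A B : ℍ →ₗ[ℝ] (E →L[ℝ] E)} (h : CliffordPair A B) {f : ℍ → E} {V : Set ℍ}
    (hf : IsRegularFor A B f V) : IsRegularFor B A f V :=
  ⟨hf.contDiffOn, by rw [h.contraction_swap]; exact hf.contraction, hf.right, hf.left⟩

lemma DoublyLeftRegularOn.isRegularFor {f : ℍ → Spinor2} {V : Set ℍ}
    (hf : DoublyLeftRegularOn f V) :
    IsRegularFor (leftAction ∘ₗ tensRight 1) (leftAction ∘ₗ tensLeft 1) f V where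
  contDiffOn := hf.contDiffOn
  contraction Z hZ := by
    rw [contraction_leftAction, leftAction_apply, sum_tens_mulVec (hf.symm Z hZ)]
  left := hf.left
  right := hf.right

lemma DoublyRightRegularOn.isRegularFor {f : ℍ → Spinor2} {V : Set ℍ}
    (hf : DoublyRightRegularOn f V) :
    IsRegularFor (rightAction ∘ₗ tensRight 1) (rightAction ∘ₗ tensLeft 1) f V where
  contDiffOn := hf.contDiffOn
  contraction Z hZ := by
    rw [contraction_rightAction, rightAction_apply, vecMul_sum_tens (hf.symm Z hZ)]
  left := hf.left
  right := hf.right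

/-! ### The closed form of k₁. -/

lemma hasDerivAt_inv_norm_sq {X : ℍ} (hX : X ≠ 0) (i : Fin 4) :
    HasDerivAt (fun t : ℝ => (‖X + t • e i‖ ^ 2)⁻¹) (-2 * coord i X * (‖X‖ ^ 2)⁻¹ ^ 2) 0 := by
  have h0 : X + (0 : ℝ) • e i = X := by simp
  have h1 : HasDerivAt (fun t : ℝ => ‖X + t • e i‖ ^ 2) (2 * coord i X) 0 := by
    have := (hasDerivAt_line X (e i)).norm_sq
    rw [h0, real_inner_comm, ← coord_eq_inner] at this
    exact this
  refine (h1.fun_inv (by rw [h0]; simpa using hX)).congr_deriv ?_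
  rw [h0, div_eq_mul_inv, inv_pow]
  ring

lemma contDiffAt_inv_norm_sq {n : WithTop ℕ∞} {X : ℍ} (hX : X ≠ 0) :
    ContDiffAt ℝ n (fun X : ℍ => (‖X‖ ^ 2)⁻¹) X :=
  (contDiff_norm_sq ℝ).contDiffAt.inv (by simpa using hX)

lemma pd_one_div_normSq {X : ℍ} (hX : X ≠ 0) (j : Fin 4) :
    pd j (fun Y : ℍ => 1 / Quaternion.normSq Y) X = -2 * coord j X * (‖X‖ ^ 2)⁻¹ ^ 2 := by
  have h : (fun Y : ℍ => 1 / Quaternion.normSq Y) = fun Y : ℍ => (‖Y‖ ^ 2)⁻¹ := by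
    funext Y
    rw [Quaternion.normSq_eq_norm_mul_self, one_div, sq]
  rw [h]
  exact fderiv_apply_eq_of_line ((contDiffAt_inv_norm_sq (n := 1) hX).differentiableAt one_ne_zero)
    (hasDerivAt_inv_norm_sq hX j)

lemma pd_pd_one_div_normSq {X : ℍ} (hX : X ≠ 0) (i j : Fin 4) :
    pd i (pd j fun Y : ℍ => 1 / Quaternion.normSq Y) X =
      8 * (‖X‖ ^ 2)⁻¹ ^ 3 * (coord i X * coord j X) -
        (2 * (‖X‖ ^ 2)⁻¹ ^ 2) * (if i = j then 1 else 0) := by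
  have h1 : (pd j fun Y : ℍ => 1 / Quaternion.normSq Y) =ᶠ[𝓝 X]
      fun Y => -2 * coord j Y * (‖Y‖ ^ 2)⁻¹ ^ 2 := by
    filter_upwards [isOpen_ne.mem_nhds hX] with Y hY using pd_one_div_normSq hY j
  have h2 : ContDiffAt ℝ 1 (fun Y : ℍ => -2 * coord j Y * (‖Y‖ ^ 2)⁻¹ ^ 2) X :=
    (contDiffAt_const.mul (contDiff_linearMap (coord j)).contDiffAt).mul
      ((contDiffAt_inv_norm_sq hX).pow 2)
  rw [pd, h1.fderiv_eq]
  refine fderiv_apply_eq_of_line (h2.differentiableAt one_ne_zero) ?_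
  have h3 := ((hasDerivAt_linearMap_line (coord j) X (e i)).const_mul (-2)).fun_mul
    ((hasDerivAt_inv_norm_sq hX i).fun_pow 2)
  refine h3.congr_deriv ?_
  have h0 : X + (0 : ℝ) • e i = X := by simp
  have h4 : coord j (e i) = if i = j then 1 else 0 := by
    rw [coord_eq_inner, inner_e]
    simp only [eq_comm]
  rw [h0, h4]
  push_cast
  ring

lemma sum_coord_smul_tens (X : ℍ) :
    ∑ i, ∑ j, (coord i X * coord j X) • tens (star (e i)) (star (e j)) =
      tens (star X) (star X) := by
  have h1 := sum_coord_smul_map_star (tensRight (star X)) X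
  have h2 : ∀ i, ∑ j, coord j X • tens (star (e i)) (star (e j)) = tens (star (e i)) (star X) :=
    fun i => sum_coord_smul_map_star (tensLeft (star (e i))) X
  simp only [mul_smul, ← Finset.smul_sum, h2]
  exact h1

/-- One quarter of the Hessian 8xᵢxⱼ/N³ − 2δᵢⱼ/N² of 1/N, contracted with eᵢ⁺ ⊗ eⱼ⁺. -/
lemma k₁_eq {X : ℍ} (hX : X ≠ 0) :
    k₁ X = (2 * (‖X‖ ^ 2)⁻¹ ^ 3) • tens (star X) (star X) -
      (1 / 2 * (‖X‖ ^ 2)⁻¹ ^ 2) • ∑ i, tens (star (e i)) (star (e i)) := by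
  simp only [k₁, pd_pd_one_div_normSq hX, sub_smul, Finset.sum_sub_distrib, mul_smul _ (_ * _),
    mul_smul _ (ite _ _ _), ite_smul, one_smul, zero_smul, smul_ite, smul_zero, Finset.sum_ite_eq,
    Finset.mem_univ, if_true, ← Finset.smul_sum, sum_coord_smul_tens]
  module

lemma kernel_eq_map_k₁ {R : Type*} [Ring R] [Algebra ℝ R] {A B : ℍ →ₗ[ℝ] R} (Φ : Mat4 →ₗ[ℝ] R)
    (h : ∀ p q, A p * B q = Φ (tens p q)) {X : ℍ} (hX : X ≠ 0) : kernel A B X = Φ (k₁ X) := by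
  simp only [kernel, contractionStarStar, h, k₁_eq hX, map_sub, map_smul, map_sum]

/-! ### Boundary densities and the final assembly. -/

lemma Dz_tangentFrame {n : ℍ} (hn : ‖n‖ = 1) : Dz (tangentFrame n) = n := by
  have h : n.re ^ 2 + n.imI ^ 2 + n.imJ ^ 2 + n.imK ^ 2 = 1 := by
    rw [← Quaternion.normSq_def', Quaternion.normSq_eq_norm_mul_self, hn, one_mul]
  have h1 : n * e 1 = quat (-n.imI) (n.re) (n.imK) (-n.imJ) := by
    apply Quaternion.ext <;> simp [e]
  have h2 : n * e 2 = quat (-n.imJ) (-n.imK) (n.re) (n.imI) := by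
    apply Quaternion.ext <;> simp [e]
  have h3 : n * e 3 = quat (-n.imK) (n.imJ) (-n.imI) (n.re) := by
    apply Quaternion.ext <;> simp [e]
  -- The coefficients of Dz on the frame are its signed 3 × 3 minors, a generalized cross product.
  -- Each minor equals a component of n times ‖n‖² = 1.
  have hd : ∀ a b c, dx3 a b c (tangentFrame n) =
      (Matrix.of fun k : Fin 3 => ![coord a (tangentFrame n k), coord b (tangentFrame n k),
        coord c (tangentFrame n k)] : Matrix (Fin 3) (Fin 3) ℝ).det := by
    intro a b c
    refine congrArg (Matrix.det (n := Fin 3) (R := ℝ)) ?_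
    ext k l
    fin_cases l <;> rfl
  have c0 : ∀ p, coord 0 p = p.re := fun _ => rfl
  have c1 : ∀ p, coord 1 p = p.imI := fun _ => rfl
  have c2 : ∀ p, coord 2 p = p.imJ := fun _ => rfl
  have c3 : ∀ p, coord 3 p = p.imK := fun _ => rfl
  have hD : Dz (tangentFrame n) = dx3 1 2 3 (tangentFrame n) • e 0 -
      dx3 0 2 3 (tangentFrame n) • e 1 + dx3 0 1 3 (tangentFrame n) • e 2 -
      dx3 0 1 2 (tangentFrame n) • e 3 := rfl
  rw [hD, hd, hd, hd, hd]
  simp only [Matrix.det_fin_three, Matrix.of_apply, tangentFrame, h1, h2, h3, c0, c1, c2, c3,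
    Matrix.cons_val_zero, Matrix.cons_val_one, Matrix.cons_val, quat_re, quat_imI, quat_imJ,
    quat_imK]
  apply Quaternion.ext <;> simp [e]
  · linear_combination n.re * h
  · linear_combination n.imI * h
  · linear_combination n.imJ * h
  · linear_combination n.imK * h

/-- At points without a normal the frame is zero and so are both sides, so no exceptional set needs
to be carried along. -/
lemma Dz_tangentFrame_outwardNormal (U : Set ℍ) (p : ℍ) :
    Dz (tangentFrame (outwardNormal U p)) = outwardNormal U p := by
  by_cases h : ∃ n, IsOutwardUnitNormal U p n
  · exact Dz_tangentFrame (isOutwardUnitNormal_outwardNormal h).1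
  · have h0 : outwardNormal U p = 0 := by rw [outwardNormal, dif_neg h]
    rw [h0]
    exact Dz.map_coord_zero 0 (by simp [tangentFrame])

lemma leftForm_density (U : Set ℍ) (ω : ℍ → ℍ [⋀^Fin 3]→ₗ[ℝ] Mat4) (f : ℍ → Spinor2) (W q : ℍ) :
    boundaryDensity U (leftForm ω f W) q =
      (leftAction (k₁ (q - W)) * leftAction (ω q (tangentFrame (outwardNormal U q)))) (f q) := by
  rw [leftAction_mul]
  rfl

lemma rightForm_density (U : Set ℍ) (ω : ℍ → ℍ [⋀^Fin 3]→ₗ[ℝ] Mat4) (g : ℍ → Spinor2) (W q : ℍ) :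
    boundaryDensity U (rightForm ω g W) q =
      (rightAction (k₁ (q - W)) * rightAction (ω q (tangentFrame (outwardNormal U q)))) (g q) := by
  rw [rightAction_mul]
  rfl

lemma DzTensZ_tangentFrame (U : Set ℍ) (q : ℍ) :
    DzTensZ q (tangentFrame (outwardNormal U q)) = tens (outwardNormal U q) q :=
  congrArg (tens · q) (Dz_tangentFrame_outwardNormal U q)

lemma ZTensDz_tangentFrame (U : Set ℍ) (q : ℍ) :
    ZTensDz q (tangentFrame (outwardNormal U q)) = tens q (outwardNormal U q) :=
  congrArg (tens q ·) (Dz_tangentFrame_outwardNormal U q)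

/-- The Cauchy-Fueter formula for a 3-form whose density comes from a pair of Clifford actions. -/
theorem CliffordPair.cauchyFueter {A B : ℍ →ₗ[ℝ] (Spinor2 →L[ℝ] Spinor2)} (h : CliffordPair A B)
    {U : Set ℍ} (hUo : IsOpen U) (hUb : Bornology.IsBounded U) (hU : HasPiecewiseC1Boundary U)
    {V : Set ℍ} (hV : IsOpen V) (hUV : closure U ⊆ V) {f : ℍ → Spinor2}
    (hf : IsRegularFor A B f V) {W : ℍ} {ω : ℍ → ℍ [⋀^Fin 3]→ₗ[ℝ] Spinor2}
    (hω : ∀ q, q ≠ W → boundaryDensity U ω q =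
      (kernel A B (q - W) * A (outwardNormal U q) * B q) (f q)) :
    (W ∈ U → BoundaryIntegrable U ω ∧
      (1 / (2 * Real.pi ^ 2)) • boundaryIntegral U ω = degAddTwo f W) ∧
    (W ∉ closure U → BoundaryIntegrable U ω ∧
      (1 / (2 * Real.pi ^ 2)) • boundaryIntegral U ω = 0) := by
  have hm : MeasurableSet (frontier U) := isClosed_frontier.measurableSet
  have transfer : W ∉ frontier U → Set.EqOn (boundaryDensity U ω)
      (fun q => (kernel A B (q - W) * A (outwardNormal U q) * B q) (f q)) (frontier U) :=
    fun hW q hq => hω q (by rintro rfl; exact hW hq)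
  constructor
  · intro hW
    have hfr := transfer fun hq => (hUo.inter_frontier_eq.subset ⟨hW, hq⟩).elim
    obtain ⟨h1, h2⟩ := h.boundary_integral_of_mem hUo hUb hU hV hUV hf hW
    refine ⟨(integrableOn_congr_fun hfr hm).2 h1, ?_⟩
    rw [boundaryIntegral, setIntegral_congr_fun hm hfr, h2, smul_smul,
      one_div_mul_cancel (by positivity), one_smul, degAddTwo]
  · intro hW
    have hfr := transfer fun hq => hW (frontier_subset_closure hq)
    obtain ⟨h1, h2⟩ := h.boundary_integral_of_notMem hUo hUb hU hV hUV hf hW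
    refine ⟨(integrableOn_congr_fun hfr hm).2 h1, ?_⟩
    rw [boundaryIntegral, setIntegral_congr_fun hm hfr, h2, smul_zero]

lemma kernel_leftAction {X : ℍ} (hX : X ≠ 0) :
    kernel (leftAction ∘ₗ tensRight 1) (leftAction ∘ₗ tensLeft 1) X = leftAction (k₁ X) :=
  kernel_eq_map_k₁ leftAction (fun p q => by
    simp only [LinearMap.comp_apply, leftAction_mul, tensRight_mul_tensLeft]) hX

lemma kernel_rightAction {X : ℍ} (hX : X ≠ 0) :
    kernel (rightAction ∘ₗ tensRight 1) (rightAction ∘ₗ tensLeft 1) X = rightAction (k₁ X) :=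
  kernel_eq_map_k₁ rightAction (fun p q => by
    simp only [LinearMap.comp_apply, rightAction_mul, tensLeft_mul_tensRight]) hX

end DoublyRegular

end

theorem mainTheorem1 (U : Set ℍ) (hU_open : IsOpen U) (hU_bdd : Bornology.IsBounded U)
    (hU : DoublyRegular.HasPiecewiseC1Boundary U) (V : Set ℍ) (hV_open : IsOpen V)
    (hUV : closure U ⊆ V) :
    (∀ f : ℍ → DoublyRegular.Spinor2, DoublyRegular.DoublyLeftRegularOn f V →
      ∀ ω ∈ ({DoublyRegular.DzTensZ, DoublyRegular.ZTensDz} :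
          Set (ℍ → ℍ [⋀^Fin 3]→ₗ[ℝ] DoublyRegular.Mat4)), ∀ W : ℍ,
        (W ∈ U →
          DoublyRegular.BoundaryIntegrable U (DoublyRegular.leftForm ω f W) ∧
          (1 / (2 * Real.pi ^ 2)) •
            DoublyRegular.boundaryIntegral U (DoublyRegular.leftForm ω f W) =
              DoublyRegular.degAddTwo f W) ∧
        (W ∉ closure U →
          DoublyRegular.BoundaryIntegrable U (DoublyRegular.leftForm ω f W) ∧
          (1 / (2 * Real.pi ^ 2)) •
            DoublyRegular.boundaryIntegral U (DoublyRegular.leftForm ω f W) = 0)) ∧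
    (∀ g : ℍ → DoublyRegular.Spinor2, DoublyRegular.DoublyRightRegularOn g V →
      ∀ ω ∈ ({DoublyRegular.DzTensZ, DoublyRegular.ZTensDz} :
          Set (ℍ → ℍ [⋀^Fin 3]→ₗ[ℝ] DoublyRegular.Mat4)), ∀ W : ℍ,
        (W ∈ U →
          DoublyRegular.BoundaryIntegrable U (DoublyRegular.rightForm ω g W) ∧
          (1 / (2 * Real.pi ^ 2)) •
            DoublyRegular.boundaryIntegral U (DoublyRegular.rightForm ω g W) =
              DoublyRegular.degAddTwo g W) ∧
        (W ∉ closure U →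
          DoublyRegular.BoundaryIntegrable U (DoublyRegular.rightForm ω g W) ∧
          (1 / (2 * Real.pi ^ 2)) •
            DoublyRegular.boundaryIntegral U (DoublyRegular.rightForm ω g W) = 0)) := by
  open DoublyRegular in
  refine ⟨fun f hf ω hω W => ?_, fun g hg ω hω W => ?_⟩
  · have h := cliffordPair_leftAction
    rcases hω with rfl | rfl
    · refine h.cauchyFueter hU_open hU_bdd hU hV_open hUV hf.isRegularFor fun q hq => ?_
      rw [leftForm_density, DzTensZ_tangentFrame, kernel_leftAction (sub_ne_zero.2 hq), mul_assoc]
      simp only [LinearMap.comp_apply, leftAction_mul, tensRight_mul_tensLeft]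
    -- For Z ⊗ Dz the normal enters through the second factor. The kernel and the regularity
    -- conditions are symmetric in A and B, so exchanging the two actions reduces this to the
    -- previous case.
    · refine h.swap.cauchyFueter hU_open hU_bdd hU hV_open hUV (h.isRegularFor_swap hf.isRegularFor)
        fun q hq => ?_
      rw [leftForm_density, ZTensDz_tangentFrame, h.kernel_swap,
        kernel_leftAction (sub_ne_zero.2 hq), mul_assoc]
      simp only [LinearMap.comp_apply, leftAction_mul, tensLeft_mul_tensRight]
  · have h := cliffordPair_rightAction
    rcases hω with rfl | rfl
    · refine h.cauchyFueter hU_open hU_bdd hU hV_open hUV hg.isRegularFor fun q hq => ?_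
      rw [rightForm_density, DzTensZ_tangentFrame, kernel_rightAction (sub_ne_zero.2 hq), mul_assoc]
      simp only [LinearMap.comp_apply, rightAction_mul, tensLeft_mul_tensRight]
    · refine h.swap.cauchyFueter hU_open hU_bdd hU hV_open hUV (h.isRegularFor_swap hg.isRegularFor)
        fun q hq => ?_
      rw [rightForm_density, ZTensDz_tangentFrame, h.kernel_swap,
        kernel_rightAction (sub_ne_zero.2 hq), mul_assoc]
      simp only [LinearMap.comp_apply, rightAction_mul, tensRight_mul_tensLeft]
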